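/- Let $\kappa_0,\kappa_1,\kappa_t,\kappa_\infty\in\mathbb C$ and put $E(t,\lambda)=\lambda(\lambda-1)(\lambda-t)$, $F(t,\lambda)=\kappa_0(\lambda-1)(\lambda-t)+\kappa_1\lambda(\lambda-t)+(\kappa_t+1)\lambda(\lambda-1)$, $G=\tfrac12\left[(\kappa_0+\kappa_1+\kappa_t+1)^2-\kappa_\infty^2\right]$. Consider the sixth Painlevé foliation in the chart at infinity, $$\frac{dt}{d\lambda}=\frac{t(t-1)\mu}{2E+F\mu},\qquad \frac{d\mu}{d\lambda}=\frac{(E_\lambda+F_\lambda\mu+G\mu^2)\mu}{2E+F\mu}.$$ Let $c\in\mathbb C\setminus\{0,1\}$. The first variational equation of this system along the leaf $D_0(c)=\{t=c,\ \mu=0\}$ is the linear system on $\mathbb C\setminus\{0,1,c\}$ $$\frac{d}{d\lambda}\begin{pmatrix}\eta\\ \xi\end{pmatrix}= \begin{pmatrix}0& \frac{c(c-1)}{2E(c,\lambda)}\\ 0&\frac{E_\lambda(c,\lambda)}{2E(c,\lambda)}\end{pmatrix} \begin{pmatrix}\eta\\ \xi\end{pmatrix}.$$ Let $$\Pi_1=\int_0^1\frac{c(c-1)\,d\lambda}{\sqrt{\lambda(\lambda-1)(\lambda-c)}},\qquad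 \Pi_2=\int_0^c\frac{c(c-1)\,d\lambda}{\sqrt{\lambda(\lambda-1)(\lambda-c)}}$$ (integrals along straight segments; if the third branch point lies inside a segment, the branch of the root is continued past it on one side). Then: (1) $\Pi_1,\Pi_2$ are fundamental periods of the elliptic curve $y^2=\lambda(\lambda-1)(\lambda-c)$: the set of integrals of the holomorphic form $\frac{c(c-1)\,d\lambda}{2y}$ over closed loops on the curve is $\mathbb Z\Pi_1+\mathbb Z\Pi_2$. They are linearly independent over $\mathbb R$. (2) For every base point $P\in\mathbb C\setminus\{0,1,c\}$, a germ at $P$ of the multivalued matrix $$X(\lambda)=\begin{pmatrix}\int_0^\lambda\frac{c(c-1)\,d\lambda}{2\sqrt{\lambda(\lambda-1)(\lambda-c)}}&1\\ \sqrt{\lambda(\lambda-1)(\lambda-c)}&0\end{pmatrix}$$ exists, and every such germ is a fundamental matrix of the first variational equation. With respect to it, the monodromy group with base point $P$, that is, the group of all matrices $T$ such that $X$ becomes $XT$ after analytic continuation along some closed path in $\mathbb C\setminus\{0,1,c\}$ based at $P$, is $$\left\{\begin{pmatrix}\pm1&0\\ p\,\Pi_1+q\,\Pi_2&1\end{pmatrix}: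 p,q\in\mathbb Z\right\}.$$ (3) With respect to an arbitrary fundamental matrix at $P$, the monodromy group is conjugate in $GL_2(\mathbb C)$ to the group in (2), and it is isomorphic to the semidirect product $\mathbb Z^2\rtimes\mathbb Z/2\mathbb Z$, in which the generator of $\mathbb Z/2\mathbb Z$ acts on $\mathbb Z^2$ by $v\mapsto -v$. -/

import Mathlib

open Filter Topology

namespace PainleveVI

noncomputable section

/-! ## The sixth Painleve foliation near the vertical leaves and its linearization -/

/-- The polynomial `E(t, l) = l (l - 1) (l - t)`. -/
def E (t l : ℂ) : ℂ := l * (l - 1) * (l - t)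

/-- The polynomial `F(t, l)`, with parameters `k0`, `k1`, `kt`. -/
def F (k0 k1 kt t l : ℂ) : ℂ :=
  k0 * (l - 1) * (l - t) + k1 * l * (l - t) + (kt + 1) * l * (l - 1)

/-- The constant `κ = ((k0 + k1 + kt + 1)^2 - kinf^2) / 2`. -/
def G (k0 k1 kt kinf : ℂ) : ℂ := ((k0 + k1 + kt + 1) ^ 2 - kinf ^ 2) / 2

/-- The Painleve VI foliation in the chart at infinity, with `l` (that is, `λ`) as independent
variable and unknown `v = (t, μ)`, written as `dv/dl = foliationField … l v`. The line
`D₀(c) : t = c, μ = 0` is a solution for every `c ≠ 0, 1`. -/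
def foliationField (k0 k1 kt kinf l : ℂ) (v : Fin 2 → ℂ) : Fin 2 → ℂ :=
  ![v 0 * (v 0 - 1) * v 1 / (2 * E (v 0) l + F k0 k1 kt (v 0) l * v 1),
    (deriv (E (v 0)) l + deriv (F k0 k1 kt (v 0)) l * v 1 + G k0 k1 kt kinf * v 1 ^ 2) * v 1 /
      (2 * E (v 0) l + F k0 k1 kt (v 0) l * v 1)]

/-- The coefficient matrix of the first variational equation along `D₀(c)`: the Jacobian matrix of
the field with respect to `(t, μ)` at `(c, 0)`. -/
def variationalMatrix (k0 k1 kt kinf c l : ℂ) : Matrix (Fin 2) (Fin 2) ℂ :=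
  LinearMap.toMatrix'
    (fderiv ℂ (foliationField k0 k1 kt kinf l) ![c, 0] : (Fin 2 → ℂ) →ₗ[ℂ] (Fin 2 → ℂ))

/-- The affine line `D₀(c)` with the singular points of the foliation removed. -/
def puncturedLine (c : ℂ) : Set ℂ := {0, 1, c}ᶜ

/-! ## Linear systems, analytic continuation and monodromy -/

/-- `X` is (a germ at `P` of) a fundamental matrix of solutions of `X' = A X`. -/
def IsFundamentalMatrix (A : ℂ → Matrix (Fin 2) (Fin 2) ℂ) (P : ℂ)
    (X : ℂ → Matrix (Fin 2) (Fin 2) ℂ) : Prop :=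
  (∀ᶠ z in 𝓝 P, ∀ i j, HasDerivAt (fun w => X w i j) ((A z * X z) i j) z) ∧ (X P).det ≠ 0

/-- `Φ t`, for `t ∈ S`, is a family of holomorphic germs at the points `γ t` which are analytic
continuations of each other along the curve `γ`. -/
def IsContinuation (S : Set unitInterval) (γ : unitInterval → ℂ)
    (Φ : unitInterval → ℂ → Matrix (Fin 2) (Fin 2) ℂ) : Prop :=
  (∀ t ∈ S, ∀ i j, AnalyticAt ℂ (fun z => Φ t z i j) (γ t)) ∧
    ∀ t ∈ S, ∀ᶠ s in 𝓝[S] t, Φ s =ᶠ[𝓝 (γ s)] Φ t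

/-- The germ `X` at the initial point of the path `γ` has the germ `Y` at its end point as
analytic continuation along `γ`. -/
def ContinuesTo {P Q : ℂ} (γ : Path P Q) (X Y : ℂ → Matrix (Fin 2) (Fin 2) ℂ) : Prop :=
  ∃ Φ, IsContinuation Set.univ γ Φ ∧ Φ 0 =ᶠ[𝓝 P] X ∧ Φ 1 =ᶠ[𝓝 Q] Y

theorem ContinuesTo.symm {P Q : ℂ} {γ : Path P Q} {X Y : ℂ → Matrix (Fin 2) (Fin 2) ℂ}
    (h : ContinuesTo γ X Y) : ContinuesTo γ.symm Y X := by
  obtain ⟨Φ, ⟨ha, hc⟩, h0, h1⟩ := h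
  refine ⟨fun t => Φ (unitInterval.symm t), ⟨fun t _ => ha _ trivial, fun t _ => ?_⟩,
    by simpa using h1, by simpa using h0⟩
  have hc' := hc (unitInterval.symm t) trivial
  rw [nhdsWithin_univ] at hc' ⊢
  exact (unitInterval.continuous_symm.tendsto t).eventually hc'

theorem ContinuesTo.mul_right {P Q : ℂ} {γ : Path P Q} {X Y : ℂ → Matrix (Fin 2) (Fin 2) ℂ}
    (h : ContinuesTo γ X Y) (T : Matrix (Fin 2) (Fin 2) ℂ) :
    ContinuesTo γ (fun z => X z * T) (fun z => Y z * T) := by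
  obtain ⟨Φ, ⟨ha, hc⟩, h0, h1⟩ := h
  have key : ∀ {a : ℂ} {U V : ℂ → Matrix (Fin 2) (Fin 2) ℂ}, U =ᶠ[𝓝 a] V →
      (fun z => U z * T) =ᶠ[𝓝 a] fun z => V z * T := by
    intro a U V hUV
    filter_upwards [hUV] with z hz
    rw [hz]
  refine ⟨fun t z => Φ t z * T, ⟨fun t ht i j => ?_, fun t ht => ?_⟩, key h0, key h1⟩
  · simp only [Matrix.mul_apply, Fin.sum_univ_two]
    exact ((ha t ht i 0).mul analyticAt_const).add ((ha t ht i 1).mul analyticAt_const)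
  · filter_upwards [hc t ht] with s hs
    exact key hs

theorem ContinuesTo.trans {P Q R : ℂ} {γ : Path P Q} {δ : Path Q R}
    {X Y Z : ℂ → Matrix (Fin 2) (Fin 2) ℂ} (h : ContinuesTo γ X Y) (k : ContinuesTo δ Y Z) :
    ContinuesTo (γ.trans δ) X Z := by
  obtain ⟨Φ, ⟨ha, hc⟩, h0, h1⟩ := h
  obtain ⟨Ψ, ⟨ka, kc⟩, k0, k1⟩ := k
  simp only [nhdsWithin_univ] at hc kc
  let u : unitInterval → unitInterval := fun t => Set.projIcc (0 : ℝ) 1 zero_le_one (2 * t)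
  let v : unitInterval → unitInterval := fun t => Set.projIcc (0 : ℝ) 1 zero_le_one (2 * t - 1)
  have hu : Continuous u := continuous_projIcc.comp (by fun_prop)
  have hv : Continuous v := continuous_projIcc.comp (by fun_prop)
  have eu : ∀ t : unitInterval, (t : ℝ) ≤ 1 / 2 → (γ.trans δ) t = γ (u t) := by
    intro t ht
    rw [Path.trans_apply, dif_pos ht]
    congr 1
    exact (Set.projIcc_of_mem zero_le_one _).symm
  have ev : ∀ t : unitInterval, ¬ (t : ℝ) ≤ 1 / 2 → (γ.trans δ) t = δ (v t) := by
    intro t ht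
    rw [Path.trans_apply, dif_neg ht]
    congr 1
    exact (Set.projIcc_of_mem zero_le_one _).symm
  let Θ : unitInterval → ℂ → Matrix (Fin 2) (Fin 2) ℂ :=
    fun t => if (t : ℝ) ≤ 1 / 2 then Φ (u t) else Ψ (v t)
  refine ⟨Θ, ⟨fun t _ i j => ?_, fun t _ => ?_⟩, ?_, ?_⟩
  · by_cases ht : (t : ℝ) ≤ 1 / 2
    · simp only [Θ, if_pos ht, eu t ht]
      exact ha _ trivial i j
    · simp only [Θ, if_neg ht, ev t ht]
      exact ka _ trivial i j
  · rw [nhdsWithin_univ]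
    rcases lt_trichotomy (t : ℝ) (1 / 2) with ht | ht | ht
    · have hlt : ∀ᶠ s : unitInterval in 𝓝 t, (s : ℝ) < 1 / 2 :=
        continuous_subtype_val.continuousAt.eventually_lt_const ht
      filter_upwards [hlt, (hu.tendsto t).eventually (hc (u t) trivial)] with s hs hs'
      simp only [Θ, if_pos hs.le, if_pos ht.le, eu s hs.le]
      exact hs'
    · have hut : u t = 1 := by
        simp only [u, ht]
        norm_num
      have hvt : v t = 0 := by
        simp only [v, ht]
        norm_num
      have hu1 := (hu.tendsto t).eventually (hc (u t) trivial)
      have hv1 := (hv.tendsto t).eventually (kc (v t) trivial)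
      have hgt : (γ.trans δ) t = Q := by
        rw [eu t ht.le, hut]
        exact γ.target
      have hglue : ∀ᶠ z in 𝓝 ((γ.trans δ) t), Ψ 0 =ᶠ[𝓝 z] Φ 1 := by
        rw [hgt]
        exact (k0.trans h1.symm).eventually_nhds
      filter_upwards [hu1, hv1, ((γ.trans δ).continuous.tendsto t).eventually hglue] with
        s hs1 hs2 hs3
      simp only [Θ, if_pos ht.le]
      by_cases hs : (s : ℝ) ≤ 1 / 2
      · simp only [if_pos hs, eu s hs]
        exact hs1
      · rw [hvt] at hs2
        rw [ev s hs] at hs3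
        simp only [if_neg hs, ev s hs, hut]
        exact hs2.trans hs3
    · have hlt : ∀ᶠ s : unitInterval in 𝓝 t, 1 / 2 < (s : ℝ) :=
        continuous_subtype_val.continuousAt.eventually_const_lt ht
      filter_upwards [hlt, (hv.tendsto t).eventually (kc (v t) trivial)] with s hs hs'
      simp only [Θ, if_neg hs.not_ge, if_neg ht.not_ge, ev s hs.not_ge]
      exact hs'
  · have : u 0 = 0 := by simp [u]
    simpa [Θ, this] using h0
  · have h2 : v 1 = 1 := by
      simp only [v, Set.Icc.coe_one]
      norm_num
    have h3 : ¬ ((1 : unitInterval) : ℝ) ≤ 1 / 2 := by norm_num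
    simp only [Θ, if_neg h3, h2]
    exact k1

theorem ContinuesTo.refl {P : ℂ} {X : ℂ → Matrix (Fin 2) (Fin 2) ℂ}
    (h : ∀ i j, AnalyticAt ℂ (fun z => X z i j) P) : ContinuesTo (Path.refl P) X X :=
  ⟨fun _ => X, ⟨fun _ _ i j => by simpa using h i j,
    fun _ _ => Eventually.of_forall fun _ => EventuallyEq.rfl⟩, EventuallyEq.rfl, EventuallyEq.rfl⟩

/-- The monodromy group, with base point `P`, of the (multivalued) fundamental matrix of solutions
of a linear system on `U` given by the holomorphic germ `X` at `P`: all invertible matrices `T`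
such that analytic continuation of `X` along some closed path in `U` based at `P` gives `X T`. -/
def monodromyGroup (U : Set ℂ) (P : ℂ) (hP : P ∈ U) (X : ℂ → Matrix (Fin 2) (Fin 2) ℂ)
    (hX : ∀ i j, AnalyticAt ℂ (fun z => X z i j) P) : Subgroup (GL (Fin 2) ℂ) where
  carrier := {T | ∃ γ : Path P P, (∀ t, γ t ∈ U) ∧
    ContinuesTo γ X fun z => X z * (T : Matrix (Fin 2) (Fin 2) ℂ)}
  one_mem' := ⟨Path.refl P, fun _ => by simpa using hP, by simpa using ContinuesTo.refl hX⟩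
  mul_mem' := by
    rintro S T ⟨γ, hγ, hS⟩ ⟨δ, hδ, hT⟩
    refine ⟨δ.trans γ, fun t => ?_, ?_⟩
    · rw [Path.trans_apply]
      split_ifs
      · exact hδ _
      · exact hγ _
    · have := hT.trans (hS.mul_right (T : Matrix (Fin 2) (Fin 2) ℂ))
      simpa [Matrix.mul_assoc] using this
  inv_mem' := by
    rintro T ⟨γ, hγ, hT⟩
    refine ⟨γ.symm, fun t => hγ _, ?_⟩
    have h := hT.symm.mul_right ((T⁻¹ : GL (Fin 2) ℂ) : Matrix (Fin 2) (Fin 2) ℂ)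
    have e : ∀ z, X z * (T : Matrix (Fin 2) (Fin 2) ℂ) *
        ((T⁻¹ : GL (Fin 2) ℂ) : Matrix (Fin 2) (Fin 2) ℂ) = X z := by
      intro z
      rw [Matrix.mul_assoc, Units.mul_inv, Matrix.mul_one]
    simpa only [e] using h

/-- A germ at `P` of a fundamental matrix of solutions is holomorphic at `P`. -/
theorem IsFundamentalMatrix.analyticAt {A : ℂ → Matrix (Fin 2) (Fin 2) ℂ} {P : ℂ}
    {X : ℂ → Matrix (Fin 2) (Fin 2) ℂ} (h : IsFundamentalMatrix A P X) (i j : Fin 2) :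
    AnalyticAt ℂ (fun z => X z i j) P :=
  Complex.analyticAt_iff_eventually_differentiableAt.2
    (h.1.mono fun _ hz => (hz i j).differentiableAt)

/-! ## The elliptic curve, its periods, and the explicit fundamental matrix -/

/-- `ω` is the period of the holomorphic one-form `c (c - 1) dl / (2 y)` along some closed loop
`(l, y)` on the elliptic curve `y² = l (l - 1) (l - c)` with the ramification points removed. The
function `h` is the primitive of the form along the loop, given by local holomorphic primitives,
so that the integral of the form along the loop is `h 1 - h 0`. -/
def IsPeriod (c ω : ℂ) : Prop :=
  ∃ l y h : C(unitInterval, ℂ),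
    (∀ t, y t ≠ 0 ∧ y t ^ 2 = E c (l t)) ∧ l 0 = l 1 ∧ y 0 = y 1 ∧
    (∀ t, ∃ Y H : ℂ → ℂ, AnalyticAt ℂ Y (l t) ∧
      (∀ᶠ z in 𝓝 (l t), Y z ^ 2 = E c z ∧ HasDerivAt H (c * (c - 1) / (2 * Y z)) z) ∧
      ∀ᶠ s in 𝓝 t, Y (l s) = y s ∧ H (l s) = h s) ∧
    ω = h 1 - h 0

/-- `Π₁ = ∫₀¹ c (c - 1) dl / √(l (l - 1) (l - c))`, along the segment `l = s`. The principal root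
is a continuous branch on the segment (for `0 < c < 1`: on both sides of `c`). -/
def period₁ (c : ℂ) : ℂ :=
  ∫ s : ℝ in (0 : ℝ)..1, c * (c - 1) / (((s : ℂ) * (s - 1) * (s - c)) ^ (1 / 2 : ℂ))

/-- `Π₂ = ∫₀ᶜ c (c - 1) dl / √(l (l - 1) (l - c))`, along the segment `l = c s`, `dl = c ds`. As
`l (l - 1) (l - c) = c² s (1 - s) (1 - c s)`, a continuous branch of the root on the segment (for
`1 < c`: on both sides of `1`) is `c √(s (1 - s) (1 - c s))`, with the principal root. -/
def period₂ (c : ℂ) : ℂ :=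
  ∫ s : ℝ in (0 : ℝ)..1,
    c * (c - 1) / (c * ((s : ℂ) * (1 - s) * (1 - c * s)) ^ (1 / 2 : ℂ)) * c

/-- `X` is, near `P`, a branch of the multivalued matrix
`[[∫₀^l c (c - 1) dl / (2 √E(c, l)), 1], [√E(c, l), 0]]`: here `I` is a primitive of
`c (c - 1) / (2 y)` and `y` a square root of `E(c, ·)`, and `X` is the end point of an analytic
continuation along some path `γ` which starts at `0` and then stays in the punctured line, in
such a way that the primitive tends to `0` at the beginning of the path. -/
def IsPicardMatrix (c P : ℂ) (X : ℂ → Matrix (Fin 2) (Fin 2) ℂ) : Prop :=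
  (∃ I y : ℂ → ℂ, ∀ᶠ z in 𝓝 P, X z = !![I z, 1; y z, 0] ∧ y z ^ 2 = E c z ∧
      HasDerivAt I (c * (c - 1) / (2 * y z)) z ∧ DifferentiableAt ℂ y z) ∧
  ∃ (γ : Path 0 P) (Φ : unitInterval → ℂ → Matrix (Fin 2) (Fin 2) ℂ),
    (∀ t, 0 < t → γ t ∈ puncturedLine c) ∧ IsContinuation (Set.Ioi 0) γ Φ ∧ Φ 1 =ᶠ[𝓝 P] X ∧
    Tendsto (fun t => Φ t (γ t) 0 0) (𝓝[>] 0) (𝓝 0)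

/-! ## The groups in the conclusion -/

/-- The matrices `[[±1, 0], [p Π₁ + q Π₂, 1]]` with `p`, `q` integers. -/
def periodMatrices (c : ℂ) : Set (GL (Fin 2) ℂ) :=
  {T | ∃ (ε : ℤˣ) (p q : ℤ), (T : Matrix (Fin 2) (Fin 2) ℂ) =
    !![((ε : ℤ) : ℂ), 0; p * period₁ c + q * period₂ c, 1]}

/-- The action of `ℤ/2` on `ℤ²` in which the generator acts by `v ↦ -v`
(both groups are written multiplicatively). -/
def signAction : Multiplicative (ZMod 2) →* MulAut (Multiplicative (ℤ × ℤ)) where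
  toFun a := if a = 1 then 1 else MulEquiv.inv _
  map_one' := by simp
  map_mul' := by
    have key : ∀ a b : Multiplicative (ZMod 2),
        (a = 1 ∧ a * b = b) ∨ (b = 1 ∧ a * b = a) ∨ (a ≠ 1 ∧ b ≠ 1 ∧ a * b = 1) := by
      decide
    intro a b
    rcases key a b with ⟨ha, hab⟩ | ⟨hb, hab⟩ | ⟨ha, hb, hab⟩
    · rw [hab, if_pos ha, one_mul]
    · rw [hab, if_pos hb, mul_one]
    · rw [hab, if_pos rfl, if_neg ha, if_neg hb]
      ext x : 1
      simp

end

end PainleveVI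

namespace PainleveVI

/-! ## Square roots and germs of solutions -/

theorem E_ne_zero_iff {c z : ℂ} : E c z ≠ 0 ↔ z ∈ puncturedLine c := by
  simp only [E, puncturedLine, Set.mem_compl_iff, Set.mem_insert_iff, Set.mem_singleton_iff, ne_eq,
    mul_eq_zero, sub_eq_zero, not_or, and_assoc]

theorem hasDerivAt_E (c z : ℂ) :
    HasDerivAt (E c) ((z - 1) * (z - c) + z * (z - c) + z * (z - 1)) z := by
  have h := (((hasDerivAt_id z).mul ((hasDerivAt_id z).sub_const 1)).mul
    ((hasDerivAt_id z).sub_const c))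
  refine h.congr_deriv ?_
  simp only [id, Pi.mul_apply]
  ring

theorem continuous_E (c : ℂ) : Continuous (E c) := by
  unfold E
  fun_prop

theorem differentiable_E (c : ℂ) : Differentiable ℂ (E c) :=
  fun z => (hasDerivAt_E c z).differentiableAt

/-- A continuous square root of a differentiable function is differentiable off its zeros. -/
theorem hasDerivAt_of_sq {𝕜 : Type*} [NontriviallyNormedField 𝕜] [NormedAlgebra 𝕜 ℂ]
    {y e : 𝕜 → ℂ} {e' : ℂ} {x : 𝕜} (hy : ContinuousAt y x) (h0 : y x ≠ 0)
    (he : HasDerivAt e e' x) (h : ∀ᶠ s in 𝓝 x, y s ^ 2 = e s) :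
    HasDerivAt y (e' / (2 * y x)) x := by
  rw [hasDerivAt_iff_tendsto_slope] at he ⊢
  have hsum : Tendsto (fun s => y s + y x) (𝓝[≠] x) (𝓝 (2 * y x)) := by
    rw [two_mul]
    exact (hy.tendsto.mono_left nhdsWithin_le_nhds).add_const _
  have h2 : (2 : ℂ) * y x ≠ 0 := mul_ne_zero two_ne_zero h0
  refine (he.div hsum h2).congr' ?_
  filter_upwards [h.filter_mono nhdsWithin_le_nhds, hsum.eventually_ne h2] with s hs hs'
  rw [Pi.div_apply, slope_def_module, slope_def_module, ← hs, ← h.self_of_nhds, div_eq_iff hs', smul_mul_assoc]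
  congr 1
  ring

/-- Two continuous square roots of the same function which agree at a point agree nearby. -/
theorem eventually_eq_of_sq {T : Type*} [TopologicalSpace T] {l : Filter T} {y y' : T → ℂ} {a : ℂ}
    (ha : a ≠ 0) (hy : Tendsto y l (𝓝 a)) (hy' : Tendsto y' l (𝓝 a))
    (h : ∀ᶠ s in l, y s ^ 2 = y' s ^ 2) : ∀ᶠ s in l, y s = y' s := by
  have hsum : ∀ᶠ s in l, y s + y' s ≠ 0 :=
    (hy.add hy').eventually_ne (by simpa [← two_mul] using ha)
  filter_upwards [h, hsum] with s hs hs'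
  rcases sq_eq_sq_iff_eq_or_eq_neg.1 hs with h | h
  · exact h
  · exact absurd (by rw [h]; ring) hs'

/-- An analytic function vanishing near a point close enough to `z` vanishes near `z`. -/
theorem eventually_eventually_zero {f : ℂ → ℂ} {z : ℂ} (hf : AnalyticAt ℂ f z) :
    ∀ᶠ w in 𝓝 z, (∀ᶠ v in 𝓝 w, f v = 0) → ∀ᶠ v in 𝓝 z, f v = 0 := by
  rcases hf.eventually_eq_zero_or_eventually_ne_zero with h | h
  · exact Eventually.of_forall fun _ _ => h
  · filter_upwards [eventually_nhdsWithin_iff.1 h] with w hw h'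
    by_cases hz : w = z
    · rwa [hz] at h'
    · exact absurd h'.self_of_nhds (hw hz)

theorem eventually_const_of_hasDerivAt_zero {f : ℂ → ℂ} {z : ℂ}
    (h : ∀ᶠ w in 𝓝 z, HasDerivAt f 0 w) : ∀ᶠ w in 𝓝 z, f w = f z := by
  obtain ⟨r, hr, hB⟩ := Metric.eventually_nhds_iff_ball.1 h
  filter_upwards [Metric.ball_mem_nhds z hr] with w hw
  exact Metric.isOpen_ball.is_const_of_deriv_eq_zero (convex_ball z r).isPreconnected
    (fun v hv => (hB v hv).differentiableAt.differentiableWithinAt)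
    (fun v hv => (hB v hv).deriv) hw (Metric.mem_ball_self hr)

/-- `X = [[I, 1], [y, 0]]` near `z`, with `y² = E(c, ·)` and `I' = c (c - 1) / (2 y)`. -/
def IsPicardGerm (c z : ℂ) (X : ℂ → Matrix (Fin 2) (Fin 2) ℂ) : Prop :=
  ∀ᶠ w in 𝓝 z, X w 0 1 = 1 ∧ X w 1 1 = 0 ∧ X w 1 0 ^ 2 = E c w ∧
    HasDerivAt (fun v => X v 0 0) (c * (c - 1) / (2 * X w 1 0)) w ∧
    DifferentiableAt ℂ (fun v => X v 1 0) w

variable {c z : ℂ} {X X' : ℂ → Matrix (Fin 2) (Fin 2) ℂ}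

theorem IsPicardGerm.eventually (h : IsPicardGerm c z X) : ∀ᶠ w in 𝓝 z, IsPicardGerm c w X :=
  Filter.Eventually.eventually_nhds h

theorem IsPicardGerm.congr (h : IsPicardGerm c z X) (h' : X =ᶠ[𝓝 z] X') :
    IsPicardGerm c z X' := by
  filter_upwards [h, h'.eventually_nhds] with w ⟨h1, h2, h3, h4, h5⟩ hw
  have e := hw.self_of_nhds
  have e' : ∀ i j, (fun v => X' v i j) =ᶠ[𝓝 w] fun v => X v i j := fun i j =>
    hw.mono fun v (hv : X v = X' v) => by simp only [hv]
  rw [← e]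
  exact ⟨h1, h2, h3, h4.congr_of_eventuallyEq (e' 0 0), h5.congr_of_eventuallyEq (e' 1 0)⟩

theorem IsPicardGerm.analyticAt (h : IsPicardGerm c z X) (i j : Fin 2) :
    AnalyticAt ℂ (fun w => X w i j) z := by
  have h01 : (fun w => X w 0 1) =ᶠ[𝓝 z] fun _ => 1 := h.mono fun w hw => hw.1
  have h11 : (fun w => X w 1 1) =ᶠ[𝓝 z] fun _ => 0 := h.mono fun w hw => hw.2.1
  have h00 : AnalyticAt ℂ (fun w => X w 0 0) z :=
    Complex.analyticAt_iff_eventually_differentiableAt.2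
      (h.mono fun w hw => hw.2.2.2.1.differentiableAt)
  have h10 : AnalyticAt ℂ (fun w => X w 1 0) z :=
    Complex.analyticAt_iff_eventually_differentiableAt.2 (h.mono fun w hw => hw.2.2.2.2)
  fin_cases i <;> fin_cases j
  · exact h00
  · exact analyticAt_const.congr h01.symm
  · exact h10
  · exact analyticAt_const.congr h11.symm

theorem IsPicardGerm.ne_zero (hz : z ∈ puncturedLine c) (h : IsPicardGerm c z X) :
    X z 1 0 ≠ 0 := by
  intro h0
  refine E_ne_zero_iff.2 hz ?_
  rw [← h.self_of_nhds.2.2.1, h0]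
  simp

theorem isOpen_puncturedLine (c : ℂ) : IsOpen (puncturedLine c) := by
  have : puncturedLine c = {z | E c z ≠ 0} := Set.ext fun z => E_ne_zero_iff.symm
  rw [this]
  exact isOpen_ne_fun (continuous_E c) continuous_const

/-- A germ is determined by its values at a point. -/
theorem IsPicardGerm.eventuallyEq (hz : z ∈ puncturedLine c) (h : IsPicardGerm c z X)
    (h' : IsPicardGerm c z X') (h0 : X z 0 0 = X' z 0 0) (h1 : X z 1 0 = X' z 1 0) :
    X =ᶠ[𝓝 z] X' := by
  have hy : ∀ᶠ w in 𝓝 z, X w 1 0 = X' w 1 0 := by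
    refine eventually_eq_of_sq (h.ne_zero hz) (h.analyticAt 1 0).continuousAt.tendsto ?_ ?_
    · rw [h1]
      exact (h'.analyticAt 1 0).continuousAt.tendsto
    · filter_upwards [h, h'] with w hw hw'
      rw [hw.2.2.1, hw'.2.2.1]
  have hI : ∀ᶠ w in 𝓝 z, X w 0 0 - X' w 0 0 = X z 0 0 - X' z 0 0 := by
    refine eventually_const_of_hasDerivAt_zero ?_
    filter_upwards [h, h', hy] with w hw hw' hyw
    have := hw.2.2.2.1.sub hw'.2.2.2.1
    rwa [hyw, sub_self] at this
  filter_upwards [h, h', hy, hI] with w hw hw' hyw hIw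
  ext i j
  fin_cases i <;> fin_cases j
  · simpa [h0, sub_eq_zero] using hIw
  · exact hw.1.trans hw'.1.symm
  · exact hyw
  · exact hw.2.1.trans hw'.2.1.symm

theorem isPicardGerm_of_analytic (hz : z ∈ puncturedLine c)
    (ha : ∀ i j, AnalyticAt ℂ (fun w => X w i j) z)
    (h : ∀ᶠ w in 𝓝 z, X w 0 1 = 1 ∧ X w 1 1 = 0 ∧ X w 1 0 ^ 2 = E c w ∧
      2 * X w 1 0 * deriv (fun v => X v 0 0) w = c * (c - 1)) : IsPicardGerm c z X := by
  filter_upwards [h, (ha 0 0).eventually_analyticAt, (ha 1 0).eventually_analyticAt,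
    (isOpen_puncturedLine c).mem_nhds hz] with w ⟨h1, h2, h3, h4⟩ a0 a1 hw
  have hy : X w 1 0 ≠ 0 := by
    intro h0
    refine E_ne_zero_iff.2 hw ?_
    rw [← h3, h0]
    simp
  refine ⟨h1, h2, h3, ?_, a1.differentiableAt⟩
  convert! a0.differentiableAt.hasDerivAt using 1
  rw [← h4]
  field_simp

/-- Whether an analytic germ is a Picard germ can be seen at any nearby point. -/
theorem eventually_isPicardGerm_imp (hz : z ∈ puncturedLine c)
    (ha : ∀ i j, AnalyticAt ℂ (fun w => X w i j) z) :
    ∀ᶠ w in 𝓝 z, IsPicardGerm c w X → IsPicardGerm c z X := by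
  have hE : AnalyticAt ℂ (E c) z := (differentiable_E c).analyticAt z
  have a1 := eventually_eventually_zero ((ha 0 1).sub (analyticAt_const (v := 1)))
  have a2 := eventually_eventually_zero (ha 1 1)
  have a3 := eventually_eventually_zero (((ha 1 0).pow 2).sub hE)
  have a4 := eventually_eventually_zero
    (((analyticAt_const (v := 2).mul (ha 1 0)).mul (ha 0 0).deriv).sub
      (analyticAt_const (v := c * (c - 1))))
  filter_upwards [a1, a2, a3, a4, (isOpen_puncturedLine c).mem_nhds hz] with w b1 b2 b3 b4 hw h
  refine isPicardGerm_of_analytic hz ha ?_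
  filter_upwards [b1 (h.mono fun v hv => by simp [hv.1]), b2 (h.mono fun v hv => by simp [hv.2.1]),
    b3 (h.mono fun v hv => by simp [hv.2.2.1]),
    b4 ((h.and ((isOpen_puncturedLine c).eventually_mem hw)).mono fun v hv => by
      have hne : X v 1 0 ≠ 0 := by
        intro h0
        refine E_ne_zero_iff.2 hv.2 ?_
        rw [← hv.1.2.2.1, h0]
        simp
      have hd := hv.1.2.2.2.1.deriv
      simp only [Pi.sub_apply, Pi.mul_apply, hd]
      field_simp
      ring)] with v v1 v2 v3 v4
  exact ⟨sub_eq_zero.1 v1, v2, sub_eq_zero.1 v3, sub_eq_zero.1 v4⟩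

/-- Analytic continuation preserves Picard germs. -/
theorem IsContinuation.isPicardGerm {S : Set unitInterval} {γ : unitInterval → ℂ}
    {Φ : unitInterval → ℂ → Matrix (Fin 2) (Fin 2) ℂ} (hS : IsPreconnected S)
    (hγ : Continuous γ) (hU : ∀ t ∈ S, γ t ∈ puncturedLine c) (h : IsContinuation S γ Φ)
    {s t : unitInterval} (hs : s ∈ S) (ht : t ∈ S) (hg : IsPicardGerm c (γ s) (Φ s)) :
    IsPicardGerm c (γ t) (Φ t) := by
  refine hS.induction₂' (fun s t => IsPicardGerm c (γ s) (Φ s) → IsPicardGerm c (γ t) (Φ t))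
    (fun t ht => ?_) (fun _ _ _ _ _ _ h1 h2 h => h2 (h1 h)) hs ht hg
  have hγt : Tendsto γ (𝓝[S] t) (𝓝 (γ t)) := hγ.continuousAt.mono_left nhdsWithin_le_nhds
  have h1 := hγt.eventually (eventually_isPicardGerm_imp (hU t ht) (h.1 t ht))
  have h2 : ∀ᶠ s in 𝓝[S] t, IsPicardGerm c (γ t) (Φ t) → IsPicardGerm c (γ s) (Φ t) := by
    by_cases hc : IsPicardGerm c (γ t) (Φ t)
    · exact (hγt.eventually hc.eventually).mono fun _ h _ => h
    · exact Eventually.of_forall fun _ h => absurd h hc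
  filter_upwards [h1, h2, h.2 t ht] with s h1 h2 h3
  exact ⟨fun h => (h2 h).congr h3.symm, fun h => h1 (h.congr h3)⟩

end PainleveVI

namespace PainleveVI

/-! ## Atlases of primitives

On the domain `V i`, a star around the branch point `a i`, the primitives of `c (c - 1) / (2 y)` are
the functions `y τ i + const`, for either choice of the root `y` of `E(c, ·)`. -/

/-- A cover of the line by star domains around the branch points, with the primitives of the
holomorphic form on them, and their offsets `e i`. -/
structure Atlas (c : ℂ) where
  /-- the branch points -/
  a : Fin 3 → ℂ
  /-- the star domains -/
  V : Fin 3 → Set ℂ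
  /-- square roots of `E(c, z) / (z - a i)` -/
  k : Fin 3 → ℂ → ℂ
  /-- quotients of a primitive vanishing at `a i` by the root of `E(c, ·)` -/
  τ : Fin 3 → ℂ → ℂ
  /-- the value of a global primitive at `a i` -/
  e : Fin 3 → ℂ
  /-- the index of the branch point `0` -/
  base : Fin 3
  isOpen_V : ∀ i, IsOpen (V i)
  mem_V : ∀ i, a i ∈ V i
  starConvex_V : ∀ i, StarConvex ℝ (a i) (V i)
  cover : ∀ z, ∃ i, z ∈ V i
  differentiableOn_k : ∀ i, DifferentiableOn ℂ (k i) (V i)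
  k_ne_zero : ∀ i, ∀ z ∈ V i, k i z ≠ 0
  E_eq : ∀ i, ∀ z ∈ V i, E c z = (z - a i) * k i z ^ 2
  differentiableOn_τ : ∀ i, DifferentiableOn ℂ (τ i) (V i)
  ode : ∀ i, ∀ z ∈ V i, ((z - 1) * (z - c) + z * (z - c) + z * (z - 1)) * τ i z +
    2 * E c z * deriv (τ i) z = c * (c - 1)
  glue : ∀ i j, ∀ z ∈ V i ∩ V j, E c z * (τ i z - τ j z) ^ 2 = (e i - e j) ^ 2
  overlap : ∀ i, ∃ z ∈ V 0 ∩ V i, z ∈ puncturedLine c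
  a_base : a base = 0
  e_base : e base = 0

theorem exists_sq_eq_E (c z : ℂ) : ∃ y : ℂ, y ^ 2 = E c z :=
  IsAlgClosed.exists_pow_nat_eq _ two_pos

variable {c z z' : ℂ} {X X' : ℂ → Matrix (Fin 2) (Fin 2) ℂ}

namespace Atlas

variable (A : Atlas c) {i j : Fin 3}

/-- The lattice generated by the doubled differences of the offsets. -/
def lattice : AddSubgroup ℂ := AddSubgroup.closure (Set.range fun i => 2 * (A.e i - A.e 0))

theorem two_mul_sub_mem (i j : Fin 3) : 2 * (A.e i - A.e j) ∈ A.lattice := by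
  have h : ∀ i, 2 * (A.e i - A.e 0) ∈ A.lattice := fun i => AddSubgroup.subset_closure ⟨i, rfl⟩
  convert! A.lattice.sub_mem (h i) (h j) using 1
  ring

theorem two_mul_mem (i : Fin 3) : 2 * A.e i ∈ A.lattice := by
  simpa [A.e_base] using A.two_mul_sub_mem i A.base

theorem hasDerivAt_τ (hz : z ∈ A.V i) : HasDerivAt (A.τ i) (deriv (A.τ i) z) z :=
  ((A.differentiableOn_τ i).differentiableAt ((A.isOpen_V i).mem_nhds hz)).hasDerivAt

theorem continuousAt_τ (hz : z ∈ A.V i) : ContinuousAt (A.τ i) z :=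
  (A.hasDerivAt_τ hz).continuousAt

theorem continuousAt_k (hz : z ∈ A.V i) : ContinuousAt (A.k i) z :=
  ((A.differentiableOn_k i).differentiableAt ((A.isOpen_V i).mem_nhds hz)).continuousAt

theorem hasDerivAt_mul_τ {y : ℂ → ℂ} (hz : z ∈ puncturedLine c) (hi : z ∈ A.V i)
    (hy : ContinuousAt y z) (h : ∀ᶠ w in 𝓝 z, y w ^ 2 = E c w) :
    HasDerivAt (fun w => y w * A.τ i w) (c * (c - 1) / (2 * y z)) z := by
  have h2 := h.self_of_nhds
  have h0 : y z ≠ 0 := by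
    intro h0
    refine E_ne_zero_iff.2 hz ?_
    rw [← h2, h0]
    simp
  refine ((hasDerivAt_of_sq hy h0 (hasDerivAt_E c z) h).mul (A.hasDerivAt_τ hi)).congr_deriv ?_
  rw [← A.ode i z hi, ← h2]
  field_simp

/-- The difference of a germ and the standard one on a chart is locally constant. -/
theorem eventually_coord (h : IsPicardGerm c z X) (hz : z ∈ puncturedLine c) (hi : z ∈ A.V i) :
    ∀ᶠ w in 𝓝 z, X w 0 0 - X w 1 0 * A.τ i w = X z 0 0 - X z 1 0 * A.τ i z := by
  refine eventually_const_of_hasDerivAt_zero ?_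
  filter_upwards [h.eventually, (isOpen_puncturedLine c).mem_nhds hz,
    (A.isOpen_V i).mem_nhds hi] with w hw hwU hwi
  have := hw.self_of_nhds.2.2.2.1.sub (A.hasDerivAt_mul_τ hwU hwi (hw.analyticAt 1 0).continuousAt
    (hw.mono fun v hv => hv.2.2.1))
  rwa [sub_self] at this

theorem transition {y : ℂ} {L : AddSubgroup ℂ} (hL : ∀ i j, 2 * (A.e i - A.e j) ∈ L)
    (hi : z ∈ A.V i) (hj : z ∈ A.V j) (hy : y ^ 2 = E c z) :
    y * A.τ i z + A.e i - (y * A.τ j z + A.e j) ∈ L := by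
  have h := A.glue i j z ⟨hi, hj⟩
  rw [← hy, ← mul_pow] at h
  rcases sq_eq_sq_iff_eq_or_eq_neg.1 h with h | h
  · convert! hL i j using 1
    linear_combination h
  · convert! L.zero_mem using 1
    linear_combination h

theorem mem_iff_of_mem {y I : ℂ} {L : AddSubgroup ℂ} (hL : ∀ i j, 2 * (A.e i - A.e j) ∈ L)
    (hi : z ∈ A.V i) (hj : z ∈ A.V j) (hy : y ^ 2 = E c z) :
    I - y * A.τ i z - A.e i ∈ L ↔ I - y * A.τ j z - A.e j ∈ L := by
  rw [← L.add_mem_cancel_right (A.transition hL hi hj hy)]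
  convert! Iff.rfl using 2
  ring

/-- Membership in the lattice is preserved along continuous families of local primitives. -/
theorem mem_of_isPreconnected {T : Type*} [TopologicalSpace T] {S : Set T} (hS : IsPreconnected S)
    {γ y I : T → ℂ} (hγ : ContinuousOn γ S) {L : AddSubgroup ℂ}
    (hL : ∀ i j, 2 * (A.e i - A.e j) ∈ L) (hy : ∀ t ∈ S, y t ^ 2 = E c (γ t))
    (hloc : ∀ t ∈ S, ∀ i, γ t ∈ A.V i → ∀ᶠ s in 𝓝[S] t,
      I s - y s * A.τ i (γ s) = I t - y t * A.τ i (γ t))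
    {s t : T} (hs : s ∈ S) (ht : t ∈ S)
    (h : ∀ i, γ s ∈ A.V i → I s - y s * A.τ i (γ s) - A.e i ∈ L) :
    ∀ i, γ t ∈ A.V i → I t - y t * A.τ i (γ t) - A.e i ∈ L := by
  refine hS.induction₂' (fun s t => (∀ i, γ s ∈ A.V i → I s - y s * A.τ i (γ s) - A.e i ∈ L) →
    ∀ i, γ t ∈ A.V i → I t - y t * A.τ i (γ t) - A.e i ∈ L)
    (fun t ht => ?_) (fun _ _ _ _ _ _ h1 h2 h => h2 (h1 h)) hs ht h
  obtain ⟨j, hj⟩ := A.cover (γ t)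
  filter_upwards [hloc t ht j hj, (hγ t ht).eventually ((A.isOpen_V j).mem_nhds hj),
    self_mem_nhdsWithin] with s h1 hsj hs
  refine ⟨fun h i hi => ?_, fun h i hi => ?_⟩
  · rw [A.mem_iff_of_mem hL hi hsj (hy s hs), h1]
    exact h j hj
  · rw [A.mem_iff_of_mem hL hi hj (hy t ht), ← h1]
    exact h j hsj

theorem eventually_coord_comp {T : Type*} [TopologicalSpace T] {S : Set T} {γ : T → ℂ}
    (hγ : ContinuousOn γ S) {Φ : T → ℂ → Matrix (Fin 2) (Fin 2) ℂ}
    {t : T} (ht : t ∈ S) (hU : γ t ∈ puncturedLine c) (hΦ : IsPicardGerm c (γ t) (Φ t))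
    (hc : ∀ᶠ s in 𝓝[S] t, Φ s =ᶠ[𝓝 (γ s)] Φ t) (hi : γ t ∈ A.V i) : ∀ᶠ s in 𝓝[S] t,
      Φ s (γ s) 0 0 - Φ s (γ s) 1 0 * A.τ i (γ s) =
        Φ t (γ t) 0 0 - Φ t (γ t) 1 0 * A.τ i (γ t) := by
  filter_upwards [hc, (hγ t ht).eventually (A.eventually_coord hΦ hU hi)] with s h1 h2
  rw [h1.self_of_nhds]
  exact h2

/-- There are germs with arbitrary initial values. -/
theorem exists_germ (A : Atlas c) {y : ℂ} (hz : z ∈ puncturedLine c) (hy : y ^ 2 = E c z) (I : ℂ) :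
    ∃ X, IsPicardGerm c z X ∧ X z 0 0 = I ∧ X z 1 0 = y := by
  obtain ⟨i, hi⟩ := A.cover z
  have hE : E c z ≠ 0 := E_ne_zero_iff.2 hz
  let Y : ℂ → ℂ := fun w => y * (E c w / E c z) ^ (1 / 2 : ℂ)
  have hYsq : ∀ w, Y w ^ 2 = E c w := by
    intro w
    simp only [Y, mul_pow, hy, one_div, Complex.cpow_ofNat_inv_pow]
    field_simp
  have hq : ContinuousAt (fun w => E c w / E c z) z :=
    ((continuous_E c).div_const _).continuousAt
  have h1 : E c z / E c z = 1 := div_self hE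
  have hev : ∀ᶠ w in 𝓝 z, E c w / E c z ∈ Complex.slitPlane := by
    refine hq.eventually (Complex.isOpen_slitPlane.mem_nhds ?_)
    simp only [h1]
    exact Complex.one_mem_slitPlane
  refine ⟨fun w => !![Y w * A.τ i w + (I - y * A.τ i z), 1; Y w, 0], ?_, ?_, ?_⟩
  · filter_upwards [hev, (isOpen_puncturedLine c).mem_nhds hz,
      (A.isOpen_V i).mem_nhds hi] with w hw hwU hwi
    have hd : DifferentiableAt ℂ Y w :=
      (((differentiable_E c w).div_const _).cpow_const hw).const_mul y
    refine ⟨by simp, by simp, by simp [hYsq], ?_, by simpa using hd⟩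
    simpa using (A.hasDerivAt_mul_τ hwU hwi hd.continuousAt (Eventually.of_forall hYsq)).add_const
      (I - y * A.τ i z)
  · simp [Y, h1]
  · simp [Y, h1]

theorem isContinuation_of_eventually {S : Set unitInterval} {γ : unitInterval → ℂ}
    (hγ : ContinuousOn γ S) {Φ : unitInterval → ℂ → Matrix (Fin 2) (Fin 2) ℂ}
    (hU : ∀ t ∈ S, γ t ∈ puncturedLine c) (hΦ : ∀ t ∈ S, IsPicardGerm c (γ t) (Φ t))
    (h : ∀ t ∈ S, ∀ᶠ s in 𝓝[S] t, Φ s (γ s) 0 0 = Φ t (γ s) 0 0 ∧ Φ s (γ s) 1 0 = Φ t (γ s) 1 0) :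
    IsContinuation S γ Φ := by
  refine ⟨fun t ht => (hΦ t ht).analyticAt, fun t ht => ?_⟩
  filter_upwards [h t ht, (hγ t ht).eventually (hΦ t ht).eventually, self_mem_nhdsWithin]
    with s h1 h2 hs
  exact (hΦ s hs).eventuallyEq (hU s hs) h2 h1.1 h1.2

/-- Within a chart, continuation amounts to following the square root. -/
theorem exists_continuation {S : Set unitInterval} {γ y : unitInterval → ℂ}
    (hγ : ContinuousOn γ S) (hyc : ContinuousOn y S) (hU : ∀ t ∈ S, γ t ∈ puncturedLine c)
    (hi : ∀ t ∈ S, γ t ∈ A.V i) (hy : ∀ t ∈ S, y t ^ 2 = E c (γ t)) (D : ℂ) :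
    ∃ Φ, IsContinuation S γ Φ ∧ ∀ t ∈ S, IsPicardGerm c (γ t) (Φ t) ∧
      Φ t (γ t) 0 0 = y t * A.τ i (γ t) + D ∧ Φ t (γ t) 1 0 = y t := by
  have h : ∀ t, ∃ X, t ∈ S → IsPicardGerm c (γ t) X ∧
      X (γ t) 0 0 = y t * A.τ i (γ t) + D ∧ X (γ t) 1 0 = y t := by
    intro t
    by_cases ht : t ∈ S
    · obtain ⟨X, hX⟩ := A.exists_germ (hU t ht) (hy t ht) (y t * A.τ i (γ t) + D)
      exact ⟨X, fun _ => hX⟩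
    · exact ⟨0, fun h => absurd h ht⟩
  choose Φ hΦ using h
  refine ⟨Φ, isContinuation_of_eventually hγ hU (fun t ht => (hΦ t ht).1) fun t ht => ?_, hΦ⟩
  obtain ⟨g1, g2, g3⟩ := hΦ t ht
  have hroot : ∀ᶠ s in 𝓝[S] t, Φ t (γ s) 1 0 = y s := by
    refine eventually_eq_of_sq (g1.ne_zero (hU t ht))
      ((g1.analyticAt 1 0).continuousAt.tendsto.comp (hγ t ht)) ?_ ?_
    · rw [g3]
      exact hyc t ht
    · filter_upwards [(hγ t ht).eventually g1, self_mem_nhdsWithin] with s h1 hs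
      rw [hy s hs]
      exact h1.2.2.1
  filter_upwards [hroot, (hγ t ht).eventually (A.eventually_coord g1 (hU t ht) (hi t ht)),
    self_mem_nhdsWithin] with s h1 h2 hs
  obtain ⟨k1, k2, k3⟩ := hΦ s hs
  refine ⟨?_, by rw [k3, h1]⟩
  rw [h1, g2, g3] at h2
  rw [k2]
  linear_combination -h2

end Atlas

/-- The germ `X` at `z` continues to `X'` at `z'` along some path in the punctured line. -/
def Connected (c z z' : ℂ) (X X' : ℂ → Matrix (Fin 2) (Fin 2) ℂ) : Prop :=
  ∃ γ : Path z z', (∀ t, γ t ∈ puncturedLine c) ∧ ContinuesTo γ X X'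

theorem Connected.symm (h : Connected c z z' X X') : Connected c z' z X' X := by
  obtain ⟨γ, h1, h2⟩ := h
  exact ⟨γ.symm, fun t => h1 _, h2.symm⟩

theorem Connected.trans {z'' : ℂ} {X'' : ℂ → Matrix (Fin 2) (Fin 2) ℂ}
    (h : Connected c z z' X X') (h' : Connected c z' z'' X' X'') : Connected c z z'' X X'' := by
  obtain ⟨γ, h1, h2⟩ := h
  obtain ⟨δ, k1, k2⟩ := h'
  refine ⟨γ.trans δ, fun t => ?_, h2.trans k2⟩
  rw [Path.trans_apply]
  split_ifs
  · exact h1 _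
  · exact k1 _

/-- Two points of a star domain around `0` can be joined off `0`. -/
theorem joinedIn_diff_zero {W : Set ℂ} (ho : IsOpen W) (h0 : (0 : ℂ) ∈ W)
    (hs : StarConvex ℝ 0 W) {x y : ℂ} (hx : x ∈ W) (hy : y ∈ W) (hx0 : x ≠ 0) (hy0 : y ≠ 0) :
    JoinedIn (W \ {0}) x y := by
  obtain ⟨r, hr, hB⟩ := Metric.isOpen_iff.1 ho 0 h0
  have key : ∀ x ∈ W, x ≠ 0 → ∃ x' ∈ Metric.sphere (0 : ℂ) (r / 2), JoinedIn (W \ {0}) x x' := by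
    intro x hx hx0
    have hn : 0 < ‖x‖ := norm_pos_iff.2 hx0
    set q : ℝ := r / 2 / ‖x‖ with hq
    have hq0 : 0 < q := by positivity
    have hqx : ‖(q : ℂ) * x‖ = r / 2 := by
      rw [norm_mul, Complex.norm_real, Real.norm_of_nonneg hq0.le, hq]
      field_simp
    refine ⟨q * x, by simpa using hqx, JoinedIn.of_segment_subset ?_⟩
    rintro w ⟨s, t, hs0, ht0, hst, rfl⟩
    have hpos : 0 < s + t * q := by
      rcases hs0.eq_or_lt with rfl | h
      · have : t = 1 := by linarith
        rw [this]
        linarith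
      · positivity
    have hw : s • x + t • ((q : ℂ) * x) = ((s + t * q : ℝ) : ℂ) * x := by
      simp only [Complex.real_smul]
      push_cast
      ring
    rw [hw]
    refine ⟨?_, mul_ne_zero (Complex.ofReal_ne_zero.2 hpos.ne') hx0⟩
    rcases le_total q 1 with h | h
    · have := hs.smul_mem hx hpos.le (by nlinarith)
      rwa [Complex.real_smul] at this
    · refine hB ?_
      rw [mem_ball_zero_iff, norm_mul, Complex.norm_real, Real.norm_of_nonneg hpos.le]
      have h1 : s + t * q ≤ q := by nlinarith
      calc (s + t * q) * ‖x‖ ≤ q * ‖x‖ := by gcongr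
        _ = r / 2 := by rw [hq]; field_simp
        _ < r := by linarith
  obtain ⟨x', hx', h1⟩ := key x hx hx0
  obtain ⟨y', hy', h2⟩ := key y hy hy0
  have hsph : IsPathConnected (Metric.sphere (0 : ℂ) (r / 2)) :=
    isPathConnected_sphere (by simp) 0 (by positivity)
  have hsub : Metric.sphere (0 : ℂ) (r / 2) ⊆ W \ {0} := by
    intro w hw
    refine ⟨hB ?_, ?_⟩
    all_goals rw [mem_sphere_zero_iff_norm] at hw
    · rw [mem_ball_zero_iff]
      linarith
    · rintro rfl
      rw [norm_zero] at hw
      linarith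
  exact h1.trans (((hsph.joinedIn x' hx' y' hy').mono hsub).trans h2.symm)

namespace Atlas

variable (A : Atlas c) {i j : Fin 3}

/-- The germ `X` at `z` is the standard one on the `i`th chart, up to the constant `ω`. -/
def OnSheet (i : Fin 3) (ω z : ℂ) (X : ℂ → Matrix (Fin 2) (Fin 2) ℂ) : Prop :=
  IsPicardGerm c z X ∧ z ∈ puncturedLine c ∧ z ∈ A.V i ∧
    X z 0 0 = X z 1 0 * A.τ i z + (A.e i + ω)

theorem OnSheet.connected {ω : ℂ} (h : A.OnSheet i ω z X) (h' : A.OnSheet i ω z' X') :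
    Connected c z z' X X' := by
  obtain ⟨g, hz, hi, hX⟩ := h
  obtain ⟨g', hz', hi', hX'⟩ := h'
  let W : Set ℂ := (fun σ => A.a i + σ ^ 2) ⁻¹' A.V i
  have hW : IsOpen W := (A.isOpen_V i).preimage (by fun_prop)
  have hstar : StarConvex ℝ 0 W := by
    rw [starConvex_zero_iff]
    intro x hx t ht0 ht1
    have := (A.starConvex_V i).add_smul_mem (show A.a i + x ^ 2 ∈ A.V i from hx)
      (sq_nonneg t) (pow_le_one₀ ht0 ht1)
    simpa [W, mul_pow] using this
  have hroot : ∀ {z : ℂ} {X : ℂ → Matrix (Fin 2) (Fin 2) ℂ}, IsPicardGerm c z X →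
      z ∈ puncturedLine c → z ∈ A.V i → ∃ σ : ℂ, σ ∈ W ∧ σ ≠ 0 ∧ A.a i + σ ^ 2 = z ∧
        σ * A.k i z = X z 1 0 := by
    intro z X g hz hi
    have hk := A.k_ne_zero i z hi
    have hsq : A.a i + (X z 1 0 / A.k i z) ^ 2 = z := by
      rw [div_pow, g.self_of_nhds.2.2.1, A.E_eq i z hi]
      field_simp
      ring
    refine ⟨X z 1 0 / A.k i z, ?_, div_ne_zero (g.ne_zero hz) hk, hsq, by field_simp⟩
    simp only [W, Set.mem_preimage, hsq]
    exact hi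
  obtain ⟨σ, hσ, hσ0, hσz, hσy⟩ := hroot g hz hi
  obtain ⟨σ', hσ', hσ0', hσz', hσy'⟩ := hroot g' hz' hi'
  have h0W : (0 : ℂ) ∈ W := by simpa [W] using A.mem_V i
  obtain ⟨p, hp⟩ := joinedIn_diff_zero hW h0W hstar hσ hσ' hσ0 hσ0'
  have hpV : ∀ t, A.a i + p t ^ 2 ∈ A.V i := fun t => (hp t).1
  have hp0 : ∀ t, p t ≠ 0 := fun t => (hp t).2
  let γ : Path z z' :=
    { toFun := fun t => A.a i + p t ^ 2
      continuous_toFun := by fun_prop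
      source' := by simpa using hσz
      target' := by simpa using hσz' }
  have hγ : ∀ t, γ t = A.a i + p t ^ 2 := fun t => rfl
  have hE : ∀ t, (p t * A.k i (γ t)) ^ 2 = E c (γ t) := by
    intro t
    rw [hγ, A.E_eq i _ (hpV t)]
    ring
  have hU : ∀ t, γ t ∈ puncturedLine c := by
    intro t
    rw [← E_ne_zero_iff, ← hE]
    exact pow_ne_zero 2 (mul_ne_zero (hp0 t) (A.k_ne_zero i _ (hpV t)))
  have hyc : Continuous fun t => p t * A.k i (γ t) :=
    p.continuous.mul (continuous_iff_continuousAt.2 fun t =>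
      ContinuousAt.comp (f := γ) (A.continuousAt_k (hpV t)) γ.continuous.continuousAt)
  obtain ⟨Φ, hc, hΦ⟩ := A.exists_continuation (S := Set.univ) (i := i) γ.continuous.continuousOn
    hyc.continuousOn (fun t _ => hU t) (fun t _ => hpV t) (fun t _ => hE t) (A.e i + ω)
  refine ⟨γ, hU, Φ, hc, ?_, ?_⟩
  · obtain ⟨h1, h2, h3⟩ := hΦ 0 trivial
    simp only [γ.source, p.source, hσy] at h1 h2 h3
    exact h1.eventuallyEq hz g (by rw [h2, hX]) h3
  · obtain ⟨h1, h2, h3⟩ := hΦ 1 trivial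
    simp only [γ.target, p.target, hσy'] at h1 h2 h3
    exact h1.eventuallyEq hz' g' (by rw [h2, hX']) h3

theorem OnSheet.exists_zero {ω : ℂ} (h : A.OnSheet i ω z X) (n : ℤ) (hn : n = 0 ∨ n = 1) :
    ∃ z' X', A.OnSheet 0 (ω + n * (2 * (A.e i - A.e 0))) z' X' ∧ Connected c z z' X X' := by
  obtain ⟨w, ⟨hw0, hwi⟩, hwU⟩ := A.overlap i
  obtain ⟨y, hy⟩ := exists_sq_eq_E c w
  have hg := A.glue 0 i w ⟨hw0, hwi⟩
  rw [← hy, ← mul_pow] at hg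
  have key : ∀ s : ℂ, s ^ 2 = 1 → ∃ y : ℂ, y ^ 2 = E c w ∧
      y * (A.τ 0 w - A.τ i w) = s * (A.e i - A.e 0) := by
    intro s hs
    rcases sq_eq_sq_iff_eq_or_eq_neg.1 hg with h | h
    · refine ⟨-s * y, by linear_combination y ^ 2 * hs + hy, ?_⟩
      linear_combination -s * h
    · refine ⟨s * y, by linear_combination y ^ 2 * hs + hy, ?_⟩
      linear_combination s * h
  obtain ⟨y, hy, hyτ⟩ := key (1 - 2 * n) (by rcases hn with rfl | rfl <;> norm_num)
  obtain ⟨X', g, hI, hY⟩ := A.exists_germ hwU hy (y * A.τ i w + (A.e i + ω))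
  refine ⟨w, X', ⟨g, hwU, hw0, ?_⟩, h.connected A ⟨g, hwU, hwi, by rw [hI, hY]⟩⟩
  rw [hI, hY]
  linear_combination -hyτ

theorem exists_onSheet_zero (ω : ℂ) : ∃ z X, A.OnSheet 0 ω z X := by
  obtain ⟨w, ⟨hw0, -⟩, hwU⟩ := A.overlap 0
  obtain ⟨y, hy⟩ := exists_sq_eq_E c w
  obtain ⟨X', g, hI, hY⟩ := A.exists_germ hwU hy (y * A.τ 0 w + (A.e 0 + ω))
  exact ⟨w, X', g, hwU, hw0, by rw [hI, hY]⟩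

theorem OnSheet.connected_zero {ω η : ℂ} (hη : η ∈ A.lattice) (h : A.OnSheet 0 ω z X)
    (h' : A.OnSheet 0 (ω + η) z' X') : Connected c z z' X X' := by
  unfold lattice at hη
  induction hη using AddSubgroup.closure_induction generalizing ω z z' X X' with
  | mem x hx =>
    obtain ⟨i, rfl⟩ := hx
    obtain ⟨w, ⟨hw0, hwi⟩, hwU⟩ := A.overlap i
    obtain ⟨y, hy⟩ := exists_sq_eq_E c w
    obtain ⟨Z, g, hI, hY⟩ := A.exists_germ hwU hy (y * A.τ i w + (A.e i + ω))
    have hZ : A.OnSheet i ω w Z := ⟨g, hwU, hwi, by rw [hI, hY]⟩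
    obtain ⟨z1, X1, h1, k1⟩ := hZ.exists_zero A 0 (Or.inl rfl)
    obtain ⟨z2, X2, h2, k2⟩ := hZ.exists_zero A 1 (Or.inr rfl)
    simp only [Int.cast_zero, zero_mul, add_zero, Int.cast_one, one_mul] at h1 h2
    exact (h.connected A h1).trans (k1.symm.trans (k2.trans (h2.connected A h')))
  | zero =>
    rw [add_zero] at h'
    exact h.connected A h'
  | add x y _ _ hx hy =>
    obtain ⟨w, Z, hZ⟩ := A.exists_onSheet_zero (ω + x)
    exact (hx h hZ).trans (hy hZ (by rwa [add_assoc]))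
  | neg x _ hx =>
    exact (hx h' (by rwa [neg_add_cancel_right])).symm

/-- Germs whose constants lie in the lattice. -/
def IsGerm (z : ℂ) (X : ℂ → Matrix (Fin 2) (Fin 2) ℂ) : Prop :=
  IsPicardGerm c z X ∧ z ∈ puncturedLine c ∧
    ∀ i, z ∈ A.V i → X z 0 0 - X z 1 0 * A.τ i z - A.e i ∈ A.lattice

theorem IsGerm.connected (h : A.IsGerm z X) (h' : A.IsGerm z' X') : Connected c z z' X X' := by
  have key : ∀ {z X}, A.IsGerm z X → ∃ ω ∈ A.lattice, ∃ w Z, A.OnSheet 0 ω w Z ∧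
      Connected c z w X Z := by
    intro z X h
    obtain ⟨i, hi⟩ := A.cover z
    have hs : A.OnSheet i (X z 0 0 - X z 1 0 * A.τ i z - A.e i) z X := ⟨h.1, h.2.1, hi, by ring⟩
    obtain ⟨w, Z, h1, h2⟩ := hs.exists_zero A 0 (Or.inl rfl)
    simp only [Int.cast_zero, zero_mul, add_zero] at h1
    exact ⟨_, h.2.2 i hi, w, Z, h1, h2⟩
  obtain ⟨ω, hω, w, Z, hs, hc⟩ := key h
  obtain ⟨ω', hω', w', Z', hs', hc'⟩ := key h'
  refine hc.trans (Connected.trans (hs.connected_zero A (A.lattice.sub_mem hω' hω) ?_) hc'.symm)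
  rwa [add_sub_cancel]

theorem isGerm_of_mem (g : IsPicardGerm c z X) (hz : z ∈ puncturedLine c) (hi : z ∈ A.V i)
    (h : X z 0 0 - X z 1 0 * A.τ i z - A.e i ∈ A.lattice) : A.IsGerm z X :=
  ⟨g, hz, fun _ hj => (A.mem_iff_of_mem A.two_mul_sub_mem hi hj g.self_of_nhds.2.2.1).1 h⟩

theorem exists_isGerm (hz : z ∈ puncturedLine c) : ∃ X, A.IsGerm z X := by
  obtain ⟨i, hi⟩ := A.cover z
  obtain ⟨y, hy⟩ := exists_sq_eq_E c z
  obtain ⟨X, g, hI, hY⟩ := A.exists_germ hz hy (y * A.τ i z + A.e i)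
  refine ⟨X, A.isGerm_of_mem g hz hi ?_⟩
  rw [hI, hY]
  simp

end Atlas

end PainleveVI

namespace PainleveVI

variable {c z z' P : ℂ} {X X' : ℂ → Matrix (Fin 2) (Fin 2) ℂ}

/-! ## Monodromy and periods -/

namespace Atlas

variable (A : Atlas c) {i j : Fin 3}

theorem coord_mem_of_isContinuation {S : Set unitInterval} {γ : unitInterval → ℂ}
    {Φ : unitInterval → ℂ → Matrix (Fin 2) (Fin 2) ℂ} (hS : IsPreconnected S)
    (hγ : Continuous γ) (hU : ∀ t ∈ S, γ t ∈ puncturedLine c) (h : IsContinuation S γ Φ)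
    {s t : unitInterval} (hs : s ∈ S) (ht : t ∈ S) (hg : IsPicardGerm c (γ s) (Φ s))
    {C : ℂ} (hi : γ s ∈ A.V i)
    (hm : Φ s (γ s) 0 0 - C - Φ s (γ s) 1 0 * A.τ i (γ s) - A.e i ∈ A.lattice)
    (hj : γ t ∈ A.V j) :
    Φ t (γ t) 0 0 - C - Φ t (γ t) 1 0 * A.τ j (γ t) - A.e j ∈ A.lattice := by
  have hG : ∀ t ∈ S, IsPicardGerm c (γ t) (Φ t) := fun t ht =>
    h.isPicardGerm hS hγ hU hs ht hg
  have hy : ∀ t ∈ S, Φ t (γ t) 1 0 ^ 2 = E c (γ t) := fun t ht => (hG t ht).self_of_nhds.2.2.1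
  refine A.mem_of_isPreconnected hS (γ := γ) (y := fun t => Φ t (γ t) 1 0)
    (I := fun t => Φ t (γ t) 0 0 - C) hγ.continuousOn A.two_mul_sub_mem hy (fun t ht i hi => ?_)
    hs ht (fun j hj => (A.mem_iff_of_mem A.two_mul_sub_mem hi hj (hy s hs)).1 hm) j hj
  filter_upwards [A.eventually_coord_comp hγ.continuousOn ht (hU t ht) (hG t ht) (h.2 t ht) hi]
    with s hs
  linear_combination hs

theorem IsGerm.continuesTo {A : Atlas c} {γ : Path z z'} (h : A.IsGerm z X)
    (hγ : ∀ t, γ t ∈ puncturedLine c) (hX : ContinuesTo γ X X') : A.IsGerm z' X' := by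
  obtain ⟨Φ, hc, h0, h1⟩ := hX
  obtain ⟨i, hi⟩ := A.cover z
  obtain ⟨j, hj⟩ := A.cover z'
  have g0 : IsPicardGerm c (γ 0) (Φ 0) := by
    rw [γ.source]
    exact h.1.congr h0.symm
  have g1 := hc.isPicardGerm isPreconnected_univ γ.continuous (fun t _ => hγ t) (s := 0) (t := 1)
    trivial trivial g0
  have hm := A.coord_mem_of_isContinuation isPreconnected_univ γ.continuous (fun t _ => hγ t) hc
    (s := 0) (t := 1) (C := 0) (i := i) (j := j) trivial trivial g0 (by rwa [γ.source])
    (by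
      rw [γ.source, h0.self_of_nhds, sub_zero]
      exact h.2.2 i hi) (by rwa [γ.target])
  rw [γ.target] at g1 hm
  rw [h1.self_of_nhds, sub_zero] at hm
  have hz' := hγ 1
  rw [γ.target] at hz'
  exact A.isGerm_of_mem (g1.congr h1) hz' hj hm

theorem mul_germ_apply (h : X z 0 1 = 1 ∧ X z 1 1 = 0) (T : Matrix (Fin 2) (Fin 2) ℂ) :
    X z * T = !![X z 0 0 * T 0 0 + T 1 0, X z 0 0 * T 0 1 + T 1 1;
      X z 1 0 * T 0 0, X z 1 0 * T 0 1] := by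
  ext i j
  fin_cases i <;> fin_cases j <;> simp [Matrix.mul_apply, Fin.sum_univ_two, h.1, h.2]

theorem IsGerm.mul {A : Atlas c} (h : A.IsGerm z X) (ε : ℤˣ) {b : ℂ} (hb : b ∈ A.lattice) :
    A.IsGerm z fun w => X w * !![((ε : ℤ) : ℂ), 0; b, 1] := by
  have hε : (((ε : ℤ) : ℂ)) = 1 ∨ (((ε : ℤ) : ℂ)) = -1 := by
    rcases Int.units_eq_one_or ε with rfl | rfl <;> simp
  have hε2 : (((ε : ℤ) : ℂ)) ^ 2 = 1 := by rcases hε with h | h <;> rw [h] <;> norm_num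
  generalize ((ε : ℤ) : ℂ) = s at hε hε2
  have hev : ∀ᶠ w in 𝓝 z, X w * !![s, 0; b, 1] = !![X w 0 0 * s + b, 1; X w 1 0 * s, 0] := by
    filter_upwards [h.1] with w hw
    rw [mul_germ_apply ⟨hw.1, hw.2.1⟩]
    simp
  have hs0 : s ≠ 0 := by
    rintro rfl
    norm_num at hε2
  have hg : IsPicardGerm c z fun w => !![X w 0 0 * s + b, 1; X w 1 0 * s, 0] := by
    filter_upwards [h.1] with w hw
    refine ⟨by simp, by simp, by simp [mul_pow, hε2, hw.2.2.1], ?_, by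
      simpa using hw.2.2.2.2.mul_const s⟩
    have := (hw.2.2.2.1.mul_const s).add_const b
    simp only [Matrix.of_apply, Matrix.cons_val', Matrix.cons_val_zero, Matrix.cons_val_one,
      Matrix.cons_val_fin_one]
    refine this.congr_deriv ?_
    rcases hε with rfl | rfl
    · simp
    · rw [mul_neg_one, mul_neg_one, mul_neg, div_neg]
  obtain ⟨i, hi⟩ := A.cover z
  refine A.isGerm_of_mem (i := i) (hg.congr (hev.mono fun w hw => hw.symm)) h.2.1 hi ?_
  simp only [hev.self_of_nhds]
  have hm := h.2.2 i hi
  rcases hε with rfl | rfl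
  · convert! A.lattice.add_mem hm hb using 1
    simp
    ring
  · convert! A.lattice.sub_mem (A.lattice.sub_mem hb hm) (A.two_mul_mem i) using 1
    simp
    ring

theorem mem_monodromyGroup_iff (h : A.IsGerm P X) (hP : P ∈ puncturedLine c)
    (hX : ∀ i j, AnalyticAt ℂ (fun z => X z i j) P) (T : GL (Fin 2) ℂ) :
    T ∈ monodromyGroup (puncturedLine c) P hP X hX ↔ ∃ (ε : ℤˣ), ∃ b ∈ A.lattice,
      (T : Matrix (Fin 2) (Fin 2) ℂ) = !![((ε : ℤ) : ℂ), 0; b, 1] := by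
  constructor
  · rintro ⟨γ, hγ, hT⟩
    have h' := h.continuesTo hγ hT
    obtain ⟨i, hi⟩ := A.cover P
    have hm := h.2.2 i hi
    have hm' := h'.2.2 i hi
    have hv := h.1.self_of_nhds
    have hv' := h'.1.self_of_nhds
    simp only [mul_germ_apply ⟨hv.1, hv.2.1⟩] at hv' hm'
    simp only [Matrix.of_apply, Matrix.cons_val', Matrix.cons_val_zero, Matrix.cons_val_one,
      Matrix.cons_val_fin_one] at hv' hm'
    have hy := h.1.ne_zero hP
    have t01 : (T : Matrix (Fin 2) (Fin 2) ℂ) 0 1 = 0 := (mul_eq_zero.1 hv'.2.1).resolve_left hy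
    have t11 : (T : Matrix (Fin 2) (Fin 2) ℂ) 1 1 = 1 := by
      have := hv'.1
      rwa [t01, mul_zero, zero_add] at this
    have t00 : (T : Matrix (Fin 2) (Fin 2) ℂ) 0 0 ^ 2 = 1 := by
      have h3 := hv'.2.2.1
      rw [← hv.2.2.1, mul_pow] at h3
      exact mul_left_cancel₀ (pow_ne_zero 2 hy) (by rw [h3, mul_one])
    rcases sq_eq_sq_iff_eq_or_eq_neg.1 (t00.trans (one_pow 2).symm) with h1 | h1
    · refine ⟨1, (T : Matrix (Fin 2) (Fin 2) ℂ) 1 0, ?_, ?_⟩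
      rotate_left
      · ext i j
        fin_cases i <;> fin_cases j
        · simp [h1]
        · simp [t01]
        · rfl
        · simp [t11]
      · rw [h1] at hm'
        convert! A.lattice.sub_mem hm' hm using 1
        simp
    · refine ⟨-1, (T : Matrix (Fin 2) (Fin 2) ℂ) 1 0, ?_, ?_⟩
      rotate_left
      · ext i j
        fin_cases i <;> fin_cases j
        · simp [h1]
        · simp [t01]
        · rfl
        · simp [t11]
      · rw [h1] at hm'
        convert! A.lattice.add_mem (A.lattice.add_mem hm' hm) (A.two_mul_mem i) using 1
        simp
        ring
  · rintro ⟨ε, b, hb, hT⟩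
    have h' := h.mul ε hb
    rw [← hT] at h'
    exact h.connected A h'

theorem isPeriod_iff (ω : ℂ) : IsPeriod c ω ↔ ω ∈ A.lattice := by
  constructor
  · rintro ⟨l, y, h, hy, hl, hy1, hloc, rfl⟩
    choose Y H hY hYH hev using hloc
    have hU : ∀ t, l t ∈ puncturedLine c := fun t => by
      rw [← E_ne_zero_iff, ← (hy t).2]
      exact pow_ne_zero 2 (hy t).1
    let Φ : unitInterval → ℂ → Matrix (Fin 2) (Fin 2) ℂ := fun t z => !![H t z, 1; Y t z, 0]
    have hΦ : ∀ t, IsPicardGerm c (l t) (Φ t) := by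
      intro t
      filter_upwards [hYH t, (hY t).eventually_analyticAt] with w h1 h2
      exact ⟨by simp [Φ], by simp [Φ], by simpa [Φ] using h1.1, by simpa [Φ] using h1.2,
        by simpa [Φ] using h2.differentiableAt⟩
    have hval : ∀ t, Φ t (l t) 0 0 = h t ∧ Φ t (l t) 1 0 = y t := fun t =>
      ⟨by simpa [Φ] using (hev t).self_of_nhds.2, by simpa [Φ] using (hev t).self_of_nhds.1⟩
    have hc : IsContinuation Set.univ l Φ := by
      refine isContinuation_of_eventually l.continuous.continuousOn (fun t _ => hU t)
        (fun t _ => hΦ t) fun t _ => ?_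
      rw [nhdsWithin_univ]
      filter_upwards [hev t] with s hs
      rw [(hval s).1, (hval s).2]
      exact ⟨by simp [Φ, hs.2], by simp [Φ, hs.1]⟩
    obtain ⟨i, hi⟩ := A.cover (l 0)
    have := A.coord_mem_of_isContinuation (C := h 0 - y 0 * A.τ i (l 0) - A.e i) (s := 0) (t := 1)
      (i := i) (j := i) isPreconnected_univ l.continuous (fun t _ => hU t) hc trivial trivial
      (hΦ 0) hi (by
        rw [(hval 0).1, (hval 0).2]
        convert! A.lattice.zero_mem using 1
        ring) (by rwa [← hl])
    rw [(hval 1).1, (hval 1).2, ← hl, ← hy1] at this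
    convert! this using 1
    ring
  · intro hω
    obtain ⟨P, -, hP⟩ := A.overlap 0
    obtain ⟨X, hX⟩ := A.exists_isGerm hP
    obtain ⟨γ, hγ, Φ, hc, h0, h1⟩ := hX.connected A (hX.mul 1 hω)
    have hG : ∀ t, IsPicardGerm c (γ t) (Φ t) := fun t =>
      hc.isPicardGerm isPreconnected_univ γ.continuous (fun t _ => hγ t) (s := 0) trivial trivial
        (by
          rw [γ.source]
          exact hX.1.congr h0.symm)
    have hev : ∀ t, ∀ᶠ s in 𝓝 t, Φ t (γ s) = Φ s (γ s) := by
      intro t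
      have := hc.2 t trivial
      rw [nhdsWithin_univ] at this
      exact this.mono fun s hs => hs.self_of_nhds.symm
    have hcont : ∀ i j, Continuous fun t => Φ t (γ t) i j := by
      intro i j
      refine continuous_iff_continuousAt.2 fun t => ?_
      have h1 : ContinuousAt (fun s => Φ t (γ s) i j) t :=
        ContinuousAt.comp (f := γ) (g := fun w => Φ t w i j) ((hG t).analyticAt i j).continuousAt
          γ.continuous.continuousAt
      exact h1.congr ((hev t).mono fun s hs => congrFun (congrFun hs i) j)
    have e0 : Φ 0 P = X P := h0.self_of_nhds
    have e1 : Φ 1 P = X P * _ := h1.self_of_nhds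
    have hXP := hX.1.self_of_nhds
    rw [mul_germ_apply ⟨hXP.1, hXP.2.1⟩] at e1
    refine ⟨⟨γ, γ.continuous⟩, ⟨_, hcont 1 0⟩, ⟨_, hcont 0 0⟩, fun t =>
      ⟨(hG t).ne_zero (hγ t), (hG t).self_of_nhds.2.2.1⟩, by simp, ?_, fun t =>
      ⟨fun w => Φ t w 1 0, fun w => Φ t w 0 0, (hG t).analyticAt 1 0, ?_, ?_⟩, ?_⟩
    · simp [e0, e1]
    · exact (hG t).mono fun w hw => ⟨hw.2.2.1, hw.2.2.2.1⟩
    · exact (hev t).mono fun s hs => by simp [hs]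
    · simp [e0, e1]

/-! ## The explicit fundamental matrix -/

theorem IsGerm.of_isPicardMatrix (hP : P ∈ puncturedLine c) (h : IsPicardMatrix c P X) :
    A.IsGerm P X := by
  obtain ⟨⟨I, y, hIy⟩, γ, Φ, hγ, hc, h1, hlim⟩ := h
  have hg : IsPicardGerm c P X := by
    have hg : IsPicardGerm c P fun z => !![I z, 1; y z, 0] := by
      filter_upwards [hIy] with z hz
      simpa using hz.2
    exact hg.congr (hIy.mono fun z hz => hz.1.symm)
  have hS : IsPreconnected (Set.Ioi (0 : unitInterval)) := isPreconnected_Ioi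
  have hmem1 : (1 : unitInterval) ∈ Set.Ioi (0 : unitInterval) := zero_lt_one' unitInterval
  have g1 : IsPicardGerm c (γ 1) (Φ 1) := by
    rw [γ.target]
    exact hg.congr h1.symm
  have hG : ∀ t ∈ Set.Ioi (0 : unitInterval), IsPicardGerm c (γ t) (Φ t) := fun t ht =>
    hc.isPicardGerm hS γ.continuous hγ hmem1 ht g1
  obtain ⟨i, hi⟩ := A.cover P
  have hV : A.V A.base ∈ 𝓝 (γ 0) := by
    rw [γ.source, ← A.a_base]
    exact (A.isOpen_V _).mem_nhds (A.mem_V _)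
  have hV' := γ.continuous.continuousAt.eventually hV
  obtain ⟨u, hu0, hu⟩ := (mem_nhdsGE_iff_exists_Ico_subset' (zero_lt_one' unitInterval)).1
    (mem_nhdsWithin_of_mem_nhds hV')
  rw [Set.mem_Ioi] at hu0
  have hsub : ∀ t ∈ Set.Ioo 0 u, γ t ∈ A.V A.base := fun t ht => hu ⟨ht.1.le, ht.2⟩
  have hne : (𝓝[>] (0 : unitInterval)).NeBot := nhdsGT_neBot_of_exists_gt ⟨1, zero_lt_one⟩
  have hconst : ∀ s ∈ Set.Ioo 0 u, ∀ t ∈ Set.Ioo 0 u,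
      Φ s (γ s) 0 0 - Φ s (γ s) 1 0 * A.τ A.base (γ s) =
        Φ t (γ t) 0 0 - Φ t (γ t) 1 0 * A.τ A.base (γ t) := by
    intro s hs t ht
    refine isPreconnected_Ioo.induction₂ (s := Set.Ioo 0 u) (fun s t =>
      Φ s (γ s) 0 0 - Φ s (γ s) 1 0 * A.τ A.base (γ s) =
        Φ t (γ t) 0 0 - Φ t (γ t) 1 0 * A.τ A.base (γ t)) (fun t ht => ?_)
      (fun _ _ _ _ _ _ => Eq.trans) (fun _ _ _ _ => Eq.symm) hs ht
    exact ((A.eventually_coord_comp γ.continuous.continuousOn (Set.mem_Ioi.2 ht.1) (hγ t ht.1)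
      (hG t ht.1) (hc.2 t ht.1) (hsub t ht)).filter_mono
        (nhdsWithin_mono _ fun s hs => hs.1)).mono fun s hs => Eq.symm hs
  have hγ0 : Tendsto γ (𝓝[>] 0) (𝓝 0) := by
    have := γ.continuous.tendsto 0
    rw [γ.source] at this
    exact this.mono_left nhdsWithin_le_nhds
  have hy0 : Tendsto (fun t => Φ t (γ t) 1 0) (𝓝[>] 0) (𝓝 0) := by
    have hE : Tendsto (fun t => ‖E c (γ t)‖) (𝓝[>] 0) (𝓝 0) := by
      have := ((continuous_E c).tendsto 0).comp hγ0
      have h0 : E c 0 = 0 := by simp [E]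
      rw [h0] at this
      simpa using this.norm
    have hs := hE.sqrt
    rw [Real.sqrt_zero] at hs
    refine tendsto_zero_iff_norm_tendsto_zero.2 (hs.congr' ?_)
    filter_upwards [self_mem_nhdsWithin] with t ht
    rw [← (hG t ht).self_of_nhds.2.2.1, norm_pow, Real.sqrt_sq (norm_nonneg _)]
  have hτ : Tendsto (fun t => A.τ A.base (γ t)) (𝓝[>] 0) (𝓝 (A.τ A.base 0)) := by
    have := A.continuousAt_τ (A.mem_V A.base)
    rw [A.a_base] at this
    exact this.tendsto.comp hγ0
  have hD := hlim.sub (hy0.mul hτ)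
  rw [zero_mul, sub_zero] at hD
  obtain ⟨t, ht0, htu⟩ := (Ioo_mem_nhdsGT hu0 : Set.Ioo 0 u ∈ 𝓝[>] (0 : unitInterval)) |>
    nonempty_of_mem
  have hDt : Φ t (γ t) 0 0 - Φ t (γ t) 1 0 * A.τ A.base (γ t) = 0 := by
    refine tendsto_nhds_unique (tendsto_const_nhds.congr' ?_) hD
    filter_upwards [Ioo_mem_nhdsGT hu0] with s hs
    exact hconst t ⟨ht0, htu⟩ s hs
  have hm := A.coord_mem_of_isContinuation (C := X P 0 0 - X P 1 0 * A.τ i P - A.e i)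
    (s := 1) (t := t) (i := i) (j := A.base) hS γ.continuous hγ hc hmem1 ht0 g1
    (by rwa [γ.target]) (by
      rw [γ.target, h1.self_of_nhds]
      convert! A.lattice.zero_mem using 1
      ring) (hsub t ⟨ht0, htu⟩)
  refine A.isGerm_of_mem hg hP hi ?_
  rw [← neg_mem_iff]
  convert! hm using 1
  rw [A.e_base]
  linear_combination -hDt

end Atlas

theorem exists_isContinuation_trans {P Q R : ℂ} {γ : Path P Q} {δ : Path Q R}
    {Φ : unitInterval → ℂ → Matrix (Fin 2) (Fin 2) ℂ} {Y Z : ℂ → Matrix (Fin 2) (Fin 2) ℂ} {x : ℂ}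
    (h : IsContinuation (Set.Ioi 0) γ Φ) (h1 : Φ 1 =ᶠ[𝓝 Q] Y) (k : ContinuesTo δ Y Z)
    (hx : Tendsto (fun t => Φ t (γ t) 0 0) (𝓝[>] 0) (𝓝 x)) :
    ∃ Θ, IsContinuation (Set.Ioi 0) (γ.trans δ) Θ ∧ Θ 1 =ᶠ[𝓝 R] Z ∧
      Tendsto (fun t => Θ t ((γ.trans δ) t) 0 0) (𝓝[>] 0) (𝓝 x) := by
  obtain ⟨ha, hc⟩ := h
  obtain ⟨Ψ, ⟨ka, kc⟩, k0, k1⟩ := k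
  simp only [nhdsWithin_univ] at kc
  have hc' : ∀ t : unitInterval, 0 < t → ∀ᶠ s in 𝓝 t, Φ s =ᶠ[𝓝 (γ s)] Φ t := fun t ht => by
    have := hc t ht
    rwa [nhdsWithin_eq_nhds.2 (Ioi_mem_nhds ht)] at this
  let u : unitInterval → unitInterval := fun t => Set.projIcc (0 : ℝ) 1 zero_le_one (2 * t)
  let v : unitInterval → unitInterval := fun t => Set.projIcc (0 : ℝ) 1 zero_le_one (2 * t - 1)
  have hu : Continuous u := continuous_projIcc.comp (by fun_prop)
  have hv : Continuous v := continuous_projIcc.comp (by fun_prop)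
  have hupos : ∀ t, 0 < t → 0 < u t := by
    intro t ht
    have ht' : (0 : ℝ) < t := ht
    have : (0 : ℝ) < u t := by
      simp only [u, Set.coe_projIcc]
      exact lt_max_of_lt_right (lt_min one_pos (by linarith))
    exact this
  have eu : ∀ t : unitInterval, (t : ℝ) ≤ 1 / 2 → (γ.trans δ) t = γ (u t) := by
    intro t ht
    rw [Path.trans_apply, dif_pos ht]
    congr 1
    exact (Set.projIcc_of_mem zero_le_one _).symm
  have ev : ∀ t : unitInterval, ¬ (t : ℝ) ≤ 1 / 2 → (γ.trans δ) t = δ (v t) := by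
    intro t ht
    rw [Path.trans_apply, dif_neg ht]
    congr 1
    exact (Set.projIcc_of_mem zero_le_one _).symm
  let Θ : unitInterval → ℂ → Matrix (Fin 2) (Fin 2) ℂ :=
    fun t => if (t : ℝ) ≤ 1 / 2 then Φ (u t) else Ψ (v t)
  refine ⟨Θ, ⟨fun t ht0 i j => ?_, fun t ht0 => ?_⟩, ?_, ?_⟩
  · by_cases ht : (t : ℝ) ≤ 1 / 2
    · simp only [Θ, if_pos ht, eu t ht]
      exact ha _ (hupos t ht0) i j
    · simp only [Θ, if_neg ht, ev t ht]
      exact ka _ trivial i j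
  · rw [nhdsWithin_eq_nhds.2 (Ioi_mem_nhds ht0)]
    rcases lt_trichotomy (t : ℝ) (1 / 2) with ht | ht | ht
    · have hlt : ∀ᶠ s : unitInterval in 𝓝 t, (s : ℝ) < 1 / 2 :=
        continuous_subtype_val.continuousAt.eventually_lt_const ht
      filter_upwards [hlt, (hu.tendsto t).eventually (hc' (u t) (hupos t ht0))] with s hs hs'
      simp only [Θ, if_pos hs.le, if_pos ht.le, eu s hs.le]
      exact hs'
    · have hut : u t = 1 := by
        simp only [u, ht]
        norm_num
      have hvt : v t = 0 := by
        simp only [v, ht]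
        norm_num
      have hu1 := (hu.tendsto t).eventually (hc' (u t) (hupos t ht0))
      have hv1 := (hv.tendsto t).eventually (kc (v t) trivial)
      have hgt : (γ.trans δ) t = Q := by
        rw [eu t ht.le, hut]
        exact γ.target
      have hglue : ∀ᶠ z in 𝓝 ((γ.trans δ) t), Ψ 0 =ᶠ[𝓝 z] Φ 1 := by
        rw [hgt]
        exact (k0.trans h1.symm).eventually_nhds
      filter_upwards [hu1, hv1, ((γ.trans δ).continuous.tendsto t).eventually hglue] with
        s hs1 hs2 hs3
      simp only [Θ, if_pos ht.le]
      by_cases hs : (s : ℝ) ≤ 1 / 2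
      · simp only [if_pos hs, eu s hs]
        exact hs1
      · rw [hvt] at hs2
        rw [ev s hs] at hs3
        simp only [if_neg hs, ev s hs, hut]
        exact hs2.trans hs3
    · have hlt : ∀ᶠ s : unitInterval in 𝓝 t, 1 / 2 < (s : ℝ) :=
        continuous_subtype_val.continuousAt.eventually_const_lt ht
      filter_upwards [hlt, (hv.tendsto t).eventually (kc (v t) trivial)] with s hs hs'
      simp only [Θ, if_neg hs.not_ge, if_neg ht.not_ge, ev s hs.not_ge]
      exact hs'
  · have h2 : v 1 = 1 := by
      simp only [v, Set.Icc.coe_one]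
      norm_num
    have h3 : ¬ ((1 : unitInterval) : ℝ) ≤ 1 / 2 := by norm_num
    simp only [Θ, if_neg h3, h2]
    exact k1
  · have hu0 : Tendsto u (𝓝[>] 0) (𝓝[>] 0) := by
      refine tendsto_nhdsWithin_iff.2 ⟨?_, eventually_mem_nhdsWithin.mono hupos⟩
      have : u 0 = 0 := by simp [u]
      simpa [this] using (hu.tendsto 0).mono_left nhdsWithin_le_nhds
    have hlt : ∀ᶠ s : unitInterval in 𝓝[>] 0, (s : ℝ) < 1 / 2 :=
      (continuous_subtype_val.continuousAt.eventually_lt_const (by norm_num)).filter_mono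
        nhdsWithin_le_nhds
    refine (hx.comp hu0).congr' (hlt.mono fun t ht => ?_)
    simp only [Θ, if_pos ht.le, eu t ht.le, Function.comp]

theorem Atlas.exists_isPicardMatrix (A : Atlas c) (hP : P ∈ puncturedLine c) :
    ∃ X, IsPicardMatrix c P X := by
  obtain ⟨z₁, ⟨-, hz₁⟩, hU₁⟩ := A.overlap A.base
  obtain ⟨σ, hσ⟩ : ∃ σ : ℂ, σ ^ 2 = z₁ := IsAlgClosed.exists_pow_nat_eq _ two_pos
  let γ : Path 0 z₁ :=
    { toFun := fun t => (((t : ℝ) : ℂ) * σ) ^ 2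
      continuous_toFun := by fun_prop
      source' := by simp
      target' := by simp [hσ] }
  have hγ : ∀ t, γ t = (((t : ℝ) : ℂ) * σ) ^ 2 := fun t => rfl
  have hV : ∀ t, γ t ∈ A.V A.base := by
    intro t
    have hs := A.starConvex_V A.base
    rw [A.a_base, starConvex_zero_iff] at hs
    have := hs hz₁ (sq_nonneg (t : ℝ)) (pow_le_one₀ t.2.1 t.2.2)
    simpa [hγ, mul_pow, hσ] using this
  have hE : ∀ t : unitInterval, (((t : ℝ) : ℂ) * σ * A.k A.base (γ t)) ^ 2 = E c (γ t) := by
    intro t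
    rw [A.E_eq A.base _ (hV t), A.a_base, hγ]
    ring
  have hσ0 : σ ≠ 0 := by
    rintro rfl
    refine E_ne_zero_iff.2 hU₁ ?_
    simp [← hσ, E]
  have hU : ∀ t : unitInterval, 0 < t → γ t ∈ puncturedLine c := by
    intro t ht
    rw [← E_ne_zero_iff, ← hE]
    have ht' : (t : ℝ) ≠ 0 := (show (0 : ℝ) < t from ht).ne'
    exact pow_ne_zero 2 (mul_ne_zero (mul_ne_zero (by exact_mod_cast ht') hσ0)
      (A.k_ne_zero _ _ (hV t)))
  have hk : Continuous fun t => A.k A.base (γ t) := continuous_iff_continuousAt.2 fun t =>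
    ContinuousAt.comp (f := γ) (A.continuousAt_k (hV t)) γ.continuous.continuousAt
  have hτ : Continuous fun t => A.τ A.base (γ t) := continuous_iff_continuousAt.2 fun t =>
    ContinuousAt.comp (f := γ) (A.continuousAt_τ (hV t)) γ.continuous.continuousAt
  have hy : Continuous fun t : unitInterval => ((t : ℝ) : ℂ) * σ * A.k A.base (γ t) := by fun_prop
  obtain ⟨Φ, hc, hΦ⟩ := A.exists_continuation (S := Set.Ioi 0) γ.continuous.continuousOn
    hy.continuousOn hU (fun t _ => hV t) (fun t _ => hE t) 0
  have hm1 : (1 : unitInterval) ∈ Set.Ioi 0 := zero_lt_one' unitInterval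
  obtain ⟨g, hI, hY⟩ := hΦ 1 hm1
  obtain ⟨X, hX⟩ := A.exists_isGerm hP
  rw [γ.target] at g hI hY
  have hg : A.IsGerm z₁ (Φ 1) := by
    refine A.isGerm_of_mem g hU₁ hz₁ ?_
    rw [hI, hY, A.e_base]
    simp
  obtain ⟨δ, hδ, hδX⟩ := hg.connected A hX
  have hlim : Tendsto (fun t => Φ t (γ t) 0 0) (𝓝[>] 0) (𝓝 0) := by
    have h0 : Tendsto (fun t : unitInterval =>
        ((t : ℝ) : ℂ) * σ * A.k A.base (γ t) * A.τ A.base (γ t)) (𝓝 0) (𝓝 0) := by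
      have := (hy.mul hτ).tendsto 0
      simpa [Pi.mul_def] using this
    refine (h0.mono_left nhdsWithin_le_nhds).congr' ?_
    filter_upwards [self_mem_nhdsWithin] with t ht
    rw [(hΦ t ht).2.1, add_zero]
  obtain ⟨Θ, hΘ, hΘ1, hΘ0⟩ := exists_isContinuation_trans hc EventuallyEq.rfl hδX hlim
  refine ⟨X, ⟨fun z => X z 0 0, fun z => X z 1 0, ?_⟩, γ.trans δ, Θ, fun t ht => ?_, hΘ, hΘ1, hΘ0⟩
  · filter_upwards [hX.1] with z hz
    refine ⟨?_, hz.2.2⟩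
    ext i j
    fin_cases i <;> fin_cases j
    · rfl
    · simp [hz.1]
    · rfl
    · simp [hz.2.1]
  · rw [Path.trans_apply]
    split_ifs with h
    · refine hU _ ?_
      have ht' : (0 : ℝ) < t := ht
      exact Subtype.mk_lt_mk.2 (by linarith)
    · exact hδ _

end PainleveVI

namespace PainleveVI

/-! ## Linear independence of the periods -/

theorem exists_abs_re_lt {f : ℂ → ℂ} {x α : ℂ} (hα : α ≠ 0) (hf : AnalyticAt ℂ f x)
    (hd : deriv f x ≠ 0) : ∃ᶠ s in 𝓝 x, |(α * f x).re| < |(α * f s).re| := by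
  intro h
  simp only [not_lt] at h
  have h' : ∀ᶠ w in 𝓝 (f x), |(α * w).re| ≤ |(α * f x).re| := by
    rw [← hf.hasStrictDerivAt.map_nhds_eq hd]
    exact h
  have hcurve : Tendsto (fun t : ℝ => f x + t * α⁻¹) (𝓝 0) (𝓝 (f x)) := by
    have : Continuous fun t : ℝ => f x + t * α⁻¹ := by fun_prop
    simpa using this.tendsto 0
  obtain ⟨δ, hδ, hB⟩ := Metric.eventually_nhds_iff_ball.1 (hcurve.eventually h')
  have hval : ∀ t : ℝ, (α * (f x + t * α⁻¹)).re = (α * f x).re + t := by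
    intro t
    have : α * (f x + t * α⁻¹) = α * f x + t := by field_simp
    rw [this, Complex.add_re, Complex.ofReal_re]
  have h1 := hB (δ / 2) (by simp [abs_of_pos hδ, hδ])
  have h2 := hB (-(δ / 2)) (by simp [abs_of_pos hδ, hδ])
  rw [hval] at h1 h2
  cases abs_cases ((α * f x).re) <;> cases abs_cases ((α * f x).re + δ / 2) <;>
    cases abs_cases ((α * f x).re + -(δ / 2)) <;> linarith

theorem nhds_le_map_sq (a σ : ℂ) : 𝓝 (a + σ ^ 2) ≤ map (fun s => a + s ^ 2) (𝓝 σ) := by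
  have hq : AnalyticAt ℂ (fun s : ℂ => a + s ^ 2) σ := by fun_prop
  refine hq.eventually_constant_or_nhds_le_map_nhds.resolve_left fun h => ?_
  refine infinite_of_mem_nhds σ h ((Set.toFinite {σ, -σ}).subset fun s hs => ?_)
  exact sq_eq_sq_iff_eq_or_eq_neg.1 (add_left_cancel hs)

theorem deriv_E_eq {c a z : ℂ} {k : ℂ → ℂ} (hk : DifferentiableAt ℂ k z)
    (h : ∀ᶠ w in 𝓝 z, E c w = (w - a) * k w ^ 2) :
    (z - 1) * (z - c) + z * (z - c) + z * (z - 1) = k z ^ 2 + 2 * (z - a) * k z * deriv k z := by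
  have h1 := ((hasDerivAt_id z).sub_const a).mul (hk.hasDerivAt.pow 2)
  rw [(hasDerivAt_E c z).unique (h1.congr_of_eventuallyEq h)]
  simp
  ring

namespace Atlas

variable {c : ℂ} (A : Atlas c) {i j : Fin 3} {z α : ℂ}

theorem deriv_formula (hz : z ∈ A.V i) : (z - 1) * (z - c) + z * (z - c) + z * (z - 1) =
    A.k i z ^ 2 + 2 * (z - A.a i) * A.k i z * deriv (A.k i) z := by
  refine deriv_E_eq ((A.differentiableOn_k i).differentiableAt ((A.isOpen_V i).mem_nhds hz)) ?_
  filter_upwards [(A.isOpen_V i).mem_nhds hz] with w hw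
  exact A.E_eq i w hw

/-- On the double cover of a chart ramified at its branch point, the primitive has no critical
points. -/
theorem primitive_analyticAt {σ : ℂ} (hK : c * (c - 1) ≠ 0) (h : A.a i + σ ^ 2 ∈ A.V i) :
    AnalyticAt ℂ (fun s => s * A.k i (A.a i + s ^ 2) * A.τ i (A.a i + s ^ 2)) σ ∧
      deriv (fun s => s * A.k i (A.a i + s ^ 2) * A.τ i (A.a i + s ^ 2)) σ ≠ 0 := by
  have hd : ∀ s : ℂ, A.a i + s ^ 2 ∈ A.V i →
      HasDerivAt (fun s => s * A.k i (A.a i + s ^ 2) * A.τ i (A.a i + s ^ 2))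
        (c * (c - 1) / A.k i (A.a i + s ^ 2)) s := by
    intro s hs
    have hk : HasDerivAt (A.k i) (deriv (A.k i) (A.a i + s ^ 2)) (A.a i + s ^ 2) :=
      ((A.differentiableOn_k i).differentiableAt ((A.isOpen_V i).mem_nhds hs)).hasDerivAt
    have hq : HasDerivAt (fun s : ℂ => A.a i + s ^ 2) (2 * s) s := by
      simpa using (hasDerivAt_pow 2 s).const_add (A.a i)
    have h1 := ((hasDerivAt_id s).mul (hk.comp s hq)).mul ((A.hasDerivAt_τ hs).comp s hq)
    refine h1.congr_deriv ?_
    rw [← A.ode i _ hs, A.deriv_formula hs, A.E_eq i _ hs, eq_div_iff (A.k_ne_zero i _ hs)]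
    simp only [Pi.mul_apply, Function.comp, id]
    ring
  have hc : Continuous fun s : ℂ => A.a i + s ^ 2 := by fun_prop
  refine ⟨Complex.analyticAt_iff_eventually_differentiableAt.2 ?_, ?_⟩
  · filter_upwards [hc.continuousAt.eventually ((A.isOpen_V i).mem_nhds h)] with s hs
    exact (hd s hs).differentiableAt
  · rw [(hd σ h).deriv]
    exact div_ne_zero hK (A.k_ne_zero i _ h)

/-- The absolute value of the real part of `α` times a primitive. -/
noncomputable def absRe (α z : ℂ) : ℝ :=
  |(α * ((E c z) ^ (1 / 2 : ℂ) * A.τ (A.cover z).choose z)).re|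

theorem absRe_eq (h : ∀ i j, (α * (A.e i - A.e j)).re = 0) (hz : z ∈ A.V i) {y : ℂ}
    (hy : y ^ 2 = E c z) : A.absRe α z = |(α * (y * A.τ i z)).re| := by
  have hj := (A.cover z).choose_spec
  set j := (A.cover z).choose
  have h1 : (y * A.τ j z - y * A.τ i z) ^ 2 = (A.e j - A.e i) ^ 2 := by
    rw [← A.glue j i z ⟨hj, hz⟩, ← hy]
    ring
  have h2 : (α * (y * A.τ j z)).re = (α * (y * A.τ i z)).re := by
    have h3 : (α * (y * A.τ j z - y * A.τ i z)).re = 0 := by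
      rcases sq_eq_sq_iff_eq_or_eq_neg.1 h1 with h3 | h3
      · rw [h3, h]
      · rw [h3, neg_sub, h]
    rw [mul_sub, Complex.sub_re] at h3
    linarith
  have hroot : ((E c z) ^ (1 / 2 : ℂ)) ^ 2 = y ^ 2 := by
    rw [hy, one_div, Complex.cpow_ofNat_inv_pow]
  rw [← h2, absRe]
  rcases sq_eq_sq_iff_eq_or_eq_neg.1 hroot with h3 | h3
  · rw [h3]
  · rw [h3, neg_mul, mul_neg, Complex.neg_re, abs_neg]

theorem absRe_sq (h : ∀ i j, (α * (A.e i - A.e j)).re = 0) {s : ℂ} (hs : A.a i + s ^ 2 ∈ A.V i) :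
    A.absRe α (A.a i + s ^ 2) =
      |(α * (s * A.k i (A.a i + s ^ 2) * A.τ i (A.a i + s ^ 2))).re| := by
  refine A.absRe_eq h hs ?_
  rw [A.E_eq i _ hs]
  ring

theorem continuous_absRe (hK : c * (c - 1) ≠ 0) (h : ∀ i j, (α * (A.e i - A.e j)).re = 0) :
    Continuous (A.absRe α) := by
  refine continuous_iff_continuousAt.2 fun z => ?_
  obtain ⟨i, hi⟩ := A.cover z
  obtain ⟨σ, hσ⟩ : ∃ σ : ℂ, σ ^ 2 = z - A.a i := IsAlgClosed.exists_pow_nat_eq _ two_pos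
  obtain rfl : z = A.a i + σ ^ 2 := by rw [hσ]; ring
  have hc : Continuous fun s : ℂ => A.a i + s ^ 2 := by fun_prop
  refine Tendsto.mono_left ?_ (nhds_le_map_sq (A.a i) σ)
  rw [tendsto_map'_iff, A.absRe_sq h hi]
  have hcont := (A.primitive_analyticAt hK hi).1.continuousAt
  refine Tendsto.congr' ?_ ((Complex.continuous_re.continuousAt.comp
    (continuousAt_const.mul hcont)).abs)
  filter_upwards [hc.continuousAt.eventually ((A.isOpen_V i).mem_nhds hi)] with s hs
  exact (A.absRe_sq h hs).symm

theorem exists_absRe_lt (hK : c * (c - 1) ≠ 0) (h : ∀ i j, (α * (A.e i - A.e j)).re = 0)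
    (hα : α ≠ 0) (z : ℂ) : ∃ w, A.absRe α z < A.absRe α w := by
  obtain ⟨i, hi⟩ := A.cover z
  obtain ⟨σ, hσ⟩ : ∃ σ : ℂ, σ ^ 2 = z - A.a i := IsAlgClosed.exists_pow_nat_eq _ two_pos
  obtain rfl : z = A.a i + σ ^ 2 := by rw [hσ]; ring
  have hc : Continuous fun s : ℂ => A.a i + s ^ 2 := by fun_prop
  obtain ⟨ha, hd⟩ := A.primitive_analyticAt hK hi
  obtain ⟨s, hs, hsV⟩ := ((exists_abs_re_lt hα ha hd).and_eventually
    (hc.continuousAt.eventually ((A.isOpen_V i).mem_nhds hi))).exists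
  exact ⟨A.a i + s ^ 2, by rwa [A.absRe_sq h hi, A.absRe_sq h hsV]⟩

/-- Near infinity, the primitive is a function of `w = z^(-1/2)` without critical points. -/
theorem exists_at_infinity (hK : c * (c - 1) ≠ 0) (h : ∀ i j, (α * (A.e i - A.e j)).re = 0) :
    ∃ r > 0, ∃ f : ℂ → ℂ, (∀ w ∈ Metric.ball (0 : ℂ) r, AnalyticAt ℂ f w ∧ deriv f w ≠ 0) ∧
      ∀ w ∈ Metric.ball (0 : ℂ) r, w ≠ 0 → A.absRe α ((w ^ 2)⁻¹) = |(α * f w).re| := by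
  set r : ℝ := 1 / (1 + ‖c‖) with hr
  have hpos : 0 < 1 + ‖c‖ := by positivity
  have hr0 : 0 < r := by positivity
  let B := Metric.ball (0 : ℂ) r
  have hB : ∀ w ∈ B, 1 - w ^ 2 ∈ Complex.slitPlane ∧ 1 - c * w ^ 2 ∈ Complex.slitPlane := by
    intro w hw
    have hw' : ‖w‖ * (1 + ‖c‖) < 1 := by
      rwa [mem_ball_zero_iff, hr, lt_div_iff₀ hpos] at hw
    have hn := norm_nonneg w
    have hcn := norm_nonneg c
    have hw1 : ‖w‖ < 1 := by nlinarith [mul_nonneg hn hcn]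
    constructor
    · rw [sub_eq_add_neg]
      refine Complex.mem_slitPlane_of_norm_lt_one ?_
      rw [norm_neg, norm_pow]
      nlinarith
    · rw [sub_eq_add_neg]
      refine Complex.mem_slitPlane_of_norm_lt_one ?_
      rw [norm_neg, norm_mul, norm_pow]
      nlinarith [mul_nonneg hn hcn, mul_nonneg (mul_nonneg hn hcn) (sub_nonneg.2 hw1.le)]
  let κ : ℂ → ℂ := fun w => (1 - w ^ 2) ^ (1 / 2 : ℂ) * (1 - c * w ^ 2) ^ (1 / 2 : ℂ)
  have hκsq : ∀ w, κ w ^ 2 = (1 - w ^ 2) * (1 - c * w ^ 2) := by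
    intro w
    simp only [κ, mul_pow, one_div, Complex.cpow_ofNat_inv_pow]
  have hκd : ∀ w ∈ B, DifferentiableAt ℂ κ w := by
    intro w hw
    have h1 : DifferentiableAt ℂ (fun w : ℂ => 1 - w ^ 2) w := by fun_prop
    have h2 : DifferentiableAt ℂ (fun w : ℂ => 1 - c * w ^ 2) w := by fun_prop
    exact (h1.cpow_const (hB w hw).1).mul (h2.cpow_const (hB w hw).2)
  have hκ0 : ∀ w ∈ B, κ w ≠ 0 := by
    intro w hw h0
    have := hκsq w
    rw [h0, zero_pow two_ne_zero] at this
    exact mul_ne_zero (Complex.slitPlane_ne_zero (hB w hw).1)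
      (Complex.slitPlane_ne_zero (hB w hw).2) this.symm
  have hprim : DifferentiableOn ℂ (fun w => -(c * (c - 1)) / κ w) B := fun w hw =>
    ((differentiableAt_const _).div (hκd w hw) (hκ0 w hw)).differentiableWithinAt
  obtain ⟨g, hg⟩ := hprim.isExactOn_ball
  have hconn : IsPreconnected (B \ {0}) := by
    have hh : ((r / 2 : ℝ) : ℂ) ∈ B := by
      rw [mem_ball_zero_iff, Complex.norm_real, Real.norm_of_nonneg (by positivity)]
      linarith
    have hh0 : ((r / 2 : ℝ) : ℂ) ≠ 0 := Complex.ofReal_ne_zero.2 (by positivity)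
    have : IsPathConnected (B \ {0}) := ⟨_, ⟨hh, hh0⟩, fun {y} hy =>
      joinedIn_diff_zero Metric.isOpen_ball (Metric.mem_ball_self hr0)
        ((convex_ball 0 r).starConvex (Metric.mem_ball_self hr0)) hh hy.1 hh0 hy.2⟩
    exact this.isConnected.isPreconnected
  have hγ : ∀ w : ℂ, w ≠ 0 → HasDerivAt (fun w : ℂ => (w ^ 2)⁻¹) (-2 / w ^ 3) w := by
    intro w hw
    refine ((hasDerivAt_pow 2 w).inv (pow_ne_zero 2 hw)).congr_deriv ?_
    field_simp
    simp [mul_comm]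
  let y : ℂ → ℂ := fun w => κ w / w ^ 3
  have hy : ∀ w : ℂ, w ≠ 0 → y w ^ 2 = E c ((w ^ 2)⁻¹) := by
    intro w hw
    simp only [y, div_pow, hκsq, E]
    field_simp
  have hyd : ∀ w ∈ B, w ≠ 0 → DifferentiableAt ℂ y w := fun w hw hw0 =>
    (hκd w hw).div (by fun_prop) (pow_ne_zero 3 hw0)
  have hy0 : ∀ w ∈ B, w ≠ 0 → y w ≠ 0 := fun w hw hw0 =>
    div_ne_zero (hκ0 w hw) (pow_ne_zero 3 hw0)
  let L : AddSubgroup ℂ :=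
    (Complex.reAddGroupHom.comp (AddMonoidHom.mulLeft α)).ker
  have hLmem : ∀ w, w ∈ L ↔ (α * w).re = 0 := fun w => Iff.rfl
  have hL : ∀ i j, 2 * (A.e i - A.e j) ∈ L := by
    intro i j
    rw [two_mul]
    exact L.add_mem (h i j) (h i j)
  have hopen : IsOpen (B \ {0}) := Metric.isOpen_ball.sdiff isClosed_singleton
  have hw₀ : ((r / 2 : ℝ) : ℂ) ∈ B \ {0} := by
    refine ⟨?_, Complex.ofReal_ne_zero.2 (by positivity)⟩
    rw [mem_ball_zero_iff, Complex.norm_real, Real.norm_of_nonneg (by positivity)]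
    linarith
  set w₀ : ℂ := ((r / 2 : ℝ) : ℂ)
  obtain ⟨i₀, hi₀⟩ := A.cover ((w₀ ^ 2)⁻¹)
  set C : ℂ := g w₀ - y w₀ * A.τ i₀ ((w₀ ^ 2)⁻¹) - A.e i₀ with hC
  have hγc : ContinuousOn (fun w : ℂ => (w ^ 2)⁻¹) (B \ {0}) := fun w hw =>
    (hγ w hw.2).continuousAt.continuousWithinAt
  have hmem : ∀ w ∈ B \ {0}, ∀ i, (w ^ 2)⁻¹ ∈ A.V i →
      g w - C - y w * A.τ i ((w ^ 2)⁻¹) - A.e i ∈ L := by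
    intro w hw
    refine A.mem_of_isPreconnected hconn (γ := fun w => (w ^ 2)⁻¹) (y := y)
      (I := fun w => g w - C) hγc hL (fun t ht => hy t ht.2) (fun t ht i hi => ?_) hw₀ hw
      (fun i hi => (A.mem_iff_of_mem hL hi₀ hi (hy w₀ hw₀.2)).1 ?_)
    · refine Eventually.filter_mono nhdsWithin_le_nhds ?_
      refine eventually_const_of_hasDerivAt_zero ?_
      filter_upwards [hopen.mem_nhds ht,
        (hγ t ht.2).continuousAt.eventually ((A.isOpen_V i).mem_nhds hi)] with w hw hwi
      have hw0 : w ≠ 0 := hw.2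
      have hE := (hasDerivAt_E c ((w ^ 2)⁻¹)).comp w (hγ w hw.2)
      have h1 := hasDerivAt_of_sq (hyd w hw.1 hw.2).continuousAt (hy0 w hw.1 hw.2) hE
        ((continuousAt_id.eventually_ne hw.2).mono fun v hv => hy v hv)
      have h2 := ((hg w hw.1).sub_const C).sub
        (h1.mul ((A.hasDerivAt_τ hwi).comp w (hγ w hw.2)))
      refine h2.congr_deriv ?_
      have ho := A.ode i _ hwi
      rw [← hy w hw.2] at ho
      have hyw : y w = κ w / w ^ 3 := rfl
      have hk := hκ0 w hw.1
      have hyne := hy0 w hw.1 hw.2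
      rw [← ho]
      simp only [Function.comp]
      have hkw : κ w = y w * w ^ 3 := by rw [hyw]; field_simp
      rw [hkw]
      field_simp
      ring
    · convert! L.zero_mem using 1
      rw [hC]
      ring
  refine ⟨r, hr0, fun w => g w - C - A.e 0, fun w hw => ⟨?_, ?_⟩, fun w hw hw0 => ?_⟩
  · refine Complex.analyticAt_iff_eventually_differentiableAt.2 ?_
    filter_upwards [Metric.isOpen_ball.mem_nhds hw] with v hv
    exact (((hg v hv).sub_const C).sub_const (A.e 0)).differentiableAt
  · rw [(((hg w hw).sub_const C).sub_const (A.e 0)).deriv]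
    exact div_ne_zero (neg_ne_zero.2 hK) (hκ0 w hw)
  · obtain ⟨i, hi⟩ := A.cover ((w ^ 2)⁻¹)
    rw [A.absRe_eq h hi (hy w hw0)]
    have h1 := (hLmem _).1 (hmem w ⟨hw, hw0⟩ i hi)
    have h2 := h i 0
    have h3 : (α * (g w - C - A.e 0)).re = (α * (y w * A.τ i ((w ^ 2)⁻¹))).re := by
      simp only [mul_sub, Complex.sub_re] at h1 h2 ⊢
      linarith
    rw [h3]

/-- No real line contains all the half periods. -/
theorem eq_zero_of_re_eq_zero (hK : c * (c - 1) ≠ 0)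
    (h : ∀ i j, (α * (A.e i - A.e j)).re = 0) : α = 0 := by
  by_contra hα
  obtain ⟨r, hr, f, hf, hfU⟩ := A.exists_at_infinity hK h
  have hsub : Metric.closedBall (0 : ℂ) (r / 2) ⊆ Metric.ball 0 r :=
    Metric.closedBall_subset_ball (by linarith)
  obtain ⟨w₀, hw₀, hmax⟩ := (isCompact_closedBall (0 : ℂ) (r / 2)).exists_isMaxOn
    (Metric.nonempty_closedBall.2 (by positivity)) (f := fun w => |(α * f w).re|) fun w hw =>
    ((Complex.continuous_re.continuousAt.comp
      (continuousAt_const.mul (hf w (hsub hw)).1.continuousAt)).abs).continuousWithinAt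
  obtain ⟨z₀, hz₀, hmax'⟩ := (isCompact_closedBall (0 : ℂ) (((r / 2) ^ 2)⁻¹)).exists_isMaxOn
    (Metric.nonempty_closedBall.2 (by positivity)) (A.continuous_absRe hK h).continuousOn
  have h1 : |(α * f w₀).re| < A.absRe α z₀ := by
    obtain ⟨w, hw, hwr⟩ := ((exists_abs_re_lt hα (hf w₀ (hsub hw₀)).1
      (hf w₀ (hsub hw₀)).2).and_eventually (Metric.isOpen_ball.mem_nhds (hsub hw₀))).exists
    have hout : r / 2 < ‖w‖ := by
      by_contra hle
      exact absurd (hmax (mem_closedBall_zero_iff.2 (not_lt.1 hle))) (not_le.2 hw)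
    have hw0 : w ≠ 0 := by
      rintro rfl
      rw [norm_zero] at hout
      linarith
    rw [← hfU w hwr hw0] at hw
    refine hw.trans_le (hmax' (mem_closedBall_zero_iff.2 ?_))
    rw [norm_inv, norm_pow]
    gcongr
  obtain ⟨z, hz⟩ := A.exists_absRe_lt hK h hα z₀
  have hout : ((r / 2) ^ 2)⁻¹ < ‖z‖ := by
    by_contra hle
    exact absurd (hmax' (mem_closedBall_zero_iff.2 (not_lt.1 hle))) (not_le.2 hz)
  have hz0 : z ≠ 0 := by
    rintro rfl
    rw [norm_zero] at hout
    have : 0 < ((r / 2) ^ 2)⁻¹ := by positivity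
    linarith
  obtain ⟨w, hw⟩ : ∃ w : ℂ, w ^ 2 = z⁻¹ := IsAlgClosed.exists_pow_nat_eq _ two_pos
  have hwn : ‖w‖ < r / 2 := by
    refine lt_of_pow_lt_pow_left₀ 2 (by positivity) ?_
    rw [← norm_pow, hw, norm_inv]
    exact inv_lt_of_inv_lt₀ (by positivity) hout
  have hw0 : w ≠ 0 := by
    rintro rfl
    rw [zero_pow two_ne_zero, eq_comm, inv_eq_zero] at hw
    exact hz0 hw
  have hwm : w ∈ Metric.closedBall (0 : ℂ) (r / 2) := mem_closedBall_zero_iff.2 hwn.le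
  have h2 := hfU w (hsub hwm) hw0
  rw [hw, inv_inv] at h2
  rw [h2] at hz
  have h3 : |(α * f w).re| ≤ |(α * f w₀).re| := hmax hwm
  linarith

end Atlas

end PainleveVI

namespace PainleveVI

/-! ## Construction of an atlas -/

theorem exists_radial_primitive {U : Set ℂ} (hU : IsOpen U) {a : ℂ} (hs : StarConvex ℝ a U)
    {ψ : ℂ → ℂ} (hψ : DifferentiableOn ℂ ψ U) :
    ∃ G : ℂ → ℂ, ∀ z ∈ U, DifferentiableAt ℂ G z ∧ G z + 2 * (z - a) * deriv G z = ψ z := by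
  have hmem : ∀ z ∈ U, ∀ r ∈ Set.Icc (0 : ℝ) 1, a + (r : ℂ) ^ 2 * (z - a) ∈ U := by
    intro z hz r hr
    have := hs.add_smul_mem (y := z - a) (by simpa using hz) (sq_nonneg r)
      (pow_le_one₀ hr.1 hr.2)
    simpa using this
  have hψ' : ContinuousOn (deriv ψ) U := (hψ.deriv hU).continuousOn
  have hat : ∀ z ∈ U, HasDerivAt ψ (deriv ψ z) z := fun z hz =>
    (hψ.differentiableAt (hU.mem_nhds hz)).hasDerivAt
  have hc1 : ∀ z ∈ U, ContinuousOn (fun r : ℝ => ψ (a + (r : ℂ) ^ 2 * (z - a))) (Set.Icc 0 1) :=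
    fun z hz => hψ.continuousOn.comp (by fun_prop) (hmem z hz)
  have hc2 : ∀ z ∈ U, ContinuousOn (fun r : ℝ => (r : ℂ) ^ 2 * deriv ψ (a + (r : ℂ) ^ 2 * (z - a)))
      (Set.Icc 0 1) :=
    fun z hz => ContinuousOn.mul (by fun_prop) (hψ'.comp (by fun_prop) (hmem z hz))
  have hint : ∀ f : ℝ → ℂ, ContinuousOn f (Set.Icc 0 1) →
      IntervalIntegrable f MeasureTheory.volume 0 1 := fun f hf => by
    refine ContinuousOn.intervalIntegrable ?_
    rwa [Set.uIcc_of_le zero_le_one]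
  have hmeas : ∀ f : ℝ → ℂ, ContinuousOn f (Set.Icc 0 1) → MeasureTheory.AEStronglyMeasurable f
      (MeasureTheory.volume.restrict (Set.uIoc (0 : ℝ) 1)) := fun f hf =>
    (hint f hf).def'.aestronglyMeasurable
  have hder : ∀ z₀ ∈ U, HasDerivAt (fun z => ∫ r in (0 : ℝ)..1, ψ (a + (r : ℂ) ^ 2 * (z - a)))
      (∫ r in (0 : ℝ)..1, (r : ℂ) ^ 2 * deriv ψ (a + (r : ℂ) ^ 2 * (z₀ - a))) z₀ := by
    intro z₀ hz₀
    obtain ⟨ρ, hρ, hB⟩ := Metric.nhds_basis_closedBall.mem_iff.1 (hU.mem_nhds hz₀)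
    have hcont : ContinuousOn (fun x : ℂ × ℝ =>
        (x.2 : ℂ) ^ 2 * deriv ψ (a + (x.2 : ℂ) ^ 2 * (x.1 - a)))
        (Metric.closedBall z₀ ρ ×ˢ Set.Icc (0 : ℝ) 1) :=
      ContinuousOn.mul (by fun_prop) (hψ'.comp (by fun_prop) fun x hx => hmem _ (hB hx.1) _ hx.2)
    obtain ⟨M, hM⟩ := ((isCompact_closedBall z₀ ρ).prod isCompact_Icc).exists_bound_of_continuousOn
      hcont
    have hIoc : ∀ t, t ∈ Set.uIoc (0 : ℝ) 1 → t ∈ Set.Icc (0 : ℝ) 1 := fun t ht => by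
      rw [Set.uIoc_of_le zero_le_one] at ht
      exact ⟨ht.1.le, ht.2⟩
    refine (intervalIntegral.hasDerivAt_integral_of_dominated_loc_of_deriv_le
      (F := fun z r => ψ (a + (r : ℂ) ^ 2 * (z - a)))
      (F' := fun z r => (r : ℂ) ^ 2 * deriv ψ (a + (r : ℂ) ^ 2 * (z - a)))
      (bound := fun _ => M) (Metric.ball_mem_nhds z₀ hρ) ?_ (hint _ (hc1 z₀ hz₀))
      (hmeas _ (hc2 z₀ hz₀)) ?_ intervalIntegrable_const ?_).2
    · filter_upwards [hU.mem_nhds hz₀] with z hz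
      exact hmeas _ (hc1 z hz)
    · exact Eventually.of_forall fun t ht x hx =>
        hM (x, t) ⟨Metric.ball_subset_closedBall hx, hIoc t ht⟩
    · refine Eventually.of_forall fun t ht x hx => ?_
      have h1 := hat _ (hmem x (hB (Metric.ball_subset_closedBall hx)) t (hIoc t ht))
      have h2 : HasDerivAt (fun x : ℂ => a + (t : ℂ) ^ 2 * (x - a)) ((t : ℂ) ^ 2) x := by
        simpa using (((hasDerivAt_id x).sub_const a).const_mul ((t : ℂ) ^ 2)).const_add a
      exact (h1.comp x h2).congr_deriv (mul_comm _ _)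
  refine ⟨fun z => ∫ r in (0 : ℝ)..1, ψ (a + (r : ℂ) ^ 2 * (z - a)), fun z hz =>
    ⟨(hder z hz).differentiableAt, ?_⟩⟩
  rw [(hder z hz).deriv, ← intervalIntegral.integral_const_mul, ← intervalIntegral.integral_add
    (hint _ (hc1 z hz)) ((hint _ (hc2 z hz)).const_mul _)]
  have hFTC := intervalIntegral.integral_eq_sub_of_hasDerivAt (a := 0) (b := 1)
    (f := fun r : ℝ => (r : ℂ) * ψ (a + (r : ℂ) ^ 2 * (z - a)))
    (f' := fun r : ℝ => ψ (a + (r : ℂ) ^ 2 * (z - a)) +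
      2 * (z - a) * ((r : ℂ) ^ 2 * deriv ψ (a + (r : ℂ) ^ 2 * (z - a)))) (fun r hr => ?_)
    ((hint _ (hc1 z hz)).add ((hint _ (hc2 z hz)).const_mul _))
  · rw [hFTC]
    simp
  · rw [Set.uIcc_of_le zero_le_one] at hr
    have h1 := hat _ (hmem z hz r hr)
    have h0 : HasDerivAt (fun r : ℝ => (r : ℂ)) 1 r := Complex.ofRealCLM.hasDerivAt
    have h2 : HasDerivAt (fun r : ℝ => a + (r : ℂ) ^ 2 * (z - a)) (2 * r * (z - a)) r := by
      have := ((h0.pow 2).mul_const (z - a)).const_add a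
      simpa using this
    refine (h0.mul (h1.comp r h2)).congr_deriv ?_
    simp only [Function.comp]
    ring

/-- The domain around `a` on which the root below is defined: the complement of the rays from `b`
and `d` pointing away from `a`. -/
def starDomain (a b d : ℂ) : Set ℂ :=
  {z | 1 - (z - a) / (b - a) ∈ Complex.slitPlane ∧ 1 - (z - a) / (d - a) ∈ Complex.slitPlane}

/-- A branch of the square root of `(z - b) (z - d)` near `a`. -/
noncomputable def starRoot (a b d z : ℂ) : ℂ :=
  ((b - a) * (d - a)) ^ (1 / 2 : ℂ) * (1 - (z - a) / (b - a)) ^ (1 / 2 : ℂ) *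
    (1 - (z - a) / (d - a)) ^ (1 / 2 : ℂ)

variable {a b d : ℂ}

theorem starDomain_comm (a b d : ℂ) : starDomain a b d = starDomain a d b :=
  Set.ext fun _ => and_comm

theorem isOpen_starDomain (a b d : ℂ) : IsOpen (starDomain a b d) :=
  (Complex.isOpen_slitPlane.preimage (by fun_prop)).inter
    (Complex.isOpen_slitPlane.preimage (by fun_prop))

theorem self_mem_starDomain (a b d : ℂ) : a ∈ starDomain a b d := by
  simp [starDomain]

theorem starConvex_slit {z₀ : ℂ} {x : ℝ} (hx : 0 < x) (h : 1 - (z₀ - a) / (b - a) = x) :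
    StarConvex ℝ z₀ {z | 1 - (z - a) / (b - a) ∈ Complex.slitPlane} := by
  rw [starConvex_iff_forall_pos (by simp [h, hx])]
  intro z hz s t hs ht hst
  have := Complex.starConvex_ofReal_slitPlane hx hz hs.le ht.le hst
  simp only [Set.mem_ofPred_eq]
  convert! this using 1
  have hs' : (s : ℂ) + t = 1 := by exact_mod_cast hst
  rw [← h]
  simp only [Complex.real_smul]
  have e : s = 1 - (t : ℂ) := by rw [← hs']; ring
  rw [e]
  ring

theorem starConvex_starDomain (a b d : ℂ) : StarConvex ℝ a (starDomain a b d) :=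
  (starConvex_slit one_pos (by simp)).inter (starConvex_slit one_pos (by simp))

theorem starRoot_ne_zero (hb : b ≠ a) (hd : d ≠ a) {z : ℂ} (hz : z ∈ starDomain a b d) :
    starRoot a b d z ≠ 0 := by
  have h : ∀ w : ℂ, w ≠ 0 → w ^ (1 / 2 : ℂ) ≠ 0 := fun w hw h => by simp [hw] at h
  exact mul_ne_zero (mul_ne_zero (h _ (mul_ne_zero (sub_ne_zero.2 hb) (sub_ne_zero.2 hd)))
    (h _ (Complex.slitPlane_ne_zero hz.1))) (h _ (Complex.slitPlane_ne_zero hz.2))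

theorem starRoot_sq (hb : b ≠ a) (hd : d ≠ a) (z : ℂ) :
    starRoot a b d z ^ 2 = (z - b) * (z - d) := by
  have hb' := sub_ne_zero.2 hb
  have hd' := sub_ne_zero.2 hd
  simp only [starRoot, mul_pow, one_div, Complex.cpow_ofNat_inv_pow]
  field_simp
  ring

theorem differentiableOn_starRoot (a b d : ℂ) :
    DifferentiableOn ℂ (starRoot a b d) (starDomain a b d) := by
  intro z hz
  have h1 : DifferentiableAt ℂ (fun z : ℂ => 1 - (z - a) / (b - a)) z := by fun_prop
  have h2 : DifferentiableAt ℂ (fun z : ℂ => 1 - (z - a) / (d - a)) z := by fun_prop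
  exact (((h1.cpow_const hz.1).const_mul _).mul (h2.cpow_const hz.2)).differentiableWithinAt

/-- The differential equation satisfied by the quotient of a primitive by the root `y`. -/
def SolvesOn (c : ℂ) (τ : ℂ → ℂ) (U : Set ℂ) : Prop :=
  DifferentiableOn ℂ τ U ∧ ∀ z ∈ U, ((z - 1) * (z - c) + z * (z - c) + z * (z - 1)) * τ z +
    2 * E c z * deriv τ z = c * (c - 1)

theorem SolvesOn.mono {c : ℂ} {τ : ℂ → ℂ} {U V : Set ℂ} (h : SolvesOn c τ U) (hV : V ⊆ U) :
    SolvesOn c τ V :=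
  ⟨h.1.mono hV, fun z hz => h.2 z (hV hz)⟩

theorem exists_solvesOn {c : ℂ} (hb : b ≠ a) (hd : d ≠ a)
    (hE : ∀ z, E c z = (z - a) * (z - b) * (z - d)) : ∃ τ, SolvesOn c τ (starDomain a b d) := by
  have hk := differentiableOn_starRoot a b d
  have hk0 : ∀ z ∈ starDomain a b d, starRoot a b d z ≠ 0 := fun z hz => starRoot_ne_zero hb hd hz
  obtain ⟨G, hG⟩ := exists_radial_primitive (isOpen_starDomain a b d) (starConvex_starDomain a b d)
    ((differentiableOn_const (c * (c - 1))).div hk hk0)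
  refine ⟨fun z => G z / starRoot a b d z, fun z hz =>
    ((hG z hz).1.differentiableWithinAt.div (hk z hz) (hk0 z hz)), fun z hz => ?_⟩
  have hkz := hk.differentiableAt ((isOpen_starDomain a b d).mem_nhds hz)
  have hEk : ∀ w, E c w = (w - a) * starRoot a b d w ^ 2 := fun w => by
    rw [starRoot_sq hb hd, hE, mul_assoc]
  rw [deriv_fun_div (hG z hz).1 hkz (hk0 z hz), deriv_E_eq hkz (Eventually.of_forall hEk), hEk]
  have hne := hk0 z hz
  have h := (hG z hz).2
  simp only [Pi.div_apply] at h
  rw [eq_div_iff hne] at h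
  rw [← h]
  field_simp
  ring

theorem SolvesOn.exists_const {c : ℂ} {τ τ' : ℂ → ℂ} {U : Set ℂ} (hU : IsOpen U)
    (hc : IsPreconnected U) (h : SolvesOn c τ U) (h' : SolvesOn c τ' U) :
    ∃ e : ℂ, ∀ z ∈ U, E c z * (τ z - τ' z) ^ 2 = e ^ 2 := by
  rcases U.eq_empty_or_nonempty with rfl | ⟨w, hw⟩
  · exact ⟨0, by simp⟩
  obtain ⟨e, he⟩ : ∃ e : ℂ, e ^ 2 = E c w * (τ w - τ' w) ^ 2 :=
    IsAlgClosed.exists_pow_nat_eq _ two_pos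
  have hd : ∀ z ∈ U, HasDerivAt (fun z => E c z * (τ z - τ' z) ^ 2) 0 z := by
    intro z hz
    have h1 := (h.1.differentiableAt (hU.mem_nhds hz)).hasDerivAt
    have h2 := (h'.1.differentiableAt (hU.mem_nhds hz)).hasDerivAt
    refine ((hasDerivAt_E c z).mul ((h1.sub h2).pow 2)).congr_deriv ?_
    simp only [Pi.sub_apply, Pi.pow_apply]
    push_cast
    linear_combination (τ z - τ' z) * (h.2 z hz - h'.2 z hz)
  refine ⟨e, fun z hz => ?_⟩
  rw [he]
  exact hU.is_const_of_deriv_eq_zero hc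
    (fun v hv => (hd v hv).differentiableAt.differentiableWithinAt) (fun v hv => (hd v hv).deriv)
    hz hw

/-- The open half plane through `m` with normal direction given by `ν`. -/
def halfPlane (m ν : ℂ) : Set ℂ := {z | 0 < ((z - m) * ν).re}

variable {m p q ν : ℂ}

theorem isOpen_halfPlane (m ν : ℂ) : IsOpen (halfPlane m ν) :=
  isOpen_lt continuous_const (by fun_prop)

theorem convex_halfPlane (m ν : ℂ) : Convex ℝ (halfPlane m ν) := by
  intro x hx y hy s t hs ht hst
  simp only [halfPlane, Set.mem_ofPred_eq] at *
  have e : (s • x + t • y - m) * ν = s • ((x - m) * ν) + t • ((y - m) * ν) := by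
    have hs' : (s : ℂ) + t = 1 := by exact_mod_cast hst
    simp only [Complex.real_smul]
    linear_combination m * ν * hs'
  rw [e, Complex.add_re, Complex.smul_re, Complex.smul_re, smul_eq_mul, smul_eq_mul]
  rcases hs.eq_or_lt with rfl | h
  · have : t = 1 := by linarith
    simpa [this] using hy
  · have := mul_pos h hx
    have := mul_nonneg ht hy.le
    linarith

theorem one_sub_mem_slitPlane {w : ℂ} (h : ∀ x : ℝ, 1 ≤ x → w ≠ x) :
    1 - w ∈ Complex.slitPlane := by
  rw [Complex.mem_slitPlane_iff]
  by_contra! hc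
  simp only [Complex.sub_re, Complex.one_re, Complex.sub_im, Complex.one_im] at hc
  refine h w.re (by linarith [hc.1]) (Complex.ext (by simp) ?_)
  simp only [Complex.ofReal_im]
  linarith [hc.2]

theorem slit_of_re_nonpos {z : ℂ} (hpm : p ≠ m) (hp : 0 < ((p - m) * ν).re)
    (hz : ((z - m) * ν).re ≤ 0) : 1 - (z - m) / (p - m) ∈ Complex.slitPlane := by
  refine one_sub_mem_slitPlane fun x hx h => ?_
  rw [div_eq_iff (sub_ne_zero.2 hpm)] at h
  rw [h, mul_assoc, Complex.re_ofReal_mul] at hz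
  nlinarith

theorem slit_of_re_nonneg {z : ℂ} (hqm : q ≠ m) (hq : ((q - m) * ν).re < 0)
    (hz : 0 ≤ ((z - m) * ν).re) : 1 - (z - m) / (q - m) ∈ Complex.slitPlane :=
  slit_of_re_nonpos (ν := -ν) hqm (by simpa using hq) (by simpa using hz)

theorem halfPlane_subset (hpm : p ≠ m) (hpq : p ≠ q) (hp : 0 < ((p - m) * ν).re)
    (hq : ((q - m) * ν).re < 0) : halfPlane m ν ⊆ starDomain p m q := by
  intro z hz
  simp only [halfPlane, Set.mem_ofPred_eq] at hz
  constructor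
  · refine one_sub_mem_slitPlane fun x hx h => ?_
    rw [div_eq_iff (sub_ne_zero.2 hpm.symm)] at h
    have e : (z - m) * ν = ((1 - x : ℝ) : ℂ) * ((p - m) * ν) := by
      push_cast
      linear_combination ν * h
    rw [e, Complex.re_ofReal_mul] at hz
    nlinarith
  · refine one_sub_mem_slitPlane fun x hx h => ?_
    rw [div_eq_iff (sub_ne_zero.2 hpq.symm)] at h
    have e : (z - m) * ν = ((1 - x : ℝ) : ℂ) * ((p - m) * ν) + (x : ℂ) * ((q - m) * ν) := by
      push_cast
      linear_combination ν * h
    rw [e, Complex.add_re, Complex.re_ofReal_mul, Complex.re_ofReal_mul] at hz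
    nlinarith

theorem isPreconnected_inter (hpm : p ≠ m) (hqm : q ≠ m) (hp : 0 < ((p - m) * ν).re)
    (hq : ((q - m) * ν).re < 0) : IsPreconnected (starDomain m p q ∩ halfPlane m ν) := by
  have e : starDomain m p q ∩ halfPlane m ν =
      {z | 1 - (z - m) / (p - m) ∈ Complex.slitPlane} ∩ halfPlane m ν := by
    ext z
    exact ⟨fun h => ⟨h.1.1, h.2⟩, fun h => ⟨⟨h.1, slit_of_re_nonneg hqm hq (le_of_lt h.2)⟩, h.2⟩⟩
  have hpm' := sub_ne_zero.2 hpm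
  have h1 : 1 - (m + (p - m) / 2 - m) / (p - m) = ((1 / 2 : ℝ) : ℂ) := by
    push_cast
    field_simp
    ring
  have hmid : m + (p - m) / 2 ∈ halfPlane m ν := by
    have : (m + (p - m) / 2 - m) * ν = ((1 / 2 : ℝ) : ℂ) * ((p - m) * ν) := by
      push_cast
      ring
    simp only [halfPlane, Set.mem_ofPred_eq, this, Complex.re_ofReal_mul]
    positivity
  rw [e]
  have hs := (starConvex_slit one_half_pos h1).inter ((convex_halfPlane m ν).starConvex hmid)
  refine (hs.isPathConnected (Set.mem_inter ?_ hmid)).isConnected.isPreconnected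
  simp only [Set.mem_ofPred_eq, h1]
  exact Complex.ofReal_mem_slitPlane.2 one_half_pos

theorem segment_mem_inter (hpm : p ≠ m) (hqm : q ≠ m) (hp : 0 < ((p - m) * ν).re)
    (hq : ((q - m) * ν).re < 0) {s : ℝ} (hs : s ∈ Set.Ioo (0 : ℝ) 1) :
    m + s * (p - m) ∈ starDomain m p q ∩ halfPlane m ν := by
  have hm : 0 < ((m + s * (p - m) - m) * ν).re := by
    have : (m + s * (p - m) - m) * ν = (s : ℂ) * ((p - m) * ν) := by ring
    rw [this, Complex.re_ofReal_mul]
    exact mul_pos hs.1 hp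
  refine ⟨⟨?_, slit_of_re_nonneg hqm hq hm.le⟩, hm⟩
  have hpm' := sub_ne_zero.2 hpm
  have : 1 - (m + s * (p - m) - m) / (p - m) = ((1 - s : ℝ) : ℂ) := by
    push_cast
    field_simp
    ring
  rw [this]
  exact Complex.ofReal_mem_slitPlane.2 (sub_pos.2 hs.2)

/-- An atlas around a branch point `m` such that the segments to the other two are disjoint. -/
theorem exists_atlas {c : ℂ} (hpm : p ≠ m) (hqm : q ≠ m) (hpq : p ≠ q)
    (hE : ∀ z, E c z = (z - m) * (z - p) * (z - q)) (hp : 0 < ((p - m) * ν).re)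
    (hq : ((q - m) * ν).re < 0) (base : Fin 3) (hbase : ![m, p, q] base = 0) :
    ∃ A : Atlas c, A.a = ![m, p, q] ∧ ∀ s ∈ Set.Ioo (0 : ℝ) 1,
      m + s * (p - m) ∈ A.V 0 ∩ A.V 1 ∧ m + s * (q - m) ∈ A.V 0 ∩ A.V 2 := by
  have hq' : 0 < ((q - m) * -ν).re := by simpa using hq
  have hp' : ((p - m) * -ν).re < 0 := by simpa using hp
  have hE1 : ∀ z, E c z = (z - p) * (z - m) * (z - q) := fun z => by rw [hE]; ring
  have hE2 : ∀ z, E c z = (z - q) * (z - m) * (z - p) := fun z => by rw [hE]; ring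
  obtain ⟨τ₀, h₀⟩ := exists_solvesOn hpm hqm hE
  obtain ⟨τ₁, h₁⟩ := exists_solvesOn hpm.symm hpq.symm hE1
  obtain ⟨τ₂, h₂⟩ := exists_solvesOn hqm.symm hpq hE2
  have sub1 := halfPlane_subset hpm hpq hp hq
  have sub2 := halfPlane_subset (ν := -ν) hqm hpq.symm hq' hp'
  obtain ⟨e₁, he₁⟩ := (h₀.mono Set.inter_subset_left).exists_const
    ((isOpen_starDomain m p q).inter (isOpen_halfPlane m ν)) (isPreconnected_inter hpm hqm hp hq)
    (h₁.mono (Set.inter_subset_right.trans sub1))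
  have pc2 := isPreconnected_inter (ν := -ν) hqm hpm hq' hp'
  rw [starDomain_comm] at pc2
  obtain ⟨e₂, he₂⟩ := (h₀.mono Set.inter_subset_left).exists_const
    ((isOpen_starDomain m p q).inter (isOpen_halfPlane m (-ν))) pc2
    (h₂.mono (Set.inter_subset_right.trans sub2))
  have seg1 : ∀ s ∈ Set.Ioo (0 : ℝ) 1, m + s * (p - m) ∈ starDomain m p q ∩ halfPlane m ν :=
    fun s hs => segment_mem_inter hpm hqm hp hq hs
  have seg2 : ∀ s ∈ Set.Ioo (0 : ℝ) 1, m + s * (q - m) ∈ starDomain m p q ∩ halfPlane m (-ν) :=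
    fun s hs => by
      rw [starDomain_comm]
      exact segment_mem_inter hqm hpm hq' hp' hs
  have hempty : ∀ z, z ∈ halfPlane m ν → z ∈ halfPlane m (-ν) → False := fun z h h' => by
    simp only [halfPlane, Set.mem_ofPred_eq, mul_neg, Complex.neg_re] at h h'
    linarith
  have hhalf : (1 / 2 : ℝ) ∈ Set.Ioo (0 : ℝ) 1 := by norm_num
  have hU : ∀ x : ℂ, x ≠ m → (∀ s ∈ Set.Ioo (0 : ℝ) 1, m + s * (x - m) ∈ starDomain m p q) →
      ∀ s ∈ Set.Ioo (0 : ℝ) 1, m + s * (x - m) ∈ puncturedLine c := by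
    intro x hx h s hs
    rw [← E_ne_zero_iff, hE, mul_assoc, ← starRoot_sq hpm hqm]
    refine mul_ne_zero ?_ (pow_ne_zero 2 (starRoot_ne_zero hpm hqm (h s hs)))
    rw [add_sub_cancel_left]
    exact mul_ne_zero (Complex.ofReal_ne_zero.2 hs.1.ne') (sub_ne_zero.2 hx)
  have u1 := hU p hpm (fun s hs => (seg1 s hs).1) _ hhalf
  have u2 := hU q hqm (fun s hs => (seg2 s hs).1) _ hhalf
  refine ⟨{
    a := ![m, p, q]
    V := ![starDomain m p q, halfPlane m ν, halfPlane m (-ν)]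
    k := ![starRoot m p q, starRoot p m q, starRoot q m p]
    τ := ![τ₀, τ₁, τ₂]
    e := fun i => ![0, e₁, e₂] i - ![0, e₁, e₂] base
    base := base
    isOpen_V := ?_
    mem_V := ?_
    starConvex_V := ?_
    cover := ?_
    differentiableOn_k := ?_
    k_ne_zero := ?_
    E_eq := ?_
    differentiableOn_τ := ?_
    ode := ?_
    glue := ?_
    overlap := ?_
    a_base := hbase
    e_base := sub_self _ }, rfl, fun s hs => ⟨seg1 s hs, seg2 s hs⟩⟩
  · intro i
    fin_cases i
    exacts [isOpen_starDomain m p q, isOpen_halfPlane m ν, isOpen_halfPlane m (-ν)]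
  · intro i
    fin_cases i
    exacts [self_mem_starDomain m p q, hp, hq']
  · intro i
    fin_cases i
    exacts [starConvex_starDomain m p q, (convex_halfPlane m ν).starConvex hp,
      (convex_halfPlane m (-ν)).starConvex hq']
  · intro z
    rcases lt_trichotomy 0 ((z - m) * ν).re with h | h | h
    · exact ⟨1, h⟩
    · exact ⟨0, slit_of_re_nonpos hpm hp h.ge, slit_of_re_nonneg hqm hq h.le⟩
    · refine ⟨2, ?_⟩
      change 0 < ((z - m) * -ν).re
      simpa using h
  · intro i
    fin_cases i
    exacts [differentiableOn_starRoot m p q, (differentiableOn_starRoot p m q).mono sub1,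
      (differentiableOn_starRoot q m p).mono sub2]
  · intro i z hz
    fin_cases i
    exacts [starRoot_ne_zero hpm hqm hz, starRoot_ne_zero hpm.symm hpq.symm (sub1 hz),
      starRoot_ne_zero hqm.symm hpq (sub2 hz)]
  · intro i z hz
    fin_cases i
    · exact (hE z).trans (by simp [starRoot_sq hpm hqm, mul_assoc])
    · exact (hE1 z).trans (by simp [starRoot_sq hpm.symm hpq.symm, mul_assoc])
    · exact (hE2 z).trans (by simp [starRoot_sq hqm.symm hpq, mul_assoc])
  · intro i
    fin_cases i
    exacts [h₀.1, h₁.1.mono sub1, h₂.1.mono sub2]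
  · intro i z hz
    fin_cases i
    exacts [h₀.2 z hz, h₁.2 z (sub1 hz), h₂.2 z (sub2 hz)]
  · intro i j z hz
    obtain ⟨hi, hj⟩ := hz
    have key : ∀ x y w u v : ℂ, x * (y - w) ^ 2 = u ^ 2 →
        x * (y - w) ^ 2 = (0 - v - (u - v)) ^ 2 := fun x y w u v h => by rw [h]; ring
    have key' : ∀ x y w u v : ℂ, x * (y - w) ^ 2 = u ^ 2 →
        x * (w - y) ^ 2 = ((u - v) - (0 - v)) ^ 2 := fun x y w u v h => by
      linear_combination h
    fin_cases i <;> fin_cases j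
    · simp
    · exact key _ _ _ _ _ (he₁ z ⟨hi, hj⟩)
    · exact key _ _ _ _ _ (he₂ z ⟨hi, hj⟩)
    · exact key' _ _ _ _ _ (he₁ z ⟨hj, hi⟩)
    · simp
    · exact (hempty z hi hj).elim
    · exact key' _ _ _ _ _ (he₂ z ⟨hj, hi⟩)
    · exact (hempty z hj hi).elim
    · simp
  · intro i
    fin_cases i
    exacts [⟨_, ⟨(seg1 _ hhalf).1, (seg1 _ hhalf).1⟩, u1⟩, ⟨_, seg1 _ hhalf, u1⟩,
      ⟨_, seg2 _ hhalf, u2⟩]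

end PainleveVI

namespace PainleveVI

/-! ## The integrals along the segments -/

theorem norm_inv_sqrt_le {x y : ℝ} (hx : 0 < x) (hy : 0 < y) :
    (√(x * y))⁻¹ ≤ (√(x + y))⁻¹ * (x ^ (-(1 / 2) : ℝ) + y ^ (-(1 / 2) : ℝ)) := by
  rw [Real.rpow_neg hx.le, Real.rpow_neg hy.le, ← Real.sqrt_eq_rpow, ← Real.sqrt_eq_rpow,
    Real.sqrt_mul hx.le]
  have h1 := Real.sqrt_pos.2 hx
  have h2 := Real.sqrt_pos.2 hy
  have h3 := Real.sqrt_pos.2 (add_pos hx hy)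
  have h4 : √(x + y) ≤ √x + √y := Real.sqrt_le_iff.2 ⟨by positivity, by
    nlinarith [Real.sq_sqrt hx.le, Real.sq_sqrt hy.le, mul_pos h1 h2]⟩
  rw [inv_add_inv h1.ne' h2.ne', inv_mul_eq_div, le_div_iff₀ h3, inv_mul_eq_div]
  gcongr

theorem intervalIntegrable_const_div {α β : ℝ} (hαβ : α < β) {r Q : ℝ → ℂ}
    (hr : ContinuousOn r (Set.Ioo α β)) (hQ : ContinuousOn Q (Set.Icc α β))
    (hQ0 : ∀ s ∈ Set.Icc α β, Q s ≠ 0)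
    (h : ∀ s ∈ Set.Ioo α β, r s ^ 2 = (s - α) * (β - s) * Q s) (C : ℂ) :
    IntervalIntegrable (fun s => C / r s) MeasureTheory.volume α β := by
  obtain ⟨s₀, hs₀, hmin⟩ := isCompact_Icc.exists_isMinOn (Set.nonempty_Icc.2 hαβ.le) hQ.norm
  have hδ : 0 < ‖Q s₀‖ := norm_pos_iff.2 (hQ0 s₀ hs₀)
  set δ := ‖Q s₀‖
  have hb1 : IntervalIntegrable (fun s : ℝ => (s - α) ^ (-(1 / 2) : ℝ)) MeasureTheory.volume
      α β := by
    have := (intervalIntegral.intervalIntegrable_rpow' (r := -(1 / 2)) (a := 0) (b := β - α)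
      (by norm_num)).comp_sub_right α
    simpa using this
  have hb2 : IntervalIntegrable (fun s : ℝ => (β - s) ^ (-(1 / 2) : ℝ)) MeasureTheory.volume
      α β := by
    have := (intervalIntegral.intervalIntegrable_rpow' (r := -(1 / 2)) (a := β - α) (b := 0)
      (by norm_num)).comp_sub_left β
    simpa using this
  have hb := ((hb1.add hb2).const_mul (√(β - α))⁻¹).const_mul (‖C‖ * (√δ)⁻¹)
  refine hb.mono_fun ?_ ?_
  · have hm : ContinuousOn (fun s => C / r s) (Set.Ioo α β) := by
      refine continuousOn_const.div hr fun s hs h0 => ?_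
      have := h s hs
      rw [h0, zero_pow two_ne_zero, eq_comm] at this
      have h1 : ((s : ℂ) - α) ≠ 0 := by exact_mod_cast (sub_pos.2 hs.1).ne'
      have h2 : ((β : ℂ) - s) ≠ 0 := by exact_mod_cast (sub_pos.2 hs.2).ne'
      exact mul_ne_zero (mul_ne_zero h1 h2) (hQ0 s ⟨hs.1.le, hs.2.le⟩) this
    rw [Set.uIoc_of_le hαβ.le, ← MeasureTheory.restrict_Ioo_eq_restrict_Ioc]
    exact hm.aestronglyMeasurable measurableSet_Ioo
  · rw [Set.uIoc_of_le hαβ.le, ← MeasureTheory.restrict_Ioo_eq_restrict_Ioc]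
    refine (MeasureTheory.ae_restrict_iff' measurableSet_Ioo).2 (Eventually.of_forall
      fun s hs => ?_)
    have h1 : 0 < s - α := sub_pos.2 hs.1
    have h2 : 0 < β - s := sub_pos.2 hs.2
    have hle : δ ≤ ‖Q s‖ := hmin ⟨hs.1.le, hs.2.le⟩
    have hn : ‖r s‖ = √((s - α) * (β - s) * ‖Q s‖) := by
      rw [← Real.sqrt_sq (norm_nonneg (r s)), ← norm_pow, h s hs, norm_mul, norm_mul,
        ← Complex.ofReal_sub, ← Complex.ofReal_sub, Complex.norm_real, Complex.norm_real,
        Real.norm_of_nonneg h1.le, Real.norm_of_nonneg h2.le]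
    have key : (√((s - α) * (β - s)))⁻¹ ≤
        (√(β - α))⁻¹ * ((s - α) ^ (-(1 / 2) : ℝ) + (β - s) ^ (-(1 / 2) : ℝ)) := by
      have := norm_inv_sqrt_le h1 h2
      rwa [show s - α + (β - s) = β - α by ring] at this
    simp only [norm_div, hn]
    rw [Real.sqrt_mul (by positivity), div_eq_mul_inv, mul_inv]
    refine le_trans ?_ (Real.le_norm_self _)
    calc ‖C‖ * ((√((s - α) * (β - s)))⁻¹ * (√‖Q s‖)⁻¹)
        ≤ ‖C‖ * (((√(β - α))⁻¹ * ((s - α) ^ (-(1 / 2) : ℝ) + (β - s) ^ (-(1 / 2) : ℝ))) *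
          (√δ)⁻¹) := by gcongr
      _ = _ := by ring

/-- The integral of the form along a segment joining two branch points is the doubled difference
of the offsets, up to sign. -/
theorem Atlas.integral_segment {c : ℂ} (A : Atlas c) {i j : Fin 3} {α β : ℝ} {u v b : ℂ}
    (hαβ : α < β) (hu : u + α * v = A.a i) (hv : u + β * v = A.a j) (hij : A.a i ≠ A.a j)
    (hbi : b ≠ A.a i) (hbj : b ≠ A.a j)
    (hE : ∀ z, E c z = (z - A.a i) * (z - A.a j) * (z - b))
    (hseg : ∀ s ∈ Set.Ioo α β, u + s * v ∈ A.V i ∩ A.V j) {r : ℝ → ℂ}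
    (hr : ContinuousOn r (Set.Ioo α β)) (hr2 : ∀ s ∈ Set.Ioo α β, r s ^ 2 = E c (u + s * v)) :
    IntervalIntegrable (fun s => c * (c - 1) * v / r s) MeasureTheory.volume α β ∧
      ((∫ s in α..β, c * (c - 1) * v / r s) = 2 * (A.e j - A.e i) ∨
        (∫ s in α..β, c * (c - 1) * v / r s) = -(2 * (A.e j - A.e i))) := by
  have hv0 : v ≠ 0 := by
    rintro rfl
    exact hij (by rw [← hu, ← hv]; simp)
  have hne : ∀ s ∈ Set.Ioo α β, u + s * v ∈ puncturedLine c := by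
    intro s hs
    rw [← E_ne_zero_iff, A.E_eq i _ (hseg s hs).1]
    refine mul_ne_zero ?_ (pow_ne_zero 2 (A.k_ne_zero i _ (hseg s hs).1))
    have : u + s * v - A.a i = (s - α : ℝ) * v := by
      push_cast
      rw [← hu]
      ring
    rw [this]
    exact mul_ne_zero (Complex.ofReal_ne_zero.2 (sub_pos.2 hs.1).ne') hv0
  have hr0 : ∀ s ∈ Set.Ioo α β, r s ≠ 0 := by
    intro s hs h0
    refine E_ne_zero_iff.2 (hne s hs) ?_
    rw [← hr2 s hs, h0]
    simp
  have hint : IntervalIntegrable (fun s => c * (c - 1) * v / r s) MeasureTheory.volume α β := by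
    refine intervalIntegrable_const_div hαβ hr (Q := fun s => -v ^ 2 * (u + s * v - b))
      (by fun_prop) (fun s hs => ?_) (fun s hs => ?_) _
    · refine mul_ne_zero (neg_ne_zero.2 (pow_ne_zero 2 hv0)) (sub_ne_zero.2 ?_)
      rcases hs.1.eq_or_lt with rfl | h1
      · rw [hu]
        exact hbi.symm
      rcases hs.2.eq_or_lt with rfl | h2
      · rw [hv]
        exact hbj.symm
      · intro h
        refine E_ne_zero_iff.2 (hne s ⟨h1, h2⟩) ?_
        rw [hE, h]
        simp
    · rw [hr2 s hs, hE, ← hu, ← hv]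
      ring
  refine ⟨hint, ?_⟩
  have hz : ∀ s : ℝ, HasDerivAt (fun s : ℝ => u + s * v) v s := fun s => by
    have h0 : HasDerivAt (fun r : ℝ => (r : ℂ)) 1 s := Complex.ofRealCLM.hasDerivAt
    simpa using (h0.mul_const v).const_add u
  have hzc : Continuous fun s : ℝ => u + s * v := by fun_prop
  have hder : ∀ l, (∀ s ∈ Set.Ioo α β, u + s * v ∈ A.V l) → ∀ s ∈ Set.Ioo α β,
      HasDerivAt (fun s => r s * A.τ l (u + s * v)) (c * (c - 1) * v / r s / 2) s := by
    intro l hl s hs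
    have hn : Set.Ioo α β ∈ 𝓝 s := Ioo_mem_nhds hs.1 hs.2
    have h1 := hasDerivAt_of_sq (hr.continuousAt hn) (hr0 s hs)
      ((hasDerivAt_E c (u + s * v)).comp s (hz s)) (by
        filter_upwards [hn] with t ht
        exact hr2 t ht)
    refine (h1.mul ((A.hasDerivAt_τ (hl s hs)).comp s (hz s))).congr_deriv ?_
    have ho := A.ode l _ (hl s hs)
    rw [← hr2 s hs] at ho
    have := hr0 s hs
    rw [← ho]
    simp only [Function.comp]
    field_simp
  have hd1 := hder i fun s hs => (hseg s hs).1
  have hd2 := hder j fun s hs => (hseg s hs).2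
  have hEi : E c (A.a i) = 0 := by rw [hE]; simp
  have hEj : E c (A.a j) = 0 := by rw [hE]; simp
  have hlim : ∀ (l : Filter ℝ) (k : Fin 3) (s₀ : ℝ), l ≤ 𝓝 s₀ → Set.Ioo α β ∈ l →
      u + s₀ * v = A.a k → E c (A.a k) = 0 →
      Tendsto (fun s => r s * A.τ k (u + s * v)) l (𝓝 0) := by
    intro l k s₀ hl hm h1 h2
    have hzl : Tendsto (fun s : ℝ => u + s * v) l (𝓝 (A.a k)) := by
      rw [← h1]
      exact (hzc.tendsto s₀).mono_left hl
    have hEl := (((continuous_E c).tendsto (A.a k)).comp hzl).norm.sqrt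
    rw [h2, norm_zero, Real.sqrt_zero] at hEl
    have hrl : Tendsto r l (𝓝 0) := by
      refine tendsto_zero_iff_norm_tendsto_zero.2 (hEl.congr' ?_)
      filter_upwards [hm] with s hs
      rw [Function.comp, ← hr2 s hs, norm_pow, Real.sqrt_sq (norm_nonneg _)]
    simpa using hrl.mul ((A.continuousAt_τ (A.mem_V k)).tendsto.comp hzl)
  have h0 := hlim (𝓝[>] α) i α nhdsWithin_le_nhds (Ioo_mem_nhdsGT hαβ) hu hEi
  have h1 := hlim (𝓝[<] β) j β nhdsWithin_le_nhds (Ioo_mem_nhdsLT hαβ) hv hEj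
  have hmid : (α + β) / 2 ∈ Set.Ioo α β := ⟨by linarith, by linarith⟩
  set s₁ := (α + β) / 2
  have hconst : ∀ s ∈ Set.Ioo α β, r s * A.τ i (u + s * v) - r s * A.τ j (u + s * v) =
      r s₁ * A.τ i (u + s₁ * v) - r s₁ * A.τ j (u + s₁ * v) := by
    intro s hs
    have hd : ∀ s ∈ Set.Ioo α β, HasDerivAt
        (fun s => r s * A.τ i (u + s * v) - r s * A.τ j (u + s * v)) 0 s := fun s hs =>
      ((hd1 s hs).sub (hd2 s hs)).congr_deriv (sub_self _)
    exact isOpen_Ioo.is_const_of_deriv_eq_zero isPreconnected_Ioo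
      (fun s hs => (hd s hs).differentiableAt.differentiableWithinAt) (fun s hs => (hd s hs).deriv)
      hs hmid
  set D := r s₁ * A.τ i (u + s₁ * v) - r s₁ * A.τ j (u + s₁ * v)
  have hD : D ^ 2 = (A.e j - A.e i) ^ 2 := by
    have := A.glue i j _ (hseg s₁ hmid)
    rw [← hr2 s₁ hmid] at this
    rw [show A.e j - A.e i = -(A.e i - A.e j) by ring, neg_sq, ← this]
    ring
  have h1' : Tendsto (fun s => r s * A.τ i (u + s * v)) (𝓝[<] β) (𝓝 D) := by
    have := h1.add_const D
    rw [zero_add] at this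
    refine this.congr' ?_
    filter_upwards [Ioo_mem_nhdsLT hαβ] with s hs
    rw [← hconst s hs]
    ring
  have hFTC := intervalIntegral.integral_eq_sub_of_hasDerivAt_of_tendsto hαβ hd1
    (hint.div_const 2) h0 h1'
  rw [intervalIntegral.integral_div, sub_zero, div_eq_iff two_ne_zero] at hFTC
  rw [hFTC]
  rcases sq_eq_sq_iff_eq_or_eq_neg.1 hD with h | h
  · exact Or.inl (by rw [h]; ring)
  · exact Or.inr (by rw [h]; ring)

theorem continuousOn_sqrt_of_neg {S : Set ℝ} {x : ℝ → ℝ} (hx : ContinuousOn x S)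
    (h : ∀ s ∈ S, x s < 0) : ContinuousOn (fun s => (x s : ℂ) ^ (1 / 2 : ℂ)) S := by
  have : ContinuousOn (fun s => ((-x s : ℝ) : ℂ) ^ (1 / 2 : ℂ) *
      Complex.exp (Real.pi * Complex.I * (1 / 2))) S := by
    refine ContinuousOn.mul (ContinuousOn.cpow_const ?_ fun s hs => ?_) continuousOn_const
    · exact Complex.continuous_ofReal.comp_continuousOn hx.neg
    · exact Complex.ofReal_mem_slitPlane.2 (neg_pos.2 (h s hs))
  refine this.congr fun s hs => ?_
  rw [Complex.ofReal_cpow_of_nonpos (h s hs).le]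
  push_cast
  rfl

theorem continuousOn_sqrt_of_pos {S : Set ℝ} {x : ℝ → ℝ} (hx : ContinuousOn x S)
    (h : ∀ s ∈ S, 0 < x s) : ContinuousOn (fun s => (x s : ℂ) ^ (1 / 2 : ℂ)) S :=
  (Complex.continuous_ofReal.comp_continuousOn hx).cpow_const fun s hs =>
    Complex.ofReal_mem_slitPlane.2 (h s hs)

theorem mem_iff_of_eq_or_neg {L : AddSubgroup ℂ} {x y : ℂ} (h : x = y ∨ x = -y) :
    x ∈ L ↔ y ∈ L := by
  rcases h with rfl | rfl
  · rfl
  · exact neg_mem_iff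

theorem Atlas.lattice_eq {c ω₁ ω₂ : ℂ} (A : Atlas c) (h1 : ω₁ ∈ A.lattice) (h2 : ω₂ ∈ A.lattice)
    (k1 : 2 * (A.e 1 - A.e 0) ∈ AddSubgroup.closure {ω₁, ω₂})
    (k2 : 2 * (A.e 2 - A.e 0) ∈ AddSubgroup.closure {ω₁, ω₂}) :
    A.lattice = AddSubgroup.closure {ω₁, ω₂} := by
  refine le_antisymm ((AddSubgroup.closure_le _).2 ?_) ((AddSubgroup.closure_le _).2 ?_)
  · rintro _ ⟨i, rfl⟩
    fin_cases i
    · simp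
    · exact k1
    · exact k2
  · rintro x (rfl | rfl)
    exacts [h1, h2]

theorem Atlas.lattice_eq_of_split {c ω₁ ω₂ J : ℂ} (A : Atlas c)
    (h1 : ω₁ = 2 * (A.e 1 - A.e 0) ∨ ω₁ = -(2 * (A.e 1 - A.e 0)))
    (h2 : J = 2 * (A.e 1 - A.e 0) ∨ J = -(2 * (A.e 1 - A.e 0)))
    (h3 : ω₂ - J = 2 * (A.e 2 - A.e 0) ∨ ω₂ - J = -(2 * (A.e 2 - A.e 0))) :
    A.lattice = AddSubgroup.closure {ω₁, ω₂} := by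
  have m1 : ω₁ ∈ AddSubgroup.closure {ω₁, ω₂} := AddSubgroup.subset_closure (by simp)
  have m2 : ω₂ ∈ AddSubgroup.closure {ω₁, ω₂} := AddSubgroup.subset_closure (by simp)
  have l1 : J ∈ A.lattice := (mem_iff_of_eq_or_neg h2).2 (A.two_mul_sub_mem 1 0)
  have l2 : ω₂ - J ∈ A.lattice := (mem_iff_of_eq_or_neg h3).2 (A.two_mul_sub_mem 2 0)
  have k1 := (mem_iff_of_eq_or_neg h1).1 m1
  refine A.lattice_eq ((mem_iff_of_eq_or_neg h1).2 (A.two_mul_sub_mem 1 0)) ?_ k1 ?_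
  · have := A.lattice.add_mem l2 l1
    rwa [sub_add_cancel] at this
  · exact (mem_iff_of_eq_or_neg h3).1 (sub_mem m2 ((mem_iff_of_eq_or_neg h2).2 k1))

end PainleveVI

namespace PainleveVI

variable {c : ℂ}

theorem exists_atlas_of_disjoint (hc0 : c ≠ 0) (hc1 : c ≠ 1) {ν : ℂ} (hν : 0 < ν.re)
    (hcν : (c * ν).re < 0)
    (h1 : ContinuousOn (fun s : ℝ => ((s : ℂ) * (s - 1) * (s - c)) ^ (1 / 2 : ℂ)) (Set.Ioo 0 1))
    (h2 : ContinuousOn (fun s : ℝ => ((s : ℂ) * (1 - s) * (1 - c * s)) ^ (1 / 2 : ℂ))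
      (Set.Ioo 0 1)) :
    ∃ A : Atlas c, A.lattice = AddSubgroup.closure {period₁ c, period₂ c} := by
  obtain ⟨A, ha, hseg⟩ := exists_atlas (c := c) (m := 0) (p := 1) (q := c) (ν := ν) one_ne_zero hc0
    hc1.symm (fun z => by simp [E]) (by simpa using hν) (by simpa using hcν) 0 rfl
  have a0 : A.a 0 = 0 := by rw [ha]; rfl
  have a1 : A.a 1 = 1 := by rw [ha]; rfl
  have a2 : A.a 2 = c := by rw [ha]; rfl
  have i1 := (A.integral_segment (i := 0) (j := 1) (u := 0) (v := 1) (b := c) zero_lt_one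
    (by simp [a0]) (by simp [a1]) (by simp [a0, a1]) (by rwa [a0]) (by rwa [a1])
    (fun z => by simp [E, a0, a1]) (fun s hs => by simpa using (hseg s hs).1) h1
    (fun s _ => by simp [E])).2
  have i2 := (A.integral_segment (i := 0) (j := 2) (u := 0) (v := c) (b := 1) zero_lt_one
    (by simp [a0]) (by simp [a2]) (by simpa [a0, a2] using hc0.symm) (by simp [a0])
    (by rw [a2]; exact hc1.symm) (fun z => by simp [E, a0, a2]; ring)
    (fun s hs => by simpa using (hseg s hs).2) (continuousOn_const (c := c).mul h2)
    (fun s _ => by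
      simp only [Pi.mul_apply, mul_pow, one_div, Complex.cpow_ofNat_inv_pow, E]
      ring)).2
  have e1 : period₁ c = ∫ s in (0 : ℝ)..1, c * (c - 1) * 1 /
      ((s : ℂ) * (s - 1) * (s - c)) ^ (1 / 2 : ℂ) := by
    simp only [period₁, mul_one]
  have e2 : period₂ c = ∫ s in (0 : ℝ)..1, c * (c - 1) * c /
      (c * ((s : ℂ) * (1 - s) * (1 - c * s)) ^ (1 / 2 : ℂ)) := by
    simp only [period₂, div_mul_eq_mul_div]
  simp only [Pi.mul_apply] at i2
  rw [← e1] at i1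
  rw [← e2] at i2
  exact ⟨A, A.lattice_eq ((mem_iff_of_eq_or_neg i1).2 (A.two_mul_sub_mem 1 0))
    ((mem_iff_of_eq_or_neg i2).2 (A.two_mul_sub_mem 2 0))
    ((mem_iff_of_eq_or_neg i1).1 (AddSubgroup.subset_closure (by simp)))
    ((mem_iff_of_eq_or_neg i2).1 (AddSubgroup.subset_closure (by simp)))⟩

theorem neg_two_mul_sub {x y z : ℂ} (h : x = 2 * (y - z) ∨ x = -(2 * (y - z))) :
    x = 2 * (z - y) ∨ x = -(2 * (z - y)) := by
  rcases h with rfl | rfl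
  · exact Or.inr (by ring)
  · exact Or.inl (by ring)

theorem exists_atlas_of_lt_one {x : ℝ} (hx0 : 0 < x) (hx1 : x < 1) :
    ∃ A : Atlas x, A.lattice = AddSubgroup.closure {period₁ x, period₂ x} := by
  have hc0 : (x : ℂ) ≠ 0 := by exact_mod_cast hx0.ne'
  have hc1 : (x : ℂ) ≠ 1 := by exact_mod_cast hx1.ne
  have hx1' : (1 - x : ℂ) ≠ 0 := sub_ne_zero.2 hc1.symm
  obtain ⟨A, ha, hseg⟩ := exists_atlas (c := x) (m := x) (p := 0) (q := 1) (ν := -1) hc0.symm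
    hc1.symm zero_ne_one (fun z => by simp only [E]; ring) (by simpa using hx0)
    (by simpa using hx1) 1 rfl
  have a0 : A.a 0 = x := by rw [ha]; rfl
  have a1 : A.a 1 = 0 := by rw [ha]; rfl
  have a2 : A.a 2 = 1 := by rw [ha]; rfl
  have hs1 : ∀ s ∈ Set.Ioo (0 : ℝ) x, (s : ℂ) ∈ A.V 1 ∩ A.V 0 := by
    intro s hs
    have hmem : 1 - s / x ∈ Set.Ioo (0 : ℝ) 1 :=
      ⟨sub_pos.2 ((div_lt_one hx0).2 hs.2), sub_lt_self _ (div_pos hs.1 hx0)⟩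
    have := (hseg _ hmem).1
    rw [Set.inter_comm]
    convert! this using 1
    push_cast
    field_simp
    ring
  have hs2 : ∀ s ∈ Set.Ioo x 1, (s : ℂ) ∈ A.V 0 ∩ A.V 2 := by
    intro s hs
    have hd : 0 < 1 - x := sub_pos.2 hx1
    have hmem : (s - x) / (1 - x) ∈ Set.Ioo (0 : ℝ) 1 :=
      ⟨div_pos (sub_pos.2 hs.1) hd, (div_lt_one hd).2 (by linarith [hs.2])⟩
    have := (hseg _ hmem).2
    convert! this using 1
    push_cast
    field_simp
    ring
  have hreal : ∀ s : ℝ, (s : ℂ) * (s - 1) * (s - x) = ((s * (s - 1) * (s - x) : ℝ) : ℂ) := by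
    intro s
    push_cast
    rfl
  have hreal2 : ∀ s : ℝ, (s : ℂ) * (1 - s) * (1 - x * s) =
      ((s * (1 - s) * (1 - x * s) : ℝ) : ℂ) := by
    intro s
    push_cast
    rfl
  have i1 := A.integral_segment (i := 1) (j := 0) (u := 0) (v := 1) (b := 1) hx0
    (by simp [a1]) (by simp [a0]) (by simpa [a0, a1] using hc0.symm) (by simp [a1])
    (by rw [a0]; exact hc1.symm) (fun z => by simp only [E, a0, a1]; ring)
    (fun s hs => by simpa using hs1 s hs)
    (r := fun s => ((s : ℂ) * (s - 1) * (s - x)) ^ (1 / 2 : ℂ))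
    (by
      simp only [hreal]
      refine continuousOn_sqrt_of_pos (by fun_prop) fun s hs => ?_
      have h1 := mul_pos hs.1 (sub_pos.2 (hs.2.trans hx1))
      nlinarith [mul_pos h1 (sub_pos.2 hs.2)])
    (fun s _ => by simp [E])
  have i2 := A.integral_segment (i := 0) (j := 2) (u := 0) (v := 1) (b := 0) hx1
    (by simp [a0]) (by simp [a2]) (by rwa [a0, a2]) (by rw [a0]; exact hc0.symm)
    (by simp [a2]) (fun z => by simp only [E, a0, a2]; ring)
    (fun s hs => by simpa using hs2 s hs)
    (r := fun s => ((s : ℂ) * (s - 1) * (s - x)) ^ (1 / 2 : ℂ))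
    (by
      simp only [hreal]
      refine continuousOn_sqrt_of_neg (by fun_prop) fun s hs => ?_
      have h1 := mul_pos (hx0.trans hs.1) (sub_pos.2 hs.2)
      nlinarith [mul_pos h1 (sub_pos.2 hs.1)])
    (fun s _ => by simp [E])
  have i3 := (A.integral_segment (i := 1) (j := 0) (u := 0) (v := x) (b := 1) zero_lt_one
    (by simp [a1]) (by simp [a0]) (by simpa [a0, a1] using hc0.symm) (by simp [a1])
    (by rw [a0]; exact hc1.symm) (fun z => by simp only [E, a0, a1]; ring)
    (fun s hs => by
      have := hs1 (s * x) ⟨mul_pos hs.1 hx0, mul_lt_of_lt_one_left hx0 hs.2⟩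
      simpa using this)
    (r := fun s => (x : ℂ) * ((s : ℂ) * (1 - s) * (1 - x * s)) ^ (1 / 2 : ℂ))
    (by
      simp only [hreal2]
      refine continuousOn_const.mul (continuousOn_sqrt_of_pos (by fun_prop) fun s hs => ?_)
      have h1 := mul_pos hs.1 (sub_pos.2 hs.2)
      exact mul_pos h1 (sub_pos.2 (by nlinarith [hs.1, hs.2])))
    (fun s _ => by
      simp only [mul_pow, one_div, Complex.cpow_ofNat_inv_pow, E]
      ring)).2
  have e2 : period₂ x = ∫ s in (0 : ℝ)..1, (x : ℂ) * (x - 1) * x /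
      (x * ((s : ℂ) * (1 - s) * (1 - x * s)) ^ (1 / 2 : ℂ)) := by
    simp only [period₂, div_mul_eq_mul_div]
  rw [← e2] at i3
  simp only [mul_one] at i1 i2
  have e1 : period₁ x - (∫ s in (0 : ℝ)..x, (x : ℂ) * (x - 1) /
      ((s : ℂ) * (s - 1) * (s - x)) ^ (1 / 2 : ℂ)) = ∫ s in x..1, (x : ℂ) * (x - 1) /
      ((s : ℂ) * (s - 1) * (s - x)) ^ (1 / 2 : ℂ) := by
    rw [period₁, ← intervalIntegral.integral_add_adjacent_intervals i1.1 i2.1, add_sub_cancel_left]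
  refine ⟨A, ?_⟩
  rw [Set.pair_comm]
  exact A.lattice_eq_of_split (neg_two_mul_sub i3) (neg_two_mul_sub i1.2) (by rw [e1]; exact i2.2)

theorem exists_atlas_of_one_lt {x : ℝ} (hx1 : 1 < x) :
    ∃ A : Atlas x, A.lattice = AddSubgroup.closure {period₁ x, period₂ x} := by
  have hx0 : 0 < x := one_pos.trans hx1
  have hc0 : (x : ℂ) ≠ 0 := by exact_mod_cast hx0.ne'
  have hc1 : (x : ℂ) ≠ 1 := by exact_mod_cast hx1.ne'
  have hx1' : (x - 1 : ℂ) ≠ 0 := sub_ne_zero.2 hc1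
  obtain ⟨A, ha, hseg⟩ := exists_atlas (c := x) (m := 1) (p := 0) (q := x) (ν := -1) zero_ne_one
    hc1 hc0.symm (fun z => by simp only [E]; ring) (by simp)
    (by simpa using hx1) 1 rfl
  have a0 : A.a 0 = 1 := by rw [ha]; rfl
  have a1 : A.a 1 = 0 := by rw [ha]; rfl
  have a2 : A.a 2 = x := by rw [ha]; rfl
  have hs1 : ∀ s ∈ Set.Ioo (0 : ℝ) 1, (s : ℂ) ∈ A.V 1 ∩ A.V 0 := by
    intro s hs
    have hmem : 1 - s ∈ Set.Ioo (0 : ℝ) 1 := ⟨sub_pos.2 hs.2, sub_lt_self _ hs.1⟩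
    have := (hseg _ hmem).1
    rw [Set.inter_comm]
    convert! this using 1
    push_cast
    ring
  have hs2 : ∀ s ∈ Set.Ioo 1 x, (s : ℂ) ∈ A.V 0 ∩ A.V 2 := by
    intro s hs
    have hd : 0 < x - 1 := sub_pos.2 hx1
    have hmem : (s - 1) / (x - 1) ∈ Set.Ioo (0 : ℝ) 1 :=
      ⟨div_pos (sub_pos.2 hs.1) hd, (div_lt_one hd).2 (by linarith [hs.2])⟩
    have := (hseg _ hmem).2
    convert! this using 1
    push_cast
    field_simp
    ring
  have hreal : ∀ s : ℝ, (s : ℂ) * (s - 1) * (s - x) = ((s * (s - 1) * (s - x) : ℝ) : ℂ) := by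
    intro s
    push_cast
    rfl
  have hreal2 : ∀ s : ℝ, (s : ℂ) * (1 - s) * (1 - x * s) =
      ((s * (1 - s) * (1 - x * s) : ℝ) : ℂ) := by
    intro s
    push_cast
    rfl
  have i1 := (A.integral_segment (i := 1) (j := 0) (u := 0) (v := 1) (b := x) zero_lt_one
    (by simp [a1]) (by simp [a0]) (by simp [a0, a1]) (by rwa [a1])
    (by rwa [a0]) (fun z => by simp only [E, a0, a1]; ring)
    (fun s hs => by simpa using hs1 s hs)
    (r := fun s => ((s : ℂ) * (s - 1) * (s - x)) ^ (1 / 2 : ℂ))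
    (by
      simp only [hreal]
      refine continuousOn_sqrt_of_pos (by fun_prop) fun s hs => ?_
      have h1 := mul_pos hs.1 (sub_pos.2 hs.2)
      nlinarith [mul_pos h1 (sub_pos.2 (hs.2.trans hx1))])
    (fun s _ => by simp [E])).2
  have hinv : x⁻¹ < 1 := inv_lt_one_of_one_lt₀ hx1
  have hinv0 : 0 < x⁻¹ := inv_pos.2 hx0
  have hr : ∀ s : ℝ, ((x : ℂ) * ((s : ℂ) * (1 - s) * (1 - x * s)) ^ (1 / 2 : ℂ)) ^ 2 =
      E x (0 + s * x) := fun s => by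
    simp only [mul_pow, one_div, Complex.cpow_ofNat_inv_pow, E]
    ring
  have i2 := A.integral_segment (i := 1) (j := 0) (u := 0) (v := x) (b := x) hinv0
    (by simp [a1]) (by simp [a0, hc0]) (by simp [a0, a1]) (by rwa [a1])
    (by rwa [a0]) (fun z => by simp only [E, a0, a1]; ring)
    (fun s hs => by
      have := hs1 (s * x) ⟨mul_pos hs.1 hx0, by
        rw [← lt_div_iff₀ hx0, one_div]
        exact hs.2⟩
      simpa using this)
    (r := fun s => (x : ℂ) * ((s : ℂ) * (1 - s) * (1 - x * s)) ^ (1 / 2 : ℂ))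
    (by
      simp only [hreal2]
      refine continuousOn_const.mul (continuousOn_sqrt_of_pos (by fun_prop) fun s hs => ?_)
      have h1 := mul_pos hs.1 (sub_pos.2 (hs.2.trans hinv))
      have h2 : s * x < 1 := by
        rw [← lt_div_iff₀ hx0, one_div]
        exact hs.2
      exact mul_pos h1 (sub_pos.2 (by linarith)))
    (fun s _ => hr s)
  have i3 := A.integral_segment (i := 0) (j := 2) (u := 0) (v := x) (b := 0) hinv
    (by simp [a0, hc0]) (by simp [a2]) (by rw [a0, a2]; exact hc1.symm) (by simp [a0])
    (by rw [a2]; exact hc0.symm) (fun z => by simp only [E, a0, a2]; ring)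
    (fun s hs => by
      have := hs2 (s * x) ⟨by
        rw [← div_lt_iff₀ hx0, one_div]
        exact hs.1, mul_lt_of_lt_one_left hx0 hs.2⟩
      simpa using this)
    (r := fun s => (x : ℂ) * ((s : ℂ) * (1 - s) * (1 - x * s)) ^ (1 / 2 : ℂ))
    (by
      simp only [hreal2]
      refine continuousOn_const.mul (continuousOn_sqrt_of_neg (by fun_prop) fun s hs => ?_)
      have h1 := mul_pos (hinv0.trans hs.1) (sub_pos.2 hs.2)
      have h2 : 1 < s * x := by
        rw [← div_lt_iff₀ hx0, one_div]
        exact hs.1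
      exact mul_neg_of_pos_of_neg h1 (by linarith))
    (fun s _ => hr s)
  have e1 : period₁ x = ∫ s in (0 : ℝ)..1, (x : ℂ) * (x - 1) * 1 /
      ((s : ℂ) * (s - 1) * (s - x)) ^ (1 / 2 : ℂ) := by
    simp only [period₁, mul_one]
  rw [← e1] at i1
  have e2 : period₂ x - (∫ s in (0 : ℝ)..x⁻¹, (x : ℂ) * (x - 1) * x /
      (x * ((s : ℂ) * (1 - s) * (1 - x * s)) ^ (1 / 2 : ℂ))) =
      ∫ s in x⁻¹..1, (x : ℂ) * (x - 1) * x /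
        (x * ((s : ℂ) * (1 - s) * (1 - x * s)) ^ (1 / 2 : ℂ)) := by
    simp only [period₂, div_mul_eq_mul_div]
    rw [← intervalIntegral.integral_add_adjacent_intervals i2.1 i3.1, add_sub_cancel_left]
  exact ⟨A, A.lattice_eq_of_split (neg_two_mul_sub i1) (neg_two_mul_sub i2.2)
    (by rw [e2]; exact i3.2)⟩

/-- The two integrals generate the lattice of a suitable atlas. -/
theorem exists_atlas_lattice_eq (hc0 : c ≠ 0) (hc1 : c ≠ 1) :
    ∃ A : Atlas c, A.lattice = AddSubgroup.closure {period₁ c, period₂ c} := by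
  by_cases him : c.im = 0
  · obtain ⟨x, rfl⟩ : ∃ x : ℝ, c = x := ⟨c.re, Complex.ext rfl (by simpa using him)⟩
    rcases lt_or_gt_of_ne (show x ≠ 0 by exact_mod_cast hc0) with hx | hx
    · refine exists_atlas_of_disjoint hc0 hc1 (ν := 1) (by simp) (by simpa using hx) ?_ ?_
      · have h : ∀ s : ℝ, (s : ℂ) * (s - 1) * (s - x) = ((s * (s - 1) * (s - x) : ℝ) : ℂ) := by
          intro s
          push_cast
          rfl
        simp only [h]
        refine continuousOn_sqrt_of_neg (by fun_prop) fun s hs => ?_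
        have h1 := mul_pos hs.1 (sub_pos.2 hs.2)
        nlinarith [mul_pos h1 (sub_pos.2 (hx.trans hs.1))]
      · have h : ∀ s : ℝ, (s : ℂ) * (1 - s) * (1 - x * s) =
            ((s * (1 - s) * (1 - x * s) : ℝ) : ℂ) := by
          intro s
          push_cast
          rfl
        simp only [h]
        refine continuousOn_sqrt_of_pos (by fun_prop) fun s hs => ?_
        have h1 := mul_pos hs.1 (sub_pos.2 hs.2)
        exact mul_pos h1 (by nlinarith [hs.1])
    · rcases lt_or_gt_of_ne (show x ≠ 1 by exact_mod_cast hc1) with hx' | hx'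
      · exact exists_atlas_of_lt_one hx hx'
      · exact exists_atlas_of_one_lt hx'
  · refine exists_atlas_of_disjoint hc0 hc1 (ν := ⟨1, (c.re + 1) / c.im⟩) one_pos ?_ ?_ ?_
    · rw [Complex.mul_re]
      field_simp
      linarith
    · refine ContinuousOn.cpow_const (by fun_prop) fun s hs => Or.inr ?_
      have e : (s : ℂ) * (s - 1) * (s - c) = ((s * (s - 1) : ℝ) : ℂ) * (s - c) := by
        push_cast
        rfl
      rw [e, Complex.im_ofReal_mul]
      refine mul_ne_zero (mul_ne_zero hs.1.ne' (sub_ne_zero.2 hs.2.ne)) ?_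
      simpa using him
    · refine ContinuousOn.cpow_const (by fun_prop) fun s hs => Or.inr ?_
      have e : (s : ℂ) * (1 - s) * (1 - c * s) = ((s * (1 - s) : ℝ) : ℂ) * (1 - c * s) := by
        push_cast
        rfl
      rw [e, Complex.im_ofReal_mul]
      refine mul_ne_zero (mul_ne_zero hs.1.ne' (sub_ne_zero.2 hs.2.ne')) ?_
      simpa [hs.1.ne'] using him

end PainleveVI

namespace PainleveVI

variable {c P : ℂ} {X Y : ℂ → Matrix (Fin 2) (Fin 2) ℂ}

/-! ## The variational equation -/

theorem deriv_F (k0 k1 kt t l : ℂ) : deriv (F k0 k1 kt t) l =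
    k0 * ((l - t) + (l - 1)) + k1 * ((l - t) + l) + (kt + 1) * ((l - 1) + l) := by
  have h0 := hasDerivAt_id l
  have h1 := ((((h0.sub_const 1).mul (h0.sub_const t)).const_mul k0).add
    ((h0.mul (h0.sub_const t)).const_mul k1)).add ((h0.mul (h0.sub_const 1)).const_mul (kt + 1))
  have h2 : HasDerivAt (F k0 k1 kt t) _ l := h1.congr_of_eventuallyEq
    (Eventually.of_forall fun x => by simp only [F, Pi.add_apply, Pi.mul_apply, id]; ring)
  rw [h2.deriv]
  simp only [id]
  ring

theorem variationalMatrix_eq (k0 k1 kt kinf : ℂ) {l : ℂ} (hl : l ∈ puncturedLine c) :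
    variationalMatrix k0 k1 kt kinf c l = !![0, c * (c - 1) / (2 * E c l);
      0, ((l - 1) * (l - c) + l * (l - c) + l * (l - 1)) / (2 * E c l)] := by
  have hE : E c l ≠ 0 := E_ne_zero_iff.2 hl
  let N : Fin 2 → (Fin 2 → ℂ) → ℂ := ![fun v => v 0 * (v 0 - 1),
    fun v => ((l - 1) * (l - v 0) + l * (l - v 0) + l * (l - 1)) +
      (k0 * ((l - v 0) + (l - 1)) + k1 * ((l - v 0) + l) + (kt + 1) * ((l - 1) + l)) * v 1 +
      G k0 k1 kt kinf * v 1 ^ 2]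
  let D : (Fin 2 → ℂ) → ℂ := fun v => 2 * E (v 0) l + F k0 k1 kt (v 0) l * v 1
  have hD0 : D ![c, 0] = 2 * E c l := by simp [D]
  have hD : DifferentiableAt ℂ D ![c, 0] := by
    simp only [D, E, F]
    fun_prop
  have hN : ∀ i, DifferentiableAt ℂ (N i) ![c, 0] := by
    intro i
    fin_cases i
    · change DifferentiableAt ℂ (fun v : Fin 2 → ℂ => v 0 * (v 0 - 1)) _
      fun_prop
    · change DifferentiableAt ℂ (fun v : Fin 2 → ℂ =>
        ((l - 1) * (l - v 0) + l * (l - v 0) + l * (l - 1)) +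
        (k0 * ((l - v 0) + (l - 1)) + k1 * ((l - v 0) + l) + (kt + 1) * ((l - 1) + l)) * v 1 +
        G k0 k1 kt kinf * v 1 ^ 2) _
      fun_prop
  have hf : foliationField k0 k1 kt kinf l = fun v i => v 1 * (N i v / D v) := by
    funext v i
    fin_cases i
    · simp only [foliationField, N, D]
      simp
      ring
    · simp only [foliationField, N, D, (hasDerivAt_E (v 0) l).deriv, deriv_F]
      simp
      ring
  have hderiv : HasFDerivAt (foliationField k0 k1 kt kinf l) (ContinuousLinearMap.pi fun i =>
      (N i ![c, 0] / (2 * E c l)) • ContinuousLinearMap.proj (R := ℂ) (φ := fun _ : Fin 2 => ℂ) 1)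
      ![c, 0] := by
    rw [hf]
    refine hasFDerivAt_pi.2 fun i => ?_
    have h1 : HasFDerivAt (fun v : Fin 2 → ℂ => v 1)
        (ContinuousLinearMap.proj (R := ℂ) (φ := fun _ : Fin 2 => ℂ) 1) ![c, 0] :=
      (ContinuousLinearMap.proj (R := ℂ) (φ := fun _ : Fin 2 => ℂ) 1).hasFDerivAt
    have h2 : DifferentiableAt ℂ (fun v => N i v / D v) ![c, 0] := by
      have hD' : D ![c, 0] ≠ 0 := by
        rw [hD0]
        exact mul_ne_zero two_ne_zero hE
      simp only [div_eq_mul_inv]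
      exact (hN i).fun_mul (hD.inv hD')
    have h3 := h1.mul h2.hasFDerivAt
    refine h3.congr_fderiv ?_
    generalize fderiv ℂ (fun v => N i v / D v) ![c, 0] = L
    ext v
    simp [hD0]
  rw [variationalMatrix, hderiv.fderiv]
  ext i j
  rw [LinearMap.toMatrix'_apply]
  fin_cases i <;> fin_cases j <;> simp [N]

theorem IsPicardGerm.isFundamentalMatrix (k0 k1 kt kinf : ℂ) (hP : P ∈ puncturedLine c)
    (h : IsPicardGerm c P X) : IsFundamentalMatrix (variationalMatrix k0 k1 kt kinf c) P X := by
  refine ⟨?_, ?_⟩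
  · filter_upwards [h.eventually, (isOpen_puncturedLine c).mem_nhds hP] with z hz hU i j
    have hv := hz.self_of_nhds
    have hy := hz.ne_zero hU
    have h10 := hasDerivAt_of_sq (hz.analyticAt 1 0).continuousAt hy (hasDerivAt_E c z)
      (hz.mono fun w hw => hw.2.2.1)
    rw [variationalMatrix_eq k0 k1 kt kinf hU, Matrix.mul_apply, Fin.sum_univ_two]
    rw [← hv.2.2.1]
    fin_cases i <;> fin_cases j
    · refine hv.2.2.2.1.congr_deriv ?_
      simp
      field_simp
    · refine ((hasDerivAt_const z (1 : ℂ)).congr_of_eventuallyEq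
        (hz.mono fun w hw => hw.1)).congr_deriv ?_
      simp [hv.2.1]
    · refine h10.congr_deriv ?_
      simp
      field_simp
    · refine ((hasDerivAt_const z (0 : ℂ)).congr_of_eventuallyEq
        (hz.mono fun w hw => hw.2.1)).congr_deriv ?_
      simp [hv.2.1]
  · have hv := h.self_of_nhds
    rw [Matrix.det_fin_two, hv.1, hv.2.1]
    simpa using h.ne_zero hP

/-- Any fundamental matrix is obtained from a given one by a constant matrix. -/
theorem IsPicardGerm.exists_eq_mul {k0 k1 kt kinf : ℂ} (hP : P ∈ puncturedLine c)
    (h : IsPicardGerm c P X) (hY : IsFundamentalMatrix (variationalMatrix k0 k1 kt kinf c) P Y) :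
    ∃ C : GL (Fin 2) ℂ, Y =ᶠ[𝓝 P] fun z => X z * (C : Matrix (Fin 2) (Fin 2) ℂ) := by
  have hY' : ∀ᶠ z in 𝓝 P, ∀ j, HasDerivAt (fun w => Y w 0 j)
      (c * (c - 1) / (2 * E c z) * Y z 1 j) z ∧ HasDerivAt (fun w => Y w 1 j)
      (((z - 1) * (z - c) + z * (z - c) + z * (z - 1)) / (2 * E c z) * Y z 1 j) z := by
    filter_upwards [hY.1, (isOpen_puncturedLine c).mem_nhds hP] with z hz hU j
    have h0 := hz 0 j
    have h1 := hz 1 j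
    rw [variationalMatrix_eq k0 k1 kt kinf hU, Matrix.mul_apply, Fin.sum_univ_two] at h0 h1
    simp at h0 h1
    exact ⟨h0, h1⟩
  have c1 : ∀ j, ∀ᶠ z in 𝓝 P, Y z 1 j / X z 1 0 = Y P 1 j / X P 1 0 := by
    intro j
    refine eventually_const_of_hasDerivAt_zero ?_
    filter_upwards [h.eventually, hY', (isOpen_puncturedLine c).mem_nhds hP] with z hz hYz hU
    have hy := hz.ne_zero hU
    have h10 := hasDerivAt_of_sq (hz.analyticAt 1 0).continuousAt hy (hasDerivAt_E c z)
      (hz.mono fun w hw => hw.2.2.1)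
    refine ((hYz j).2.div h10 hy).congr_deriv ?_
    rw [← hz.self_of_nhds.2.2.1]
    field_simp
    ring
  have c0 : ∀ j, ∀ᶠ z in 𝓝 P, Y z 0 j - X z 0 0 * (Y P 1 j / X P 1 0) =
      Y P 0 j - X P 0 0 * (Y P 1 j / X P 1 0) := by
    intro j
    refine eventually_const_of_hasDerivAt_zero ?_
    filter_upwards [h.eventually, hY', c1 j, (isOpen_puncturedLine c).mem_nhds hP]
      with z hz hYz hcz hU
    have hy := hz.ne_zero hU
    refine ((hYz j).1.sub (hz.self_of_nhds.2.2.2.1.mul_const _)).congr_deriv ?_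
    rw [← hcz, ← hz.self_of_nhds.2.2.1]
    field_simp
    ring
  let M : Matrix (Fin 2) (Fin 2) ℂ := !![Y P 1 0 / X P 1 0, Y P 1 1 / X P 1 0;
    Y P 0 0 - X P 0 0 * (Y P 1 0 / X P 1 0), Y P 0 1 - X P 0 0 * (Y P 1 1 / X P 1 0)]
  have hM : Y =ᶠ[𝓝 P] fun z => X z * M := by
    filter_upwards [h.eventually, c0 0, c0 1, c1 0, c1 1, (isOpen_puncturedLine c).mem_nhds hP]
      with z hz a0 a1 b0 b1 hU
    have hy := hz.ne_zero hU
    have hv := hz.self_of_nhds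
    rw [div_eq_iff hy] at b0 b1
    rw [Atlas.mul_germ_apply ⟨hv.1, hv.2.1⟩]
    ext i j
    fin_cases i <;> fin_cases j
    · simp only [M]
      simp
      linear_combination a0
    · simp only [M]
      simp
      linear_combination a1
    · simp only [M]
      simp
      linear_combination b0
    · simp only [M]
      simp
      linear_combination b1
  have hdet : M.det ≠ 0 := by
    intro h0
    refine hY.2 ?_
    have : Y P = X P * M := hM.self_of_nhds
    rw [this, Matrix.det_mul, h0, mul_zero]
  exact ⟨Matrix.GeneralLinearGroup.mkOfDetNeZero M hdet, hM⟩

theorem ContinuesTo.congr {Q : ℂ} {γ : Path P Q} {X X' Z Z' : ℂ → Matrix (Fin 2) (Fin 2) ℂ}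
    (h : ContinuesTo γ X Z) (hX : X =ᶠ[𝓝 P] X') (hZ : Z =ᶠ[𝓝 Q] Z') : ContinuesTo γ X' Z' := by
  obtain ⟨Φ, hc, h0, h1⟩ := h
  exact ⟨Φ, hc, h0.trans hX, h1.trans hZ⟩

theorem mem_monodromyGroup_mul_iff {U : Set ℂ} (hP : P ∈ U)
    (hX : ∀ i j, AnalyticAt ℂ (fun z => X z i j) P) (hY : ∀ i j, AnalyticAt ℂ (fun z => Y z i j) P)
    (C : GL (Fin 2) ℂ) (h : Y =ᶠ[𝓝 P] fun z => X z * (C : Matrix (Fin 2) (Fin 2) ℂ))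
    (T : GL (Fin 2) ℂ) :
    T ∈ monodromyGroup U P hP Y hY ↔ C * T * C⁻¹ ∈ monodromyGroup U P hP X hX := by
  constructor
  · rintro ⟨γ, hγ, hT⟩
    refine ⟨γ, hγ, (hT.mul_right ((C⁻¹ : GL (Fin 2) ℂ) : Matrix (Fin 2) (Fin 2) ℂ)).congr ?_ ?_⟩
    · filter_upwards [h] with z hz
      rw [hz, Matrix.mul_assoc, Units.mul_inv, Matrix.mul_one]
    · filter_upwards [h] with z hz
      rw [hz]
      simp only [Units.val_mul, Matrix.mul_assoc]
  · rintro ⟨γ, hγ, hT⟩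
    refine ⟨γ, hγ, (hT.mul_right (C : Matrix (Fin 2) (Fin 2) ℂ)).congr h.symm ?_⟩
    filter_upwards [h] with z hz
    rw [hz]
    simp only [Units.val_mul, Matrix.mul_assoc, Units.inv_mul, Matrix.mul_one]

/-! ## The group -/

/-- The sign character of `ℤ/2`. -/
noncomputable def signChar (a : Multiplicative (ZMod 2)) : ℂ := if a = 1 then 1 else -1

theorem signChar_one : signChar 1 = 1 := if_pos rfl

theorem signChar_eq (a : Multiplicative (ZMod 2)) : signChar a = 1 ∨ signChar a = -1 := by
  unfold signChar
  split_ifs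
  exacts [Or.inl rfl, Or.inr rfl]

theorem signChar_sq (a : Multiplicative (ZMod 2)) : signChar a * signChar a = 1 := by
  rcases signChar_eq a with h | h <;> rw [h] <;> norm_num

theorem signChar_mul (a b : Multiplicative (ZMod 2)) :
    signChar (a * b) = signChar a * signChar b := by
  have key : ∀ a b : Multiplicative (ZMod 2),
      (a = 1 ∧ a * b = b) ∨ (b = 1 ∧ a * b = a) ∨ (a ≠ 1 ∧ b ≠ 1 ∧ a * b = 1) := by
    decide
  rcases key a b with ⟨ha, hab⟩ | ⟨hb, hab⟩ | ⟨ha, hb, hab⟩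
  · rw [hab, ha, signChar_one, one_mul]
  · rw [hab, hb, signChar_one, mul_one]
  · rw [hab, signChar_one, signChar, signChar, if_neg ha, if_neg hb]
    norm_num

theorem signChar_injective : Function.Injective signChar := by
  have key : ∀ a b : Multiplicative (ZMod 2), (a = 1 ↔ b = 1) → a = b := by decide
  intro a b h
  refine key a b ?_
  unfold signChar at h
  split_ifs at h with h1 h2 h2
  · simp [h1, h2]
  · norm_num at h
  · norm_num at h
  · simp [h1, h2]

/-- The linear combination of `x` and `y` with given integer coefficients. -/
def intComb (x y : ℂ) (n : Multiplicative (ℤ × ℤ)) : ℂ :=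
  (Multiplicative.toAdd n).1 * x + (Multiplicative.toAdd n).2 * y

theorem intComb_mul (x y : ℂ) (m n : Multiplicative (ℤ × ℤ)) :
    intComb x y (m * n) = intComb x y m + intComb x y n := by
  simp only [intComb, toAdd_mul, Prod.fst_add, Prod.snd_add]
  push_cast
  ring

theorem intComb_signAction (x y : ℂ) (a : Multiplicative (ZMod 2)) (n : Multiplicative (ℤ × ℤ)) :
    intComb x y (signAction a n) = signChar a * intComb x y n := by
  by_cases h : a = 1
  · simp [h, signChar_one]
  · have : signAction a n = n⁻¹ := by
      simp [signAction, h]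
    rw [this, signChar, if_neg h]
    simp only [intComb, toAdd_inv, Prod.fst_neg, Prod.snd_neg]
    push_cast
    ring

theorem intComb_injective {x y : ℂ} (h : LinearIndependent ℝ ![x, y]) :
    Function.Injective (intComb x y) := by
  intro m n hmn
  have h' := LinearIndependent.pair_iff.1 h
    (((Multiplicative.toAdd m).1 - (Multiplicative.toAdd n).1 : ℤ) : ℝ)
    (((Multiplicative.toAdd m).2 - (Multiplicative.toAdd n).2 : ℤ) : ℝ) (by
      simp only [intComb] at hmn
      simp only [Complex.real_smul]
      push_cast
      linear_combination hmn)
  refine Multiplicative.toAdd.injective (Prod.ext ?_ ?_)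
  · exact sub_eq_zero.1 (by exact_mod_cast h'.1)
  · exact sub_eq_zero.1 (by exact_mod_cast h'.2)

/-- The affine representation of `ℤ² ⋊ ℤ/2` with translations by `x` and `y`. -/
noncomputable def affineRep (x y : ℂ) :
    Multiplicative (ℤ × ℤ) ⋊[signAction] Multiplicative (ZMod 2) →* GL (Fin 2) ℂ where
  toFun g := Matrix.GeneralLinearGroup.mkOfDetNeZero
    !![signChar g.right, 0; signChar g.right * intComb x y g.left, 1] (by
      rw [Matrix.det_fin_two_of, mul_one, zero_mul, sub_zero]
      exact left_ne_zero_of_mul_eq_one (signChar_sq _))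
  map_one' := by
    refine Units.ext ?_
    change !![signChar 1, 0; signChar 1 * intComb x y 1, 1] = (1 : Matrix (Fin 2) (Fin 2) ℂ)
    rw [signChar_one, Matrix.one_fin_two]
    simp [intComb]
  map_mul' g h := by
    refine Units.ext ?_
    change !![signChar (g.right * h.right), 0;
      signChar (g.right * h.right) * intComb x y (g.left * signAction g.right h.left), 1] =
      !![signChar g.right, 0; signChar g.right * intComb x y g.left, 1] *
        !![signChar h.right, 0; signChar h.right * intComb x y h.left, 1]
    rw [Matrix.mul_fin_two, signChar_mul, intComb_mul, intComb_signAction]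
    congr 3
    · ring
    · simp
    · funext i
      fin_cases i
      · simp
        linear_combination signChar h.right * intComb x y h.left * signChar_sq g.right
      · simp

theorem coe_affineRep (x y : ℂ)
    (g : Multiplicative (ℤ × ℤ) ⋊[signAction] Multiplicative (ZMod 2)) :
    ((affineRep x y g : GL (Fin 2) ℂ) : Matrix (Fin 2) (Fin 2) ℂ) =
      !![signChar g.right, 0; signChar g.right * intComb x y g.left, 1] := rfl

theorem affineRep_injective {x y : ℂ} (h : LinearIndependent ℝ ![x, y]) :
    Function.Injective (affineRep x y) := by
  intro g g' hg
  have e := congrArg (fun T : GL (Fin 2) ℂ => (T : Matrix (Fin 2) (Fin 2) ℂ)) hg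
  simp only [coe_affineRep] at e
  have e00 : signChar g.right = signChar g'.right := congrFun (congrFun e 0) 0
  have e10 : signChar g.right * intComb x y g.left = signChar g'.right * intComb x y g'.left :=
    congrFun (congrFun e 1) 0
  rw [← e00] at e10
  refine SemidirectProduct.ext (intComb_injective h ?_) (signChar_injective e00)
  exact mul_left_cancel₀ (left_ne_zero_of_mul_eq_one (signChar_sq _)) e10

theorem mem_range_affineRep (T : GL (Fin 2) ℂ) :
    T ∈ (affineRep (period₁ c) (period₂ c)).range ↔ T ∈ periodMatrices c := by
  constructor
  · rintro ⟨g, rfl⟩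
    rcases signChar_eq g.right with h | h
    · refine ⟨1, (Multiplicative.toAdd g.left).1, (Multiplicative.toAdd g.left).2, ?_⟩
      rw [coe_affineRep, h]
      simp [intComb]
    · refine ⟨-1, -(Multiplicative.toAdd g.left).1, -(Multiplicative.toAdd g.left).2, ?_⟩
      rw [coe_affineRep, h]
      simp [intComb]
      ring
  · rintro ⟨ε, p, q, h⟩
    rcases Int.units_eq_one_or ε with rfl | rfl
    · refine ⟨⟨Multiplicative.ofAdd (p, q), 1⟩, Units.ext ?_⟩
      rw [coe_affineRep, h]
      simp [intComb, signChar_one]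
    · have hs : signChar (Multiplicative.ofAdd 1) = -1 := if_neg (by decide)
      refine ⟨⟨Multiplicative.ofAdd (-p, -q), Multiplicative.ofAdd 1⟩, Units.ext ?_⟩
      rw [coe_affineRep, h, hs]
      simp [intComb]
      ring

theorem linearIndependent_of_re {x y : ℂ}
    (h : ∀ α : ℂ, (α * x).re = 0 → (α * y).re = 0 → α = 0) : LinearIndependent ℝ ![x, y] := by
  have key : ∀ x y : ℂ, (∀ α : ℂ, (α * x).re = 0 → (α * y).re = 0 → α = 0) → ∀ s t : ℝ,
      s • x + t • y = 0 → s = 0 := by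
    intro x y h s t hst
    by_contra hs
    have hs' : (s : ℂ) ≠ 0 := Complex.ofReal_ne_zero.2 hs
    have hx : x = ((-t / s : ℝ) : ℂ) * y := by
      simp only [Complex.real_smul] at hst
      push_cast
      field_simp
      linear_combination hst
    have h0 : ∀ α : ℂ, (α * y).re = 0 → α = 0 := fun α hα => by
      refine h α ?_ hα
      rw [hx, mul_left_comm, Complex.re_ofReal_mul, hα, mul_zero]
    have hy : y ≠ 0 := by
      rintro rfl
      exact one_ne_zero (h0 1 (by simp))
    have := h0 (Complex.I * (starRingEnd ℂ) y) (by
      rw [mul_assoc, mul_comm ((starRingEnd ℂ) y), Complex.mul_conj, Complex.I_mul_re,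
        Complex.ofReal_im, neg_zero])
    simp [hy] at this
  refine LinearIndependent.pair_iff.2 fun s t hst => ⟨key x y h s t hst, ?_⟩
  exact key y x (fun α h1 h2 => h α h2 h1) t s (by rwa [add_comm])

theorem linearIndependent_periods (A : Atlas c) (hK : c * (c - 1) ≠ 0)
    (hA : A.lattice = AddSubgroup.closure {period₁ c, period₂ c}) :
    LinearIndependent ℝ ![period₁ c, period₂ c] := by
  refine linearIndependent_of_re fun α h1 h2 => A.eq_zero_of_re_eq_zero hK fun i j => ?_
  have hle : A.lattice ≤ (Complex.reAddGroupHom.comp (AddMonoidHom.mulLeft α)).ker := by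
    rw [hA, AddSubgroup.closure_le]
    rintro x (rfl | rfl)
    exacts [h1, h2]
  have h : (α * (2 * (A.e i - A.e j))).re = 0 := hle (A.two_mul_sub_mem i j)
  rw [two_mul, mul_add, Complex.add_re] at h
  linarith

end PainleveVI

open PainleveVI in
theorem proposition1 (k0 k1 kt kinf c : ℂ) (hc0 : c ≠ 0) (hc1 : c ≠ 1) :
    -- the two integrals are fundamental periods of the elliptic curve
    {ω : ℂ | IsPeriod c ω} = {ω | ∃ p q : ℤ, ω = p * period₁ c + q * period₂ c} ∧
    LinearIndependent ℝ ![period₁ c, period₂ c] ∧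
    ∀ (P : ℂ) (hP : P ∈ puncturedLine c),
      -- the explicit matrix is a fundamental matrix, with the stated monodromy group
      (∃ X, IsPicardMatrix c P X) ∧
      (∀ X, IsPicardMatrix c P X →
        ∃ hX : IsFundamentalMatrix (variationalMatrix k0 k1 kt kinf c) P X,
          (monodromyGroup (puncturedLine c) P hP X hX.analyticAt : Set (GL (Fin 2) ℂ)) =
            periodMatrices c) ∧
      -- the monodromy group of any fundamental matrix is conjugate to that one, and isomorphic
      -- to the semidirect product
      ∀ (Y : ℂ → Matrix (Fin 2) (Fin 2) ℂ)
        (hY : IsFundamentalMatrix (variationalMatrix k0 k1 kt kinf c) P Y),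
        (∃ g : GL (Fin 2) ℂ, ∀ T : GL (Fin 2) ℂ,
          T ∈ monodromyGroup (puncturedLine c) P hP Y hY.analyticAt ↔
            g * T * g⁻¹ ∈ periodMatrices c) ∧
        Nonempty (monodromyGroup (puncturedLine c) P hP Y hY.analyticAt ≃*
          Multiplicative (ℤ × ℤ) ⋊[signAction] Multiplicative (ZMod 2)) := by
  obtain ⟨A, hA⟩ := exists_atlas_lattice_eq hc0 hc1
  have hK : c * (c - 1) ≠ 0 := mul_ne_zero hc0 (sub_ne_zero.2 hc1)
  have hlin := linearIndependent_periods A hK hA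
  have hmem : ∀ ω, ω ∈ A.lattice ↔ ∃ p q : ℤ, ω = p * period₁ c + q * period₂ c := by
    intro ω
    rw [hA, AddSubgroup.mem_closure_pair]
    simp only [zsmul_eq_mul, eq_comm]
  have hmon : ∀ {P : ℂ} (hP : P ∈ puncturedLine c) {X : ℂ → Matrix (Fin 2) (Fin 2) ℂ}
      (_ : A.IsGerm P X) (hX : ∀ i j, AnalyticAt ℂ (fun z => X z i j) P) (T : GL (Fin 2) ℂ),
      T ∈ monodromyGroup (puncturedLine c) P hP X hX ↔ T ∈ periodMatrices c := by
    intro P hP X h hX T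
    rw [A.mem_monodromyGroup_iff h hP hX]
    constructor
    · rintro ⟨ε, b, hb, hT⟩
      obtain ⟨p, q, rfl⟩ := (hmem b).1 hb
      exact ⟨ε, p, q, hT⟩
    · rintro ⟨ε, p, q, hT⟩
      exact ⟨ε, _, (hmem _).2 ⟨p, q, rfl⟩, hT⟩
  refine ⟨?_, hlin, fun P hP => ⟨A.exists_isPicardMatrix hP, fun X hX => ?_, fun Y hY => ?_⟩⟩
  · ext ω
    exact (A.isPeriod_iff ω).trans (hmem ω)
  · have hg := Atlas.IsGerm.of_isPicardMatrix A hP hX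
    exact ⟨hg.1.isFundamentalMatrix k0 k1 kt kinf hP, Set.ext fun T => hmon hP hg _ T⟩
  · obtain ⟨X, hX⟩ := A.exists_isGerm hP
    obtain ⟨C, hC⟩ := hX.1.exists_eq_mul hP hY
    have hconj : ∀ T : GL (Fin 2) ℂ,
        T ∈ monodromyGroup (puncturedLine c) P hP Y hY.analyticAt ↔
          C * T * C⁻¹ ∈ periodMatrices c := fun T =>
      (mem_monodromyGroup_mul_iff hP hX.1.analyticAt hY.analyticAt C hC T).trans
        (hmon hP hX hX.1.analyticAt _)
    refine ⟨⟨C, hconj⟩, ?_⟩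
    let ρ := (MulAut.conj C⁻¹).toMonoidHom.comp (affineRep (period₁ c) (period₂ c))
    have hρ : Function.Injective ρ :=
      (MulAut.conj C⁻¹).injective.comp (affineRep_injective hlin)
    have hrange : ρ.range = monodromyGroup (puncturedLine c) P hP Y hY.analyticAt := by
      ext T
      rw [hconj, ← mem_range_affineRep]
      constructor
      · rintro ⟨g, rfl⟩
        exact ⟨g, by simp [ρ, mul_assoc]⟩
      · rintro ⟨g, hg⟩
        refine ⟨g, ?_⟩
        simp [ρ, hg, mul_assoc]
    exact ⟨((MonoidHom.ofInjective hρ).trans (MulEquiv.subgroupCongr hrange)).symm⟩
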